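/- **Subordination integral formula for space-time fractional diffusion.** Let $0<\alpha\le 2$, $|\theta|\le\min\{\alpha,2-\alpha\}$, $0<\beta\le 1$, and $\psi_\alpha^\theta(\kappa)=|\kappa|^\alpha e^{i(\operatorname{sign}\kappa)\theta\pi/2}$. Write $\hat f(\kappa)=\int_{\mathbb R}e^{i\kappa x}f(x)\,dx$. *The Cauchy problem.* Consider ${}_tD_*^\beta u={}_xD_\theta^\alpha u$, $u(x,0)=\delta(x)$, where ${}_xD^\alpha_\theta$ is the Riesz–Feller derivative, $\widehat{{}_xD_\theta^\alpha f}=-\psi_\alpha^\theta\hat f$, and ${}_tD_*^\beta$ is the Caputo derivative, ${}_tD_*^\beta g(t)=\frac1{\Gamma(1-\beta)}\int_0^t(t-\tau)^{-\beta}g'(\tau)\,d\tau$ for $\beta<1$ and $g'(t)$ for $\beta=1$. A *fundamental solution* is a family $(u_t)_{t>0}$ of finite signed measures on $\mathbb R$, with total variation bounded on every $(0,T]$, such that for every Schwartz function $\varphi$ the function $g(t)=\int\varphi\,du_t$ ($t>0$), $g(0)=\varphi(0)$, is continuous on $[0,\infty)$, differentiable on $(0,\infty)$, with $g'$ (and,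 if $\beta<1$, $\tau\mapsto(t-\tau)^{-\beta}g'(\tau)$) integrable on $(0,t)$ for every $t>0$, and $${}_tD_*^\beta g(t)=\int {}_xD_{-\theta}^\alpha\varphi\,du_t\qquad(t>0).$$ (${}_xD^\alpha_{-\theta}$ is the transpose of ${}_xD^\alpha_\theta$.) A function $u(x,t)$ with $u(\cdot,t)\in L^1(\mathbb R)$ for all $t>0$ is a fundamental solution if the measures $u(x,t)\,dx$ are. *The two densities.* For $t_*>0$, $t>0$ let $$f_{\alpha,\theta}(x,t_*)=t_*^{-1/\alpha}L_\alpha^\theta\!\left(x/t_*^{1/\alpha}\right),\quad L_\alpha^\theta(x)=\frac1{2\pi}\int_{\mathbb R}e^{-i\kappa x}e^{-\psi_\alpha^\theta(\kappa)}\,d\kappa\qquad(|\theta|<1),$$ $$q_\beta(t_*,t)=t^{-\beta}M_\beta(t_*/t^\beta),\quad M_\beta(z)=\sum_{n\ge0}\frac{(-z)^n}{n!\,\Gamma(-\beta n+1-\beta)}\qquad(\beta<1),$$ the second also for $t_*=0$. In the singular cases, $f_{1,\pm1}(\cdot,t_*)$ denotes the unit mass at $\mp t_*$ (note that $|\theta|=1$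 forces $\alpha=1$) and $q_1(\cdot,t)$ the unit mass at $t$. Then the following hold. 1. If $|\theta|<1$, then for every $t_*>0$ the function $f_{\alpha,\theta}(\cdot,t_*)$ is a (stable) probability density with Fourier transform $e^{-t_*\psi_\alpha^\theta(\kappa)}$. 2. If $\beta<1$, then for every $t>0$ the function $q_\beta(\cdot,t)$ is a probability density on $(0,\infty)$, nonnegative also at $t_*=0$, and for all $t_*\ge0$ and $\operatorname{Re}s>0$ $$\int_0^\infty e^{-st}q_\beta(t_*,t)\,dt=s^{\beta-1}e^{-t_*s^\beta},$$ the integral converging absolutely. 3. For all parameters in the above range there is exactly one fundamental solution, and it is given by $$u_t(A)=\int_{(0,\infty)}f_{\alpha,\theta}(A,t_*)\,q_\beta(dt_*,t)\qquad(t>0,\ A\subseteq\mathbb R\text{ Borel}),$$ where $f_{\alpha,\theta}(\cdot,t_*)$ and $q_\beta(\cdot,t)$ are understood as probability measures. 4. Let $|\theta|<1$ and $\beta<1$. For every $t>0$ the integral $$G(x,t)=\int_0^\infty f_{\alpha,\theta}(x,t_*)\,q_\beta(t_*,t)\,dt_*$$ converges absolutely for every $x\ne0$, and also for $x=0$ if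 $\alpha>1$, and $G(\cdot,t)\in L^1(\mathbb R)$. A function $u$ with $u(\cdot,t)\in L^1(\mathbb R)$ for all $t>0$ is a fundamental solution if and only if, for every $t>0$, $u(x,t)=G(x,t)$ for almost every $x$. For such a fundamental solution $u$, $u(x,t)=G(x,t)$ holds at every $x$ at which $u(\cdot,t)$ is continuous and which satisfies $x\neq0$ or $\alpha>1$. -/

import Mathlib

open MeasureTheory Set
open scoped SchwartzMap NNReal

noncomputable section

namespace STFD

/-- The symbol `ψ_α^θ(κ) = |κ|^α exp(i (sign κ) θ π / 2)`. -/
def symbol (α θ κ : ℝ) : ℂ :=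
  ((|κ| ^ α : ℝ) : ℂ) * Complex.exp (Complex.I * (Real.sign κ : ℂ) * (θ : ℂ) * (Real.pi : ℂ) / 2)

/-- The Fourier transform `∫ exp(+iκx) f(x) dx`. -/
def fourierPlus (f : ℝ → ℂ) (κ : ℝ) : ℂ :=
  ∫ x : ℝ, Complex.exp (Complex.I * (κ : ℂ) * (x : ℂ)) * f x

/-- The inverse Fourier transform `(2π)⁻¹ ∫ exp(-iκx) g(κ) dκ`. -/
def fourierPlusInv (g : ℝ → ℂ) (x : ℝ) : ℂ :=
  (2 * (Real.pi : ℂ))⁻¹ * ∫ κ : ℝ, Complex.exp (-(Complex.I * (κ : ℂ) * (x : ℂ))) * g κ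

/-- The Riesz–Feller derivative of order `α` and skewness `θ`: the pseudo-differential operator
with symbol `-ψ_α^θ`. It is applied to Schwartz functions only. -/
def rieszFeller (α θ : ℝ) (f : ℝ → ℂ) : ℝ → ℂ :=
  fourierPlusInv fun κ => -symbol α θ κ * fourierPlus f κ

/-- The Caputo derivative of order `β ∈ (0, 1]` at time `t > 0`. -/
def caputoDeriv (β : ℝ) (g : ℝ → ℂ) (t : ℝ) : ℂ :=
  if β = 1 then deriv g t
  else (((Real.Gamma (1 - β))⁻¹ : ℝ) : ℂ) *
    ∫ τ in (0 : ℝ)..t, (((t - τ) ^ (-β) : ℝ) : ℂ) * deriv g τ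

/-- The regularity that gives a meaning to the Caputo derivative at all times `t > 0`: `g` is
continuous on `[0, ∞)` and differentiable on `(0, ∞)`, and `g'` as well as (for `β < 1`) the
integrand of the Caputo derivative are integrable. -/
structure CaputoRegular (β : ℝ) (g : ℝ → ℂ) : Prop where
  continuousOn : ContinuousOn g (Ici 0)
  differentiableAt : ∀ t : ℝ, 0 < t → DifferentiableAt ℝ g t
  integrable_deriv : ∀ t : ℝ, 0 < t → IntervalIntegrable (deriv g) volume 0 t
  integrable_kernel : β < 1 → ∀ t : ℝ, 0 < t →
    IntervalIntegrable (fun τ => (((t - τ) ^ (-β) : ℝ) : ℂ) * deriv g τ) volume 0 t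

/-- The pairing `⟨u(·, t), φ⟩` for `t > 0`, with the value `⟨δ, φ⟩ = φ 0` at the initial time. -/
def pairing (μ : ℝ → SignedMeasure ℝ) (φ : 𝓢(ℝ, ℂ)) (t : ℝ) : ℂ :=
  if t ≤ 0 then φ 0 else ∫ᵛ x, φ x ∂<•(μ t)

/-- `μ t` (`t > 0`) is a weak solution of the Cauchy problem for the space-time fractional
diffusion equation (Caputo derivative of order `β` in time, Riesz–Feller derivative of order `α`
and skewness `θ` in space) with initial value `δ`. The transpose of the Riesz–Feller operator of
skewness `θ` is the one of skewness `-θ`. The initial condition is contained in the continuity of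
`pairing μ φ` at time `0`. -/
structure IsFundamentalSolution (α θ β : ℝ) (μ : ℝ → SignedMeasure ℝ) : Prop where
  locally_bounded : ∀ T : ℝ, 0 < T → ∃ C : ℝ≥0, ∀ t ∈ Ioc 0 T, (μ t).variation univ ≤ C
  regular : ∀ φ : 𝓢(ℝ, ℂ), CaputoRegular β (pairing μ φ)
  equation : ∀ φ : 𝓢(ℝ, ℂ), ∀ t : ℝ, 0 < t →
    caputoDeriv β (pairing μ φ) t = ∫ᵛ x, rieszFeller α (-θ) φ x ∂<•(μ t)

/-- The stable density `L_α^θ` with characteristic function `exp(-ψ_α^θ)`, for `|θ| < 1`. The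
inverse Fourier integral is real, since its integrand at `-κ` is conjugate to that at `κ`. -/
def stableDensity (α θ x : ℝ) : ℝ :=
  (fourierPlusInv (fun κ => Complex.exp (-symbol α θ κ)) x).re

/-- `f_{α,θ}(x, τ) = τ^{-1/α} L_α^θ(x / τ^{1/α})`. -/
def parentDensity (α θ x τ : ℝ) : ℝ :=
  τ ^ (-(1 / α)) * stableDensity α θ (x / τ ^ (1 / α))

/-- The law with density `f_{α,θ}(·, τ)`; in the degenerate case `|θ| = 1` (which forces `α = 1`),
`L_1^{±1}(x) = δ(x ± 1)` and the law is the unit mass at `-θ τ`. -/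
def parentLaw (α θ τ : ℝ) : Measure ℝ :=
  if |θ| = 1 then Measure.dirac (-(θ * τ))
  else volume.withDensity fun x => ENNReal.ofReal (parentDensity α θ x τ)

/-- The Wright function `W_{l,m}(z) = ∑ zⁿ / (n! Γ(l n + m))`; at the poles of `Γ` the value of
`Real.Gamma` is `0`, so that `1 / Γ` vanishes there as it should. -/
def wright (l m z : ℝ) : ℝ :=
  ∑' n : ℕ, z ^ n / ((n.factorial : ℝ) * Real.Gamma (l * n + m))

/-- The `M`-Wright function `M_ν(z) = W_{-ν,1-ν}(-z)`, `0 < ν < 1`. -/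
def wrightM (ν z : ℝ) : ℝ := wright (-ν) (1 - ν) (-z)

/-- `q_β(τ, t) = t^{-β} M_β(τ / t^β)`, for `0 < β < 1`. -/
def operationalDensity (β τ t : ℝ) : ℝ := t ^ (-β) * wrightM β (τ / t ^ β)

/-- The law on `(0, ∞)` with density `q_β(·, t)`; for `β = 1` one has `M_1(z) = δ(z - 1)` and the
law is the unit mass at `t`. -/
def operationalLaw (β t : ℝ) : Measure ℝ :=
  if β = 1 then Measure.dirac t
  else (volume.restrict (Ioi 0)).withDensity fun τ => ENNReal.ofReal (operationalDensity β τ t)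

end STFD

end

open Filter Topology

noncomputable section

namespace STFD

/-! In Fourier variables the problem decouples: for each `κ` the characteristic function solves the
Caputo relaxation equation with rate `ψ(κ)` and initial value `1`. The solution is `relax β ψ(κ) t =
∫ exp(-ψ(κ) τ) q_β(dτ, t)`, usually written `E_β(-ψ(κ) t^β)`. Since `exp(-τ ψ(κ))` is the
characteristic function of the stable law at operational time `τ`, the mixture of these laws under
`q_β(·, t)` has exactly this characteristic function (`integral_exp_subordinatedLaw`).

Positivity is obtained without Bochner's theorem. `PosMult` contains the characters and the
nonnegative constants and is closed under sums, products, exponentials and pointwise limits.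
Fractional powers `s^a` are limits of `h^{-a} (1 - e^{-hs})^a`, and the signs of the binomial
coefficients put `exp(-c s^a)` for `0 ≤ a ≤ 1` and `exp(c s^a)` for `1 ≤ a ≤ 2` into this class
(`posMult_exp_neg_cpow`, `posMult_exp_cpow`). The condition `|θ| ≤ min α (2 - α)` says that `ψ` is a
combination of `(iκ)^α` and `(-iκ)^α` with coefficients of the right sign (`symbol_eq_cpow`). A
bounded function with nonnegative Fourier transform has an integrable one
(`integrable_fourierPlusInv_re`), so inversion yields the stable probability density.

For `q_β`, the Wright series sums to an integral along a ray in the left half-plane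
(`operationalDensity_eq_ray`). Turning the ray to the imaginary axis exhibits `q_β(τ, ·)` as an
inverse Fourier transform of `s^{β-1} exp(-τ s^β)`, which is positive by the multiplier argument.
Shifting the contour identifies the Laplace transform in `t` (`laplace_operationalDensity`), from
which total mass, moments and the Laplace transform of `relax` follow.

Existence: injectivity of the Laplace transform gives the relaxation equation (`caputo_relax`),
which is integrated against the Fourier transform of a test function. Uniqueness: inserting
truncated characters into the weak equation and inverting the Caputo derivative gives an
Abel–Volterra equation for the characteristic function (`IsFundamentalSolution.volterra`). The
difference of two solutions is a bounded solution of the homogeneous equation, hence zero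
(`eq_zero_of_volterra`), and characteristic functions determine signed measures.

The pointwise statements on densities rest on two bounds uniform in the operational time, `f ≤ C
τ^{-1/α}` and `|x| f ≤ C` (`exists_parentDensity_le`). They dominate the subordination integral near
every admissible `x` and make it continuous there. -/

/-! ### Multipliers preserving nonnegativity of the Fourier transform -/

/-- An integrable function whose Fourier transform has nonnegative real part. -/
def FourierNonneg (w : ℝ → ℂ) : Prop :=
  Integrable w ∧ ∀ x : ℝ, 0 ≤ (∫ κ : ℝ, Complex.exp (-(Complex.I * κ * x)) * w κ).re

/-- Multipliers that preserve `FourierNonneg`, dominated by their value at the origin. They play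
the role of the characteristic functions of finite measures. -/
structure PosMult (g : ℝ → ℂ) : Prop where
  measurable : Measurable g
  bound : ∀ κ, ‖g κ‖ ≤ (g 0).re
  mul_fourierNonneg : ∀ w, FourierNonneg w → FourierNonneg fun κ => g κ * w κ

lemma norm_exp_I_mul (κ x : ℝ) : ‖Complex.exp (-(Complex.I * κ * x))‖ = 1 := by
  rw [Complex.norm_exp]; simp

lemma norm_exp_I_mul' (κ x : ℝ) : ‖Complex.exp (Complex.I * κ * x)‖ = 1 := by
  rw [Complex.norm_exp]; simp

lemma integrable_exp_I_mul {w : ℝ → ℂ} (hw : Integrable w) (x : ℝ) :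
    Integrable fun κ : ℝ => Complex.exp (-(Complex.I * κ * x)) * w κ :=
  hw.bdd_mul (c := 1) (Continuous.aestronglyMeasurable (by fun_prop))
    (Eventually.of_forall fun κ => (norm_exp_I_mul κ x).le)

lemma integrable_exp_I_mul' {w : ℝ → ℂ} (hw : Integrable w) (x : ℝ) :
    Integrable fun κ : ℝ => Complex.exp (Complex.I * x * κ) * w κ :=
  hw.bdd_mul (c := 1) (Continuous.aestronglyMeasurable (by fun_prop))
    (Eventually.of_forall fun κ => (norm_exp_I_mul' x κ).le)

namespace FourierNonneg

lemma add {v w : ℝ → ℂ} (hv : FourierNonneg v) (hw : FourierNonneg w) :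
    FourierNonneg fun κ => v κ + w κ := by
  refine ⟨hv.1.add hw.1, fun x => ?_⟩
  simp_rw [mul_add]
  rw [integral_add (integrable_exp_I_mul hv.1 x) (integrable_exp_I_mul hw.1 x), Complex.add_re]
  exact add_nonneg (hv.2 x) (hw.2 x)

lemma of_tendsto {w : ℕ → ℝ → ℂ} {v : ℝ → ℂ} {b : ℝ → ℝ} (hw : ∀ n, FourierNonneg (w n))
    (hb : Integrable b) (hwb : ∀ n, ∀ᵐ κ, ‖w n κ‖ ≤ b κ)
    (hv : ∀ᵐ κ, Tendsto (fun n => w n κ) atTop (𝓝 (v κ))) : FourierNonneg v := by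
  have hvm : AEStronglyMeasurable v volume :=
    aestronglyMeasurable_of_tendsto_ae atTop (fun n => (hw n).1.1) hv
  refine ⟨hb.mono' hvm ?_, fun x => ?_⟩
  · filter_upwards [hv, ae_all_iff.2 hwb] with κ h1 h2
    exact le_of_tendsto h1.norm (Eventually.of_forall h2)
  · have h := tendsto_integral_of_dominated_convergence (μ := volume) b
      (F := fun n κ => Complex.exp (-(Complex.I * (κ : ℝ) * x)) * w n κ)
      (f := fun κ => Complex.exp (-(Complex.I * (κ : ℝ) * x)) * v κ)
      (fun n => (integrable_exp_I_mul (hw n).1 x).1) hb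
      (fun n => by
        filter_upwards [hwb n] with κ h
        rwa [norm_mul, norm_exp_I_mul, one_mul])
      (by filter_upwards [hv] with κ h using h.const_mul _)
    exact ge_of_tendsto ((Complex.continuous_re.tendsto _).comp h)
      (Eventually.of_forall fun n => (hw n).2 x)

lemma gaussian {b : ℝ} (hb : 0 < b) :
    FourierNonneg fun κ : ℝ => Complex.exp (-(b : ℂ) * (κ : ℂ) ^ 2) := by
  refine ⟨integrable_cexp_neg_mul_sq (by simpa using hb), fun x => ?_⟩
  have h := fourierIntegral_gaussian (b := (b : ℂ)) (by simpa using hb) (-(x : ℂ))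
  have h2 : (∫ κ : ℝ, Complex.exp (-(Complex.I * κ * x)) * Complex.exp (-(b : ℂ) * (κ : ℂ) ^ 2)) =
      (((Real.pi / b) ^ (1 / 2 : ℝ) * Real.exp (-x ^ 2 / (4 * b)) : ℝ) : ℂ) := by
    have e : ((((Real.pi / b) ^ (1 / 2 : ℝ) : ℝ)) : ℂ) = ((Real.pi : ℂ) / b) ^ (1 / 2 : ℂ) := by
      rw [Complex.ofReal_cpow (by positivity)]; push_cast; rfl
    rw [Complex.ofReal_mul, e]
    convert h using 1
    · congr 1; ext κ; congr 2; ring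
    · push_cast; congr 3; ring
  rw [h2, Complex.ofReal_re]
  positivity

end FourierNonneg

namespace PosMult

/-- The bound at the origin forces equality in `|re| ≤ ‖·‖`, so the imaginary part vanishes. This is
what makes the bound multiplicative. -/
lemma ofReal_re_zero {g : ℝ → ℂ} (hg : PosMult g) : g 0 = ((g 0).re : ℂ) := by
  have h1 := hg.bound 0
  have h2 := Complex.abs_re_le_norm (g 0)
  have h3 : |(g 0).re| = ‖g 0‖ := le_antisymm h2 (h1.trans (le_abs_self _))
  exact Complex.ext (by simp) (by simpa using Complex.abs_re_eq_norm.1 h3)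

lemma mul {f g : ℝ → ℂ} (hf : PosMult f) (hg : PosMult g) : PosMult fun κ => f κ * g κ where
  measurable := hf.measurable.mul hg.measurable
  bound κ := by
    rw [hf.ofReal_re_zero, hg.ofReal_re_zero, norm_mul, ← Complex.ofReal_mul, Complex.ofReal_re]
    exact mul_le_mul (hf.bound κ) (hg.bound κ) (norm_nonneg _)
      ((norm_nonneg _).trans (hf.bound κ))
  mul_fourierNonneg w hw := by
    simp_rw [mul_assoc]
    exact hf.mul_fourierNonneg _ (hg.mul_fourierNonneg _ hw)

lemma add {f g : ℝ → ℂ} (hf : PosMult f) (hg : PosMult g) : PosMult fun κ => f κ + g κ where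
  measurable := hf.measurable.add hg.measurable
  bound κ := (norm_add_le _ _).trans (by
    rw [Complex.add_re]; exact add_le_add (hf.bound κ) (hg.bound κ))
  mul_fourierNonneg w hw := by
    simp_rw [add_mul]
    exact (hf.mul_fourierNonneg _ hw).add (hg.mul_fourierNonneg _ hw)

lemma const {c : ℝ} (hc : 0 ≤ c) : PosMult fun _ => (c : ℂ) where
  measurable := measurable_const
  bound κ := by simp [abs_of_nonneg hc]
  mul_fourierNonneg w hw := by
    refine ⟨hw.1.const_mul _, fun x => ?_⟩
    have : ∀ κ : ℝ, Complex.exp (-(Complex.I * κ * x)) * ((c : ℂ) * w κ) =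
      (c : ℂ) * (Complex.exp (-(Complex.I * κ * x)) * w κ) := fun κ => by ring
    simp_rw [this]
    rw [integral_const_mul, Complex.re_ofReal_mul]
    exact mul_nonneg hc (hw.2 x)

lemma char (a : ℝ) : PosMult fun κ : ℝ => Complex.exp (Complex.I * a * κ) where
  measurable := by fun_prop
  bound κ := by rw [norm_exp_I_mul' a κ]; simp
  mul_fourierNonneg w hw := by
    refine ⟨integrable_exp_I_mul' hw.1 a, fun x => ?_⟩
    have : ∀ κ : ℝ, Complex.exp (-(Complex.I * κ * x)) * (Complex.exp (Complex.I * a * κ) * w κ) =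
        Complex.exp (-(Complex.I * κ * ((x - a : ℝ) : ℂ))) * w κ := fun κ => by
      rw [← mul_assoc, ← Complex.exp_add]; congr 2; push_cast; ring
    simp_rw [this]
    exact hw.2 _

lemma sum {f : ℕ → ℝ → ℂ} (hf : ∀ k, PosMult (f k)) (n : ℕ) :
    PosMult fun κ => ∑ k ∈ Finset.range n, f k κ := by
  induction n with
  | zero => simpa using const le_rfl
  | succ n ih => simp_rw [Finset.sum_range_succ]; exact ih.add (hf n)

lemma pow {f : ℝ → ℂ} (hf : PosMult f) (n : ℕ) : PosMult fun κ => f κ ^ n := by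
  induction n with
  | zero => simpa using const zero_le_one
  | succ n ih => simp_rw [pow_succ]; exact ih.mul hf

/-- Convergence at the origin alone bounds the whole sequence uniformly in `κ`, so a multiple of
`‖w‖` dominates. This replaces Lévy's continuity theorem. -/
lemma of_tendsto {g : ℕ → ℝ → ℂ} {f : ℝ → ℂ} (hg : ∀ n, PosMult (g n))
    (h : ∀ κ, Tendsto (fun n => g n κ) atTop (𝓝 (f κ))) : PosMult f := by
  have h0 : Tendsto (fun n => (g n 0).re) atTop (𝓝 (f 0).re) :=
    (Complex.continuous_re.tendsto _).comp (h 0)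
  obtain ⟨C, hC⟩ := h0.bddAbove_range
  refine ⟨measurable_of_tendsto_metrizable (fun n => (hg n).measurable) (tendsto_pi_nhds.2 h),
    fun κ => le_of_tendsto_of_tendsto (h κ).norm h0 (Eventually.of_forall fun n => (hg n).bound κ),
    fun w hw => ?_⟩
  refine FourierNonneg.of_tendsto (b := fun κ => C * ‖w κ‖)
    (fun n => (hg n).mul_fourierNonneg w hw) (hw.1.norm.const_mul C)
    (fun n => Eventually.of_forall fun κ => ?_)
    (Eventually.of_forall fun κ => (h κ).mul_const _)
  rw [norm_mul]
  exact mul_le_mul_of_nonneg_right (((hg n).bound κ).trans (hC ⟨n, rfl⟩)) (norm_nonneg _)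

lemma of_tendsto_filter {ι : Type*} {l : Filter ι} [l.IsCountablyGenerated] [l.NeBot]
    {g : ι → ℝ → ℂ} {f : ℝ → ℂ} (hg : ∀ᶠ i in l, PosMult (g i))
    (h : ∀ κ, Tendsto (fun i => g i κ) l (𝓝 (f κ))) : PosMult f := by
  obtain ⟨u, hu⟩ := exists_seq_tendsto l
  obtain ⟨N, hN⟩ := eventually_atTop.1 (hu.eventually hg)
  exact of_tendsto (g := fun n => g (u (n + N))) (fun n => hN _ (Nat.le_add_left _ _))
    fun κ => (h κ).comp (hu.comp (tendsto_add_atTop_nat N))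

lemma of_hasSum {g : ℕ → ℝ → ℂ} {f : ℝ → ℂ} (hg : ∀ n, PosMult (g n))
    (h : ∀ κ, HasSum (fun n => g n κ) (f κ)) : PosMult f :=
  of_tendsto (fun n => sum hg n) fun κ => (h κ).tendsto_sum_nat

lemma exp {g : ℝ → ℂ} (hg : PosMult g) : PosMult fun κ => Complex.exp (g κ) := by
  refine of_hasSum (g := fun n κ => (((n.factorial : ℝ)⁻¹ : ℝ) : ℂ) * g κ ^ n)
    (fun n => (const (by positivity)).mul (hg.pow n)) fun κ => ?_
  have := NormedSpace.expSeries_div_hasSum_exp (g κ)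
  rw [← Complex.exp_eq_exp_ℂ] at this
  refine this.congr_fun ?_
  intro n
  push_cast
  field_simp

/-- The factor `e^{-c}` is a positive constant, so the constant term of an exponent may have any
sign. These are the compound Poisson multipliers. -/
lemma exp_sub {g : ℝ → ℂ} (hg : PosMult g) (c : ℝ) :
    PosMult fun κ => Complex.exp (g κ - c) := by
  have := (const (Real.exp_pos (-c)).le).mul hg.exp
  convert this using 2 with κ
  rw [Complex.ofReal_exp, ← Complex.exp_add]; congr 1; push_cast; ring

/-- The constant `1` is not integrable, so the multiplier is applied to ever wider Gaussians
`exp(-κ²/(n+1))` instead, with `‖g‖` as majorant. -/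
lemma fourierNonneg {g : ℝ → ℂ} (hg : PosMult g) (hi : Integrable g) : FourierNonneg g := by
  refine FourierNonneg.of_tendsto (b := fun κ => ‖g κ‖)
    (w := fun n κ => g κ * Complex.exp (-((1 / ((n : ℝ) + 1) : ℝ) : ℂ) * (κ : ℂ) ^ 2))
    (fun n => hg.mul_fourierNonneg _ (FourierNonneg.gaussian (by positivity))) hi.norm
    (fun n => Eventually.of_forall fun κ => ?_) (Eventually.of_forall fun κ => ?_)
  · rw [norm_mul]
    refine mul_le_of_le_one_right (norm_nonneg _) ?_
    rw [Complex.norm_exp, Real.exp_le_one_iff]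
    have : (-((1 / ((n : ℝ) + 1) : ℝ) : ℂ) * (κ : ℂ) ^ 2) =
      ((-(1 / ((n : ℝ) + 1)) * κ ^ 2 : ℝ) : ℂ) := by push_cast; ring
    rw [this, Complex.ofReal_re, neg_mul, neg_nonpos]
    positivity
  · have h1 : Tendsto (fun n : ℕ => -(((1 / ((n : ℝ) + 1) : ℝ)) : ℂ)) atTop (𝓝 (-((0 : ℝ) : ℂ))) :=
      ((Complex.continuous_ofReal.tendsto _).comp tendsto_one_div_add_atTop_nhds_zero_nat).neg
    have h2 := ((Complex.continuous_exp.tendsto _).comp (h1.mul_const ((κ : ℂ) ^ 2))).const_mul (g κ)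
    simpa using h2

end PosMult

/-! ### Signs of the binomial coefficients of `(1 - z) ^ a` -/

/-- The coefficients of the power series of `(1 - z) ^ a`. -/
def binomCoeff (a : ℝ) (k : ℕ) : ℝ := (-1) ^ k * Ring.choose a k

lemma binomCoeff_zero (a : ℝ) : binomCoeff a 0 = 1 := by simp [binomCoeff]

lemma binomCoeff_succ (a : ℝ) (k : ℕ) :
    binomCoeff a (k + 1) = binomCoeff a k * ((k - a) / (k + 1)) := by
  have h1 := Ring.descPochhammer_eq_factorial_smul_choose a k
  have h2 := Ring.descPochhammer_eq_factorial_smul_choose a (k + 1)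
  rw [descPochhammer_succ_right, Polynomial.smeval_mul, h1] at h2
  simp only [Polynomial.smeval_sub, Polynomial.smeval_X, pow_one, Polynomial.smeval_natCast,
    pow_zero, nsmul_eq_mul, mul_one, Nat.factorial_succ, Nat.cast_mul] at h2
  have hk : (0 : ℝ) < k.factorial := by exact_mod_cast k.factorial_pos
  have h3 : ((k : ℝ) + 1) * Ring.choose a (k + 1) = Ring.choose a k * (a - k) := by
    apply mul_left_cancel₀ hk.ne'
    push_cast at h2
    linarith
  have h4 : Ring.choose a (k + 1) = Ring.choose a k * (a - k) / (k + 1) := by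
    rw [eq_div_iff (by positivity)]; linarith
  rw [binomCoeff, binomCoeff, h4]
  ring

lemma binomCoeff_one (a : ℝ) : binomCoeff a 1 = -a := by
  have := binomCoeff_succ a 0
  simpa [binomCoeff_zero] using this

lemma binomCoeff_nonneg_of_nonpos {a : ℝ} (ha : a ≤ 0) (k : ℕ) : 0 ≤ binomCoeff a k := by
  induction k with
  | zero => simp [binomCoeff_zero]
  | succ k ih =>
    rw [binomCoeff_succ]
    have : (0 : ℝ) ≤ k - a := by have := k.cast_nonneg (α := ℝ); linarith
    positivity

lemma binomCoeff_succ_nonpos {a : ℝ} (ha : 0 ≤ a) (ha1 : a ≤ 1) (k : ℕ) :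
    binomCoeff a (k + 1) ≤ 0 := by
  induction k with
  | zero => rw [binomCoeff_one]; linarith
  | succ k ih =>
    rw [binomCoeff_succ]
    have h : (0 : ℝ) ≤ (k + 1 : ℕ) - a := by
      push_cast; have := k.cast_nonneg (α := ℝ); linarith
    exact mul_nonpos_of_nonpos_of_nonneg ih (by positivity)

/-- The coefficient of index `2` is `a (a - 1) / 2`, and from there on the ratio `(k - a) / (k + 1)`
is nonnegative because `a ≤ 2`. -/
lemma binomCoeff_add_two_nonneg {a : ℝ} (ha : 1 ≤ a) (ha1 : a ≤ 2) (k : ℕ) :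
    0 ≤ binomCoeff a (k + 2) := by
  induction k with
  | zero =>
    rw [binomCoeff_succ, binomCoeff_one]
    push_cast
    nlinarith
  | succ k ih =>
    rw [binomCoeff_succ]
    have h : (0 : ℝ) ≤ (k + 2 : ℕ) - a := by
      push_cast; have := k.cast_nonneg (α := ℝ); linarith
    positivity

lemma hasSum_binomCoeff (a : ℝ) {z : ℂ} (hz : ‖z‖ < 1) :
    HasSum (fun k => (binomCoeff a k : ℂ) * z ^ k) ((1 - z) ^ (a : ℂ)) := by
  have h := (Complex.one_add_cpow_hasFPowerSeriesOnBall_zero (a := (a : ℂ))).hasSum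
    (y := -z) (by
      have hz' : ‖z‖₊ < 1 := hz
      simpa [Metric.mem_eball, edist_zero_right, enorm_eq_nnnorm] using hz')
  simp only [zero_add, binomialSeries_apply, List.ofFn_const, List.prod_replicate,
    smul_eq_mul] at h
  rw [sub_eq_add_neg]
  refine h.congr_fun fun k => ?_
  rw [binomCoeff, neg_pow z]
  push_cast
  ring

/-! ### Exponentials of fractional powers as limits of compound Poisson multipliers -/

/-- The point `exp(-h (ε + i σ κ))` of the open unit disc. -/
def diskPoint (h ε σ κ : ℝ) : ℂ := Complex.exp (-(h * (ε + Complex.I * σ * κ)))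

lemma norm_diskPoint_lt_one {h ε : ℝ} (hh : 0 < h) (hε : 0 < ε) (σ κ : ℝ) :
    ‖diskPoint h ε σ κ‖ < 1 := by
  rw [diskPoint, Complex.norm_exp, Real.exp_lt_one_iff]
  simp
  positivity

lemma posMult_diskPoint (h ε σ : ℝ) : PosMult (diskPoint h ε σ) := by
  have := (PosMult.const (Real.exp_pos (-(h * ε))).le).mul (PosMult.char (-(h * σ)))
  convert this using 2 with κ
  rw [diskPoint, Complex.ofReal_exp, ← Complex.exp_add]
  congr 1; push_cast; ring

/-- The inverse may leave the disc, but it is still a positive constant times a character. -/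
lemma posMult_diskPoint_inv (h ε σ : ℝ) : PosMult fun κ => (diskPoint h ε σ κ)⁻¹ := by
  have := posMult_diskPoint (-h) ε σ
  convert this using 2 with κ
  rw [diskPoint, diskPoint, ← Complex.exp_neg]
  congr 1; push_cast; ring

lemma ofReal_mul_cpow {r : ℝ} (hr : 0 < r) (z : ℂ) (a : ℝ) :
    ((r : ℂ) * z) ^ (a : ℂ) = ((r ^ a : ℝ) : ℂ) * z ^ (a : ℂ) := by
  rcases eq_or_ne z 0 with rfl | hz
  · rcases eq_or_ne a 0 with rfl | ha
    · simp
    · simp [ha]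
  · have hr' : (r : ℂ) ≠ 0 := by exact_mod_cast hr.ne'
    rw [Complex.ofReal_cpow hr.le, Complex.cpow_def_of_ne_zero (mul_ne_zero hr' hz),
      Complex.cpow_def_of_ne_zero hr', Complex.cpow_def_of_ne_zero hz,
      Complex.log_ofReal_mul hr hz, ← Complex.ofReal_log hr.le, add_mul, Complex.exp_add]

/-- The difference quotient that approximates `(ε + i σ κ) ^ a`. -/
def diffQuot (a ε σ : ℝ) (n : ℕ) (κ : ℝ) : ℂ :=
  ((((n : ℝ) + 1) ^ a : ℝ) : ℂ) * (1 - diskPoint (1 / ((n : ℝ) + 1)) ε σ κ) ^ (a : ℂ)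

lemma add_mem_slitPlane {ε : ℝ} (hε : 0 < ε) (σ κ : ℝ) :
    (ε + Complex.I * σ * κ : ℂ) ∈ Complex.slitPlane := by
  left; simpa using hε

/-- A positive factor moves inside the power. There `(1 - e^{-hs}) / h` is a difference quotient at
`0` of `u ↦ 1 - e^{-us}`, with limit `s` in the slit plane, where the power is continuous. -/
lemma tendsto_diffQuot (a : ℝ) {ε : ℝ} (hε : 0 < ε) (σ κ : ℝ) :
    Tendsto (fun n => diffQuot a ε σ n κ) atTop (𝓝 ((ε + Complex.I * σ * κ) ^ (a : ℂ))) := by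
  set s : ℂ := ε + Complex.I * σ * κ with hs
  have hd : HasDerivAt (fun u : ℂ => 1 - Complex.exp (-(u * s))) s 0 := by
    have h1 : HasDerivAt (fun u : ℂ => -(u * s)) (-(1 * s)) 0 := ((hasDerivAt_id (0 : ℂ)).mul_const s).neg
    have := (h1.cexp.const_sub 1)
    simpa using this
  have h0 : Tendsto (fun n : ℕ => ((1 / ((n : ℝ) + 1) : ℝ) : ℂ)) atTop (𝓝[≠] 0) := by
    refine tendsto_nhdsWithin_iff.2 ⟨?_, Eventually.of_forall fun n => ?_⟩
    · have := (Complex.continuous_ofReal.tendsto _).comp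
        (tendsto_one_div_add_atTop_nhds_zero_nat (𝕜 := ℝ))
      simpa [Function.comp_def] using this
    · have : (1 / ((n : ℝ) + 1)) ≠ 0 := by positivity
      exact Complex.ofReal_ne_zero.2 this
  have h1 := (hasDerivAt_iff_tendsto_slope.1 hd).comp h0
  have h2 := (((continuousAt_cpow_const (b := (a : ℂ)) (add_mem_slitPlane hε σ κ)).tendsto).comp h1)
  refine h2.congr fun n => ?_
  simp only [Function.comp_apply, slope, vsub_eq_sub, sub_zero, zero_mul, neg_zero,
    Complex.exp_zero, sub_self, smul_eq_mul, diffQuot]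
  rw [← ofReal_mul_cpow (by positivity)]
  congr 1
  rw [diskPoint, ← hs]
  push_cast
  simp

lemma posMult_cpow_of_nonpos {a : ℝ} (ha : a ≤ 0) {ε : ℝ} (hε : 0 < ε) (σ : ℝ) :
    PosMult fun κ : ℝ => (ε + Complex.I * σ * κ : ℂ) ^ (a : ℂ) := by
  refine PosMult.of_tendsto (fun n => ?_) fun κ => tendsto_diffQuot a hε σ κ
  refine (PosMult.const (by positivity)).mul ?_
  exact PosMult.of_hasSum
    (fun k => (PosMult.const (binomCoeff_nonneg_of_nonpos ha k)).mul ((posMult_diskPoint _ ε σ).pow k))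
    fun κ => hasSum_binomCoeff a (norm_diskPoint_lt_one (by positivity) hε σ κ)

/-- With `z` in the disc, `1 - (1 - z)^a` has only nonnegative coefficients for `0 ≤ a ≤ 1`. The
remaining constant `-c h^{-a}` in the exponent is absorbed by `PosMult.exp_sub`. -/
lemma posMult_exp_neg_cpow {a : ℝ} (ha : 0 ≤ a) (ha1 : a ≤ 1) {c : ℝ} (hc : 0 ≤ c) {ε : ℝ}
    (hε : 0 < ε) (σ : ℝ) :
    PosMult fun κ : ℝ => Complex.exp (-(c * (ε + Complex.I * σ * κ : ℂ) ^ (a : ℂ))) := by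
  refine PosMult.of_tendsto (g := fun n κ => Complex.exp (-(c * diffQuot a ε σ n κ)))
    (fun n => ?_) fun κ =>
    (Complex.continuous_exp.tendsto _).comp ((tendsto_diffQuot a hε σ κ).const_mul _).neg
  have h1 : PosMult fun κ => -((1 - diskPoint (1 / ((n : ℝ) + 1)) ε σ κ) ^ (a : ℂ) - 1) := by
    refine PosMult.of_hasSum (fun k => (PosMult.const
      (neg_nonneg.2 (binomCoeff_succ_nonpos ha ha1 k))).mul
      ((posMult_diskPoint (1 / ((n : ℝ) + 1)) ε σ).pow (k + 1))) fun κ => ?_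
    have := hasSum_binomCoeff a (norm_diskPoint_lt_one (h := 1 / ((n : ℝ) + 1)) (by positivity) hε σ κ)
    rw [← hasSum_nat_add_iff' 1] at this
    simpa [binomCoeff_zero] using this.neg
  have h2 := ((PosMult.const (c := c * ((n : ℝ) + 1) ^ a) (by positivity)).mul h1).exp_sub
    (c * ((n : ℝ) + 1) ^ a)
  convert h2 using 3 with κ
  rw [diffQuot]; push_cast; ring

/-- For `1 ≤ a ≤ 2` the coefficient `-a` of `z` in `(1 - z)^a` has the wrong sign. Dividing by `z`,
the shifted Grünwald–Letnikov quotient, moves it to the constant term, where `PosMult.exp_sub`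
absorbs it. The shift disappears in the limit because `z⁻¹ → 1`. -/
lemma posMult_exp_cpow {a : ℝ} (ha : 1 ≤ a) (ha1 : a ≤ 2) {c : ℝ} (hc : 0 ≤ c) {ε : ℝ}
    (hε : 0 < ε) (σ : ℝ) :
    PosMult fun κ : ℝ => Complex.exp (c * (ε + Complex.I * σ * κ : ℂ) ^ (a : ℂ)) := by
  have hz : ∀ κ : ℝ, Tendsto (fun n : ℕ => (diskPoint (1 / ((n : ℝ) + 1)) ε σ κ)⁻¹) atTop (𝓝 1) := by
    intro κ
    have h0 := (Complex.continuous_ofReal.tendsto _).comp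
        (tendsto_one_div_add_atTop_nhds_zero_nat (𝕜 := ℝ))
    have h1 := ((Complex.continuous_exp.tendsto _).comp
      ((h0.mul_const (ε + Complex.I * σ * κ : ℂ)).neg)).inv₀ (Complex.exp_ne_zero _)
    simpa [diskPoint, Function.comp_def] using h1
  refine PosMult.of_tendsto (g := fun n κ => Complex.exp (c *
    ((diskPoint (1 / ((n : ℝ) + 1)) ε σ κ)⁻¹ * diffQuot a ε σ n κ))) (fun n => ?_) fun κ => ?_
  · have h1 : PosMult fun κ => (diskPoint (1 / ((n : ℝ) + 1)) ε σ κ)⁻¹ *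
        (1 - diskPoint (1 / ((n : ℝ) + 1)) ε σ κ) ^ (a : ℂ) + a := by
      have h3 : PosMult fun κ => (diskPoint (1 / ((n : ℝ) + 1)) ε σ κ)⁻¹ *
        ((1 - diskPoint (1 / ((n : ℝ) + 1)) ε σ κ) ^ (a : ℂ) -
          (1 - a * diskPoint (1 / ((n : ℝ) + 1)) ε σ κ)) := by
        refine (posMult_diskPoint_inv _ ε σ).mul ?_
        refine PosMult.of_hasSum (fun k => (PosMult.const
          (binomCoeff_add_two_nonneg ha ha1 k)).mul
          ((posMult_diskPoint (1 / ((n : ℝ) + 1)) ε σ).pow (k + 2))) fun κ => ?_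
        have := hasSum_binomCoeff a
          (norm_diskPoint_lt_one (h := 1 / ((n : ℝ) + 1)) (by positivity) hε σ κ)
        rw [← hasSum_nat_add_iff' 2] at this
        simpa [Finset.sum_range_succ, binomCoeff_zero, binomCoeff_one, sub_eq_add_neg] using this
      have h4 := h3.add (posMult_diskPoint_inv (1 / ((n : ℝ) + 1)) ε σ)
      convert h4 using 2 with κ
      have : diskPoint (1 / ((n : ℝ) + 1)) ε σ κ ≠ 0 := Complex.exp_ne_zero _
      field_simp
      ring
    have h2 := ((PosMult.const (c := c * ((n : ℝ) + 1) ^ a) (by positivity)).mul h1).exp_sub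
      (c * ((n : ℝ) + 1) ^ a * a)
    convert h2 using 3 with κ
    rw [diffQuot]; push_cast; ring
  · have := ((hz κ).mul (tendsto_diffQuot a hε σ κ)).const_mul (c : ℂ)
    rw [one_mul] at this
    exact (Complex.continuous_exp.tendsto _).comp this

lemma continuousAt_cpow_of_re_nonneg {a : ℝ} (ha : 0 < a) {z : ℂ} (hz : 0 ≤ z.re) :
    ContinuousAt (fun w : ℂ => w ^ (a : ℂ)) z := by
  rcases eq_or_ne z 0 with rfl | h0
  · exact Complex.continuousAt_cpow_const_of_re_pos (by simp) (by simpa using ha)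
  · refine continuousAt_cpow_const ?_
    rcases hz.lt_or_eq with h | h
    · exact Or.inl h
    · exact Or.inr fun hi => h0 (Complex.ext h.symm hi)

lemma tendsto_cpow_nhdsGT {a : ℝ} (ha : 0 < a) (σ κ : ℝ) :
    Tendsto (fun ε : ℝ => (ε + Complex.I * σ * κ : ℂ) ^ (a : ℂ)) (𝓝[>] 0)
      (𝓝 ((Complex.I * σ * κ) ^ (a : ℂ))) := by
  have h1 : Tendsto (fun ε : ℝ => (ε + Complex.I * σ * κ : ℂ)) (𝓝[>] 0) (𝓝 (Complex.I * σ * κ)) := by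
    have : Continuous fun ε : ℝ => (ε + Complex.I * σ * κ : ℂ) := by fun_prop
    simpa using (this.tendsto 0).mono_left nhdsWithin_le_nhds
  exact (continuousAt_cpow_of_re_nonneg ha (by simp)).tendsto.comp h1

lemma posMult_exp_neg_cpow_I {a : ℝ} (ha : 0 < a) (ha1 : a ≤ 1) {c : ℝ} (hc : 0 ≤ c) (σ : ℝ) :
    PosMult fun κ : ℝ => Complex.exp (-(c * (Complex.I * σ * κ : ℂ) ^ (a : ℂ))) :=
  PosMult.of_tendsto_filter (l := 𝓝[>] (0 : ℝ))
    (eventually_mem_nhdsWithin.mono fun _ hε => posMult_exp_neg_cpow ha.le ha1 hc hε σ)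
    fun κ => (Complex.continuous_exp.tendsto _).comp ((tendsto_cpow_nhdsGT ha σ κ).const_mul _).neg

lemma posMult_exp_cpow_I {a : ℝ} (ha : 1 ≤ a) (ha1 : a ≤ 2) {c : ℝ} (hc : 0 ≤ c) (σ : ℝ) :
    PosMult fun κ : ℝ => Complex.exp (c * (Complex.I * σ * κ : ℂ) ^ (a : ℂ)) :=
  PosMult.of_tendsto_filter (l := 𝓝[>] (0 : ℝ))
    (eventually_mem_nhdsWithin.mono fun _ hε => posMult_exp_cpow ha ha1 hc hε σ)
    fun κ => (Complex.continuous_exp.tendsto _).comp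
      ((tendsto_cpow_nhdsGT (by linarith) σ κ).const_mul _)

/-! ### The Riesz–Feller symbol as a combination of one-sided powers -/

lemma cpow_I_mul_pos (a : ℝ) {κ : ℝ} (hκ : 0 < κ) :
    (Complex.I * κ : ℂ) ^ (a : ℂ) =
      ((κ ^ a : ℝ) : ℂ) * Complex.exp (Complex.I * (a * Real.pi / 2 : ℝ)) := by
  rw [mul_comm, ofReal_mul_cpow hκ, Complex.cpow_def_of_ne_zero Complex.I_ne_zero, Complex.log_I]
  congr 2; push_cast; ring

lemma cpow_neg_I_mul_pos (a : ℝ) {κ : ℝ} (hκ : 0 < κ) :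
    (-Complex.I * κ : ℂ) ^ (a : ℂ) =
      ((κ ^ a : ℝ) : ℂ) * Complex.exp (-(Complex.I * (a * Real.pi / 2 : ℝ))) := by
  rw [mul_comm, ofReal_mul_cpow hκ, Complex.cpow_def_of_ne_zero (neg_ne_zero.2 Complex.I_ne_zero),
    Complex.log_neg_I]
  congr 2; push_cast; ring

lemma symbol_of_pos (α θ : ℝ) {κ : ℝ} (hκ : 0 < κ) :
    symbol α θ κ = ((κ ^ α : ℝ) : ℂ) * Complex.exp (Complex.I * (θ * Real.pi / 2 : ℝ)) := by
  rw [symbol, abs_of_pos hκ, Real.sign_of_pos hκ]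
  congr 2; push_cast; ring

lemma symbol_of_neg (α θ : ℝ) {κ : ℝ} (hκ : κ < 0) :
    symbol α θ κ = (((-κ) ^ α : ℝ) : ℂ) * Complex.exp (-(Complex.I * (θ * Real.pi / 2 : ℝ))) := by
  rw [symbol, abs_of_neg hκ, Real.sign_of_neg hκ]
  congr 2; push_cast; ring

lemma symbol_zero {α : ℝ} (hα : 0 < α) (θ : ℝ) : symbol α θ 0 = 0 := by
  simp [symbol, Real.zero_rpow hα.ne']

lemma exp_I_combination {x y : ℝ} (h : Real.sin (2 * x) ≠ 0) :
    ((Real.sin (x + y) / Real.sin (2 * x) : ℝ) : ℂ) * Complex.exp (Complex.I * x) +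
      ((Real.sin (x - y) / Real.sin (2 * x) : ℝ) : ℂ) * Complex.exp (-(Complex.I * x)) =
      Complex.exp (Complex.I * y) := by
  have h' : Complex.sin (2 * x) ≠ 0 := by exact_mod_cast h
  have e : ∀ u : ℝ, Complex.exp (Complex.I * u) = Complex.cos u + Complex.sin u * Complex.I := by
    intro u; rw [mul_comm, Complex.exp_mul_I]
  have e2 : Complex.exp (-(Complex.I * x)) = Complex.cos x - Complex.sin x * Complex.I := by
    have := e (-x)
    rw [Complex.ofReal_neg, Complex.cos_neg, Complex.sin_neg, mul_neg] at this
    rw [this]; ring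
  rw [e, e, e2]
  push_cast
  rw [div_mul_eq_mul_div, div_mul_eq_mul_div, ← add_div, div_eq_iff h', Complex.sin_two_mul,
    Complex.sin_add, Complex.sin_sub]
  ring

/-- When `sin(απ) ≠ 0` the numbers `e^{±iαπ/2}` form a real basis of `ℂ`, and the two coefficients
are those of `e^{iθπ/2}`. For `κ < 0` the two powers change roles, which amounts to replacing `θ` by
`-θ`. -/
lemma symbol_eq_cpow {α : ℝ} (hα : 0 < α) (hs : Real.sin (α * Real.pi) ≠ 0) (θ κ : ℝ) :
    symbol α θ κ =
      ((Real.sin ((α + θ) * Real.pi / 2) / Real.sin (α * Real.pi) : ℝ) : ℂ) *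
        (Complex.I * (1 : ℝ) * κ) ^ (α : ℂ) +
      ((Real.sin ((α - θ) * Real.pi / 2) / Real.sin (α * Real.pi) : ℝ) : ℂ) *
        (Complex.I * (-1 : ℝ) * κ) ^ (α : ℂ) := by
  have hα' : (α : ℂ) ≠ 0 := by exact_mod_cast hα.ne'
  have hs' : Real.sin (2 * (α * Real.pi / 2)) ≠ 0 := by convert hs using 2; ring
  have h1 : (α + θ) * Real.pi / 2 = α * Real.pi / 2 + θ * Real.pi / 2 := by ring
  have h2 : (α - θ) * Real.pi / 2 = α * Real.pi / 2 - θ * Real.pi / 2 := by ring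
  have h3 : α * Real.pi = 2 * (α * Real.pi / 2) := by ring
  have hI : ∀ u : ℝ, Complex.I * ((1 : ℝ) : ℂ) * u = Complex.I * u := by intro u; simp
  have hI' : ∀ u : ℝ, Complex.I * ((-1 : ℝ) : ℂ) * u = -Complex.I * u := by intro u; simp
  rw [hI, hI', h1, h2]
  conv_rhs => rw [h3]
  rcases lt_trichotomy κ 0 with h | rfl | h
  · have e1 : Complex.I * κ = -Complex.I * ((-κ : ℝ) : ℂ) := by push_cast; ring
    have e2 : -Complex.I * κ = Complex.I * ((-κ : ℝ) : ℂ) := by push_cast; ring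
    have hk : 0 < -κ := by linarith
    have e3 := exp_I_combination (x := α * Real.pi / 2) (y := -(θ * Real.pi / 2)) hs'
    rw [← sub_eq_add_neg, sub_neg_eq_add] at e3
    rw [symbol_of_neg α θ h, e1, e2, cpow_I_mul_pos α hk, cpow_neg_I_mul_pos α hk]
    rw [Complex.ofReal_neg, mul_neg] at e3
    rw [← e3]
    ring_nf
  · rw [symbol_zero hα]; simp [hα']
  · rw [symbol_of_pos α θ h, cpow_I_mul_pos α h, cpow_neg_I_mul_pos α h, ← exp_I_combination hs']
    ring_nf

/-- The admissible range means `0 ≤ α ± θ ≤ 2`, so both numerators are nonnegative. The denominator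
`sin(απ)` is positive for `α < 1` and negative for `α > 1`, as the two exponential lemmas require.
-/
lemma posMult_exp_neg_symbol_aux {α θ : ℝ} (hα : 0 < α) (hα2 : α < 2) (hα1 : α ≠ 1)
    (hθ : |θ| ≤ min α (2 - α)) : PosMult fun κ => Complex.exp (-symbol α θ κ) := by
  have hπ := Real.pi_pos
  obtain ⟨h1, h2⟩ := le_min_iff.1 hθ
  obtain ⟨h3, h4⟩ := abs_le.1 h1
  obtain ⟨h5, h6⟩ := abs_le.1 h2
  have hA : 0 ≤ Real.sin ((α + θ) * Real.pi / 2) :=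
    Real.sin_nonneg_of_nonneg_of_le_pi (by nlinarith) (by nlinarith)
  have hB : 0 ≤ Real.sin ((α - θ) * Real.pi / 2) :=
    Real.sin_nonneg_of_nonneg_of_le_pi (by nlinarith) (by nlinarith)
  rcases lt_or_gt_of_ne hα1 with h | h
  · have hs : 0 < Real.sin (α * Real.pi) :=
      Real.sin_pos_of_pos_of_lt_pi (by positivity) (by nlinarith)
    have := (posMult_exp_neg_cpow_I hα h.le (div_nonneg hA hs.le) 1).mul
      (posMult_exp_neg_cpow_I hα h.le (div_nonneg hB hs.le) (-1))
    convert this using 2 with κ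
    rw [symbol_eq_cpow hα hs.ne', ← Complex.exp_add, neg_add]
  · have hs : Real.sin (α * Real.pi) < 0 := by
      have := Real.sin_pos_of_pos_of_lt_pi (x := α * Real.pi - Real.pi) (by nlinarith) (by nlinarith)
      rw [Real.sin_sub_pi] at this; linarith
    have := (posMult_exp_cpow_I h.le hα2.le
        (neg_nonneg.2 (div_nonpos_of_nonneg_of_nonpos hA hs.le)) 1).mul
      (posMult_exp_cpow_I h.le hα2.le
        (neg_nonneg.2 (div_nonpos_of_nonneg_of_nonpos hB hs.le)) (-1))
    convert this using 2 with κ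
    rw [symbol_eq_cpow hα hs.ne, ← Complex.exp_add]
    push_cast
    congr 1; ring

lemma tendsto_symbol {ι : Type*} {l : Filter ι} {u : ι → ℝ} {α : ℝ} (hα : 0 < α)
    (hu : Tendsto u l (𝓝 α)) (θ κ : ℝ) :
    Tendsto (fun i => symbol (u i) θ κ) l (𝓝 (symbol α θ κ)) := by
  refine Tendsto.mul_const _ ((Complex.continuous_ofReal.tendsto _).comp ?_)
  exact (tendsto_const_nhds (x := |κ|)).rpow hu (Or.inr hα)

/-- At `α = 1` and `α = 2` the sine vanishes, and these orders are approached from below. At `α = 1`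
the strict inequality `|θ| < 1` leaves room for `|θ| ≤ 1 - ε`; at `α = 2` one has `θ = 0`. -/
lemma posMult_exp_neg_symbol {α θ : ℝ} (hα : 0 < α) (hα2 : α ≤ 2) (hθ : |θ| ≤ min α (2 - α))
    (hθ1 : |θ| < 1) : PosMult fun κ => Complex.exp (-symbol α θ κ) := by
  have h0 := abs_nonneg θ
  by_cases h : α ≠ 1 ∧ α ≠ 2
  · exact posMult_exp_neg_symbol_aux hα (lt_of_le_of_ne hα2 h.2) h.1 hθ
  have hu : Tendsto (fun ε : ℝ => α - ε) (𝓝[>] 0) (𝓝 α) := by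
    have : Continuous fun ε : ℝ => α - ε := by fun_prop
    simpa using (this.tendsto 0).mono_left nhdsWithin_le_nhds
  refine PosMult.of_tendsto_filter (l := 𝓝[>] (0 : ℝ))
    (g := fun ε κ => Complex.exp (-symbol (α - ε) θ κ)) ?_ fun κ =>
    (Complex.continuous_exp.tendsto _).comp (tendsto_symbol hα hu θ κ).neg
  have hsmall : Ioo (0 : ℝ) ((1 - |θ|) / 2) ∈ 𝓝[>] (0 : ℝ) := Ioo_mem_nhdsGT (by linarith)
  filter_upwards [hsmall] with ε hε
  obtain ⟨hε0, hε1⟩ := hε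
  rcases not_and_or.1 h with h | h
  · obtain rfl := not_not.1 h
    exact posMult_exp_neg_symbol_aux (by linarith) (by linarith) (by linarith)
      (le_min (by linarith) (by linarith))
  · obtain rfl := not_not.1 h
    have : |θ| ≤ 2 - 2 := (le_min_iff.1 hθ).2
    exact posMult_exp_neg_symbol_aux (by linarith) (by linarith) (by linarith)
      (le_min (by linarith) (by linarith))

/-! ### Fourier inversion and integrability of nonnegative transforms -/

lemma fourierPlusInv_eq_fourier (g : ℝ → ℂ) (x : ℝ) :
    fourierPlusInv g x = (2 * (Real.pi : ℂ))⁻¹ * FourierTransform.fourier g (x / (2 * Real.pi)) := by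
  rw [fourierPlusInv, Real.fourier_real_eq_integral_exp_smul]
  congr 2; ext κ
  rw [smul_eq_mul]
  congr 2
  have := Real.pi_pos.ne'
  push_cast
  field_simp

lemma fourierPlus_eq_fourierInv (f : ℝ → ℂ) (κ : ℝ) :
    fourierPlus f κ = FourierTransformInv.fourierInv f (κ / (2 * Real.pi)) := by
  rw [fourierPlus, Real.fourierInv_eq']
  congr 1; ext x
  rw [smul_eq_mul]
  congr 2
  have := Real.pi_pos.ne'
  have e : inner ℝ x (κ / (2 * Real.pi)) = κ / (2 * Real.pi) * x := rfl
  rw [e]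
  push_cast
  field_simp

lemma fourierPlus_fourierPlusInv {g : ℝ → ℂ} (hg : Integrable g)
    (h : Integrable (fourierPlusInv g)) {κ : ℝ} (hc : ContinuousAt g κ) :
    fourierPlus (fourierPlusInv g) κ = g κ := by
  have hπ : (2 * Real.pi) ≠ 0 := by positivity
  have hπ' : (2 * (Real.pi : ℂ)) ≠ 0 := by exact_mod_cast hπ
  have h1 : FourierTransform.fourier g = fun y => (2 * (Real.pi : ℂ)) * fourierPlusInv g (2 * Real.pi * y) := by
    ext y
    rw [fourierPlusInv_eq_fourier, mul_inv_cancel_left₀ hπ', mul_div_cancel_left₀ _ hπ]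
  have h2 : Integrable (FourierTransform.fourier g) := by
    rw [h1]; exact (h.comp_mul_left' hπ).const_mul _
  rw [← hg.fourierInv_fourier_eq h2 hc, fourierPlus, Real.fourierInv_eq']
  have h3 := Measure.integral_comp_div (fun y : ℝ => Complex.exp (Complex.I * κ * (2 * Real.pi * y : ℝ)) *
    fourierPlusInv g (2 * Real.pi * y)) (2 * Real.pi)
  simp_rw [mul_div_cancel₀ _ hπ] at h3
  rw [h3, ← integral_smul, h1]
  congr 1; ext y
  have e : inner ℝ y κ = κ * y := rfl
  rw [e, abs_of_pos (by positivity), Complex.real_smul, smul_eq_mul]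
  push_cast
  have e2 : Complex.I * κ * (2 * Real.pi * y) = 2 * Real.pi * (κ * y) * Complex.I := by ring
  rw [e2]
  ring

lemma fourierPlusInv_fourierPlus {f : ℝ → ℂ} (hf : Integrable f)
    (h : Integrable (fourierPlus f)) {x : ℝ} (hc : ContinuousAt f x) :
    fourierPlusInv (fourierPlus f) x = f x := by
  have hπ : (2 * Real.pi) ≠ 0 := by positivity
  have hπ' : (2 * (Real.pi : ℂ)) ≠ 0 := by exact_mod_cast hπ
  have h1 : FourierTransformInv.fourierInv f = fun y => fourierPlus f (2 * Real.pi * y) := by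
    ext y
    rw [fourierPlus_eq_fourierInv, mul_div_cancel_left₀ _ hπ]
  have h2 : Integrable (FourierTransformInv.fourierInv f) := by
    rw [h1]; exact h.comp_mul_left' hπ
  have h2' : Integrable (FourierTransform.fourier f) := by
    have e : FourierTransform.fourier f = fun y => FourierTransformInv.fourierInv f (-y) := by
      ext y; rw [Real.fourierInv_eq_fourier_neg, neg_neg]
    rw [e]; exact h2.comp_neg
  rw [← hf.fourier_fourierInv_eq h2' hc, fourierPlusInv, Real.fourier_real_eq_integral_exp_smul]
  have h3 := Measure.integral_comp_div (fun y : ℝ =>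
    Complex.exp (-(Complex.I * (2 * Real.pi * y : ℝ) * x)) * fourierPlus f (2 * Real.pi * y)) (2 * Real.pi)
  simp_rw [mul_div_cancel₀ _ hπ] at h3
  rw [h3, abs_of_pos (by positivity), Complex.real_smul, ← mul_assoc, h1]
  push_cast
  rw [inv_mul_cancel₀ hπ', one_mul]
  congr 1; ext y
  rw [smul_eq_mul]
  congr 2
  ring

lemma integrable_exp_mul_fourierPlus {g : ℝ → ℂ} (hg : Integrable g) (κ : ℝ) :
    Integrable fun x : ℝ => Complex.exp (Complex.I * κ * x) * g x :=
  integrable_exp_I_mul' hg κ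

lemma continuous_fourierPlusInv {g : ℝ → ℂ} (hg : Integrable g) : Continuous (fourierPlusInv g) := by
  refine continuous_const.mul (continuous_of_dominated (bound := fun κ => ‖g κ‖)
    (fun x => (integrable_exp_I_mul hg x).1) (fun x => Eventually.of_forall fun κ => ?_) hg.norm
    (Eventually.of_forall fun κ => by fun_prop))
  rw [norm_mul, norm_exp_I_mul, one_mul]

lemma continuous_fourierPlus {g : ℝ → ℂ} (hg : Integrable g) : Continuous (fourierPlus g) := by
  refine continuous_of_dominated (bound := fun κ => ‖g κ‖)
    (fun x => (integrable_exp_I_mul' hg x).1) (fun x => Eventually.of_forall fun κ => ?_) hg.norm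
    (Eventually.of_forall fun κ => by fun_prop)
  rw [norm_mul, norm_exp_I_mul', one_mul]

lemma norm_fourierPlusInv_le (g : ℝ → ℂ) (x : ℝ) :
    ‖fourierPlusInv g x‖ ≤ (2 * Real.pi)⁻¹ * ∫ κ, ‖g κ‖ := by
  rw [fourierPlusInv, norm_mul]
  have hπ := Real.pi_pos
  refine mul_le_mul (by simp [abs_of_pos hπ]) ((norm_integral_le_integral_norm _).trans (le_of_eq ?_))
    (norm_nonneg _) (by positivity)
  simp_rw [norm_mul, norm_exp_I_mul, one_mul]

/-- Functions with `h (-κ) = conj (h κ)` have real integral. -/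
lemma integrable_of_hermitian {h : ℝ → ℂ} (hh : ∀ κ, 0 < κ → h (-κ) = (starRingEnd ℂ) (h κ))
    (hi : IntegrableOn h (Ioi 0)) : Integrable h := by
  have h1 : IntegrableOn (fun κ => (starRingEnd ℂ) (h κ)) (Ioi (-0)) := by
    rw [neg_zero]
    refine ⟨(Complex.continuous_conj.comp_aestronglyMeasurable hi.1), ?_⟩
    exact hi.2.mono (by simp)
  have h2 : IntegrableOn h (Iio 0) := by
    refine (h1.comp_neg_Iio).congr_fun (fun κ hκ => ?_) measurableSet_Iio
    simp only
    rw [← hh (-κ) (by simpa using hκ), neg_neg]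
  rw [← integrableOn_univ, ← Iic_union_Ioi (a := (0 : ℝ))]
  exact ((integrableOn_Iic_iff_integrableOn_Iio (by simp)).2 h2).union hi

lemma integral_of_hermitian {h : ℝ → ℂ} (hh : ∀ κ, 0 < κ → h (-κ) = (starRingEnd ℂ) (h κ))
    (hi : IntegrableOn h (Ioi 0)) : ∫ κ, h κ = ((2 * (∫ κ in Ioi 0, h κ).re : ℝ) : ℂ) := by
  have hI := integrable_of_hermitian hh hi
  rw [← intervalIntegral.integral_Iic_add_Ioi (b := 0) hI.integrableOn hI.integrableOn]
  have h1 : ∫ κ in Iic 0, h κ = (starRingEnd ℂ) (∫ κ in Ioi 0, h κ) := by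
    rw [← integral_conj, ← neg_zero, ← integral_comp_neg_Ioi, neg_zero]
    exact setIntegral_congr_fun measurableSet_Ioi fun κ hκ => hh κ hκ
  rw [h1, add_comm, Complex.add_conj]

/-- A continuous function `g` bounded by `B` whose Fourier transform is nonnegative has an
integrable Fourier transform. -/
lemma integrable_fourierPlusInv_re {g : ℝ → ℂ} (hg : FourierNonneg g) {B : ℝ} (hB : ∀ κ, ‖g κ‖ ≤ B) :
    Integrable fun x => (fourierPlusInv g x).re := by
  have hπ := Real.pi_pos
  have hc : Continuous fun x => (fourierPlusInv g x).re :=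
    Complex.continuous_re.comp (continuous_fourierPlusInv hg.1)
  have hB0 : 0 ≤ B := (norm_nonneg _).trans (hB 0)
  have hnn : ∀ x, 0 ≤ (fourierPlusInv g x).re := fun x => by
    have : fourierPlusInv g x = (((2 * Real.pi)⁻¹ : ℝ) : ℂ) *
      ∫ κ : ℝ, Complex.exp (-(Complex.I * (κ : ℂ) * (x : ℂ))) * g κ := by
      rw [fourierPlusInv]; push_cast; rfl
    rw [this, Complex.re_ofReal_mul]
    exact mul_nonneg (by positivity) (hg.2 x)
  have hgauss : ∀ b : ℝ, 0 < b → Integrable fun x : ℝ => Complex.exp (-(b : ℂ) * (x : ℂ) ^ 2) :=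
    fun b hb => integrable_cexp_neg_mul_sq (by simpa using hb)
  -- Parseval against a Gaussian: the transformed Gaussian has mass `2π`, which cancels the
  -- prefactor of the inversion formula, so the bound `B` does not depend on `b`.
  have key : ∀ b : ℝ, 0 < b → ∫ x, (fourierPlusInv g x).re * Real.exp (-b * x ^ 2) ≤ B := by
    intro b hb
    have hint : Integrable (Function.uncurry fun (x κ : ℝ) =>
        Complex.exp (-(b : ℂ) * (x : ℂ) ^ 2) * (Complex.exp (-(Complex.I * κ * x)) * g κ))
        (volume.prod volume) := by
      have h1 := (hgauss b hb).mul_prod hg.1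
      have h2 := h1.bdd_mul (c := 1) (f := fun z : ℝ × ℝ => Complex.exp (-(Complex.I * z.2 * z.1)))
        (Continuous.aestronglyMeasurable (by fun_prop))
        (Eventually.of_forall fun z => (norm_exp_I_mul z.2 z.1).le)
      refine h2.congr (Eventually.of_forall fun z => ?_)
      simp only [Function.uncurry]
      ring
    have h1 : ∫ x : ℝ, Complex.exp (-(b : ℂ) * (x : ℂ) ^ 2) * fourierPlusInv g x =
        (2 * (Real.pi : ℂ))⁻¹ * ∫ κ : ℝ, (∫ x : ℝ, Complex.exp (Complex.I * (-κ : ℂ) * x) *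
          Complex.exp (-(b : ℂ) * (x : ℂ) ^ 2)) * g κ := by
      have e1 : ∀ x : ℝ, Complex.exp (-(b : ℂ) * (x : ℂ) ^ 2) * fourierPlusInv g x =
          (2 * (Real.pi : ℂ))⁻¹ * ∫ κ : ℝ,
          Complex.exp (-(b : ℂ) * (x : ℂ) ^ 2) * (Complex.exp (-(Complex.I * κ * x)) * g κ) := by
        intro x; rw [integral_const_mul, fourierPlusInv]; ring
      simp_rw [e1]
      rw [integral_const_mul, integral_integral_swap hint]
      congr 2; ext κ
      rw [← integral_mul_const]
      congr 1; ext x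
      have : Complex.I * (-κ : ℂ) * x = -(Complex.I * κ * x) := by ring
      rw [this]; ring
    have h2 : ∀ κ : ℝ, (∫ x : ℝ, Complex.exp (Complex.I * (-κ : ℂ) * x) *
          Complex.exp (-(b : ℂ) * (x : ℂ) ^ 2)) =
          ((Real.sqrt (Real.pi / b) * Real.exp (-(1 / (4 * b)) * κ ^ 2) : ℝ) : ℂ) := by
      intro κ
      rw [fourierIntegral_gaussian (by simpa using hb), Real.sqrt_eq_rpow, Complex.ofReal_mul,
        Complex.ofReal_cpow (by positivity)]
      push_cast
      congr 2
      field_simp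
    have h3 : ‖∫ x : ℝ, Complex.exp (-(b : ℂ) * (x : ℂ) ^ 2) * fourierPlusInv g x‖ ≤ B := by
      rw [h1, norm_mul]
      simp_rw [h2]
      have h4 : ‖∫ κ : ℝ, ((Real.sqrt (Real.pi / b) * Real.exp (-(1 / (4 * b)) * κ ^ 2) : ℝ) : ℂ) * g κ‖ ≤
          ∫ κ : ℝ, Real.sqrt (Real.pi / b) * Real.exp (-(1 / (4 * b)) * κ ^ 2) * B := by
        refine norm_integral_le_of_norm_le
          (((integrable_exp_neg_mul_sq (by positivity)).const_mul _).mul_const _)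
          (Eventually.of_forall fun κ => ?_)
        rw [norm_mul, Complex.norm_real, Real.norm_of_nonneg (by positivity)]
        exact mul_le_mul_of_nonneg_left (hB κ) (by positivity)
      rw [integral_mul_const, integral_const_mul, integral_gaussian] at h4
      have h5 : Real.sqrt (Real.pi / b) * Real.sqrt (Real.pi / (1 / (4 * b))) = 2 * Real.pi := by
        rw [← Real.sqrt_mul (by positivity)]
        have : Real.pi / b * (Real.pi / (1 / (4 * b))) = (2 * Real.pi) ^ 2 := by field_simp; ring
        rw [this, Real.sqrt_sq (by positivity)]
      rw [h5] at h4
      calc _ ≤ ‖(2 * (Real.pi : ℂ))⁻¹‖ * (2 * Real.pi * B) := by gcongr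
        _ = B := by
          have : ‖(2 * (Real.pi : ℂ))⁻¹‖ = (2 * Real.pi)⁻¹ := by simp [abs_of_pos hπ]
          rw [this]; field_simp
    have h4 : ∫ x, (fourierPlusInv g x).re * Real.exp (-b * x ^ 2) =
        (∫ x : ℝ, Complex.exp (-(b : ℂ) * (x : ℂ) ^ 2) * fourierPlusInv g x).re := by
      have e : Integrable fun x : ℝ => Complex.exp (-(b : ℂ) * (x : ℂ) ^ 2) * fourierPlusInv g x :=
        (hgauss b hb).mul_bdd (continuous_fourierPlusInv hg.1).aestronglyMeasurable
          (Eventually.of_forall (norm_fourierPlusInv_le g))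
      rw [← Complex.reCLM_apply, ← ContinuousLinearMap.integral_comp_comm _ e]
      congr 1; ext x
      have : Complex.exp (-(b : ℂ) * (x : ℂ) ^ 2) = ((Real.exp (-b * x ^ 2) : ℝ) : ℂ) := by push_cast; rfl
      rw [Complex.reCLM_apply, this, Complex.re_ofReal_mul, mul_comm]
    rw [h4]
    exact (Complex.re_le_norm _).trans h3
  refine integrable_of_intervalIntegral_norm_bounded (l := atTop) (a := fun n : ℕ => -((n : ℝ) + 1))
    (b := fun n : ℕ => (n : ℝ) + 1) (Real.exp 1 * B) (fun n => ?_) ?_ ?_ (Eventually.of_forall fun n => ?_)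
  · exact hc.locallyIntegrable.integrableOn_isCompact isCompact_Icc |>.mono_set Ioc_subset_Icc_self
  · exact tendsto_neg_atTop_atBot.comp (tendsto_atTop_add_const_right _ _ tendsto_natCast_atTop_atTop)
  · exact tendsto_atTop_add_const_right _ _ tendsto_natCast_atTop_atTop
  · set N : ℝ := (n : ℝ) + 1 with hN
    have hNpos : 0 < N := by positivity
    -- With this width the Gaussian weight is at least `e⁻¹` on `[-N, N]`, so removing it costs only
    -- a factor `e`.
    set b : ℝ := 1 / N ^ 2 with hb
    have hbpos : 0 < b := by positivity
    have hI : Integrable fun x => (fourierPlusInv g x).re * Real.exp (-b * x ^ 2) :=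
      (integrable_exp_neg_mul_sq hbpos).bdd_mul (c := (2 * Real.pi)⁻¹ * ∫ κ, ‖g κ‖)
        hc.aestronglyMeasurable (Eventually.of_forall fun x =>
          (Complex.abs_re_le_norm _).trans (norm_fourierPlusInv_le g x))
    rw [intervalIntegral.integral_of_le (by linarith)]
    calc ∫ x in Ioc (-N) N, ‖(fourierPlusInv g x).re‖
        ≤ ∫ x in Ioc (-N) N, Real.exp 1 * ((fourierPlusInv g x).re * Real.exp (-b * x ^ 2)) := by
          refine setIntegral_mono_on ?_ (hI.const_mul _).integrableOn measurableSet_Ioc fun x hx => ?_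
          · exact (hc.norm.locallyIntegrable.integrableOn_isCompact isCompact_Icc).mono_set
              Ioc_subset_Icc_self
          · rw [Real.norm_of_nonneg (hnn x)]
            have h1 : x ^ 2 ≤ N ^ 2 := sq_le_sq' hx.1.le hx.2
            have h2 : b * x ^ 2 ≤ 1 := by
              rw [hb, div_mul_eq_mul_div, one_mul]
              exact (div_le_one (by positivity)).2 h1
            have h3 : 1 ≤ Real.exp 1 * Real.exp (-b * x ^ 2) := by
              rw [← Real.exp_add]; exact Real.one_le_exp (by linarith)
            calc _ = (fourierPlusInv g x).re * 1 := (mul_one _).symm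
              _ ≤ (fourierPlusInv g x).re * (Real.exp 1 * Real.exp (-b * x ^ 2)) :=
                mul_le_mul_of_nonneg_left h3 (hnn x)
              _ = _ := by ring
      _ ≤ ∫ x, Real.exp 1 * ((fourierPlusInv g x).re * Real.exp (-b * x ^ 2)) :=
          setIntegral_le_integral (hI.const_mul _) (Eventually.of_forall fun x =>
            mul_nonneg (Real.exp_pos _).le (mul_nonneg (hnn x) (Real.exp_pos _).le))
      _ ≤ _ := by
          rw [integral_const_mul]
          exact mul_le_mul_of_nonneg_left (key b hbpos) (Real.exp_pos _).le

/-! ### The stable density: positivity, transform, scaling and decay -/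

lemma norm_symbol (α θ κ : ℝ) : ‖symbol α θ κ‖ = |κ| ^ α := by
  rw [symbol, norm_mul, Complex.norm_real, Real.norm_of_nonneg (by positivity)]
  have : Complex.I * (Real.sign κ : ℂ) * (θ : ℂ) * (Real.pi : ℂ) / 2 =
    ((Real.sign κ * θ * Real.pi / 2 : ℝ) : ℂ) * Complex.I := by push_cast; ring
  rw [this, Complex.norm_exp_ofReal_mul_I, mul_one]

/-- A form without the discontinuous sign function, from which continuity at `κ = 0` can be read
off. -/
lemma symbol_eq_max {α : ℝ} (hα : 0 < α) (θ κ : ℝ) : symbol α θ κ =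
    (((max κ 0) ^ α : ℝ) : ℂ) * Complex.exp (Complex.I * (θ * Real.pi / 2 : ℝ)) +
    (((max (-κ) 0) ^ α : ℝ) : ℂ) * Complex.exp (-(Complex.I * (θ * Real.pi / 2 : ℝ))) := by
  rcases lt_trichotomy κ 0 with h | rfl | h
  · rw [symbol_of_neg α θ h, max_eq_right h.le, max_eq_left (by linarith), Real.zero_rpow hα.ne']
    simp
  · simp [symbol_zero hα, Real.zero_rpow hα.ne']
  · rw [symbol_of_pos α θ h, max_eq_left h.le, max_eq_right (by linarith), Real.zero_rpow hα.ne']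
    simp

lemma continuous_symbol {α : ℝ} (hα : 0 < α) (θ : ℝ) : Continuous (symbol α θ) := by
  rw [show symbol α θ = _ from funext (symbol_eq_max hα θ)]
  have h1 : Continuous fun κ : ℝ => (max κ 0) ^ α :=
    (continuous_id.max continuous_const).rpow_const fun _ => Or.inr hα.le
  have h2 : Continuous fun κ : ℝ => (max (-κ) 0) ^ α :=
    (continuous_neg.max continuous_const).rpow_const fun _ => Or.inr hα.le
  exact ((Complex.continuous_ofReal.comp h1).mul continuous_const).add
    ((Complex.continuous_ofReal.comp h2).mul continuous_const)

lemma symbol_neg_arg (α θ κ : ℝ) : symbol α θ (-κ) = symbol α (-θ) κ := by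
  have : Real.sign (-κ) = -Real.sign κ := by
    rcases lt_trichotomy κ 0 with h | rfl | h
    · rw [Real.sign_of_neg h, Real.sign_of_pos (by linarith)]; ring
    · simp
    · rw [Real.sign_of_pos h, Real.sign_of_neg (by linarith)]
  rw [symbol, symbol, abs_neg, this]
  congr 2; push_cast; ring

lemma symbol_neg_eq_conj (α θ κ : ℝ) : symbol α θ (-κ) = (starRingEnd ℂ) (symbol α θ κ) := by
  rw [symbol_neg_arg, symbol, symbol, map_mul, Complex.conj_ofReal, ← Complex.exp_conj]
  have h2 : (starRingEnd ℂ) 2 = 2 := map_ofNat _ 2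
  congr 2
  simp [h2]

lemma re_symbol (α θ κ : ℝ) (hα : 0 < α) :
    (symbol α θ κ).re = |κ| ^ α * Real.cos (θ * Real.pi / 2) := by
  have hc : ∀ y : ℝ, (Complex.exp (Complex.I * y)).re = Real.cos y := by
    intro y; rw [mul_comm, Complex.exp_ofReal_mul_I_re]
  have hc' : ∀ y : ℝ, (Complex.exp (-(Complex.I * y))).re = Real.cos y := by
    intro y
    have := hc (-y)
    rwa [Complex.ofReal_neg, mul_neg, Real.cos_neg] at this
  rcases lt_trichotomy κ 0 with h | rfl | h
  · rw [symbol_of_neg α θ h, Complex.re_ofReal_mul, hc', abs_of_neg h]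
  · simp [symbol_zero hα, Real.zero_rpow hα.ne']
  · rw [symbol_of_pos α θ h, Complex.re_ofReal_mul, hc, abs_of_pos h]

lemma cos_pos_of_abs_lt_one {θ : ℝ} (hθ : |θ| < 1) : 0 < Real.cos (θ * Real.pi / 2) := by
  have hπ := Real.pi_pos
  obtain ⟨h1, h2⟩ := abs_lt.1 hθ
  exact Real.cos_pos_of_mem_Ioo ⟨by nlinarith, by nlinarith⟩

lemma cos_nonneg_of_abs_le_one {θ : ℝ} (hθ : |θ| ≤ 1) : 0 ≤ Real.cos (θ * Real.pi / 2) := by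
  have hπ := Real.pi_pos
  obtain ⟨h1, h2⟩ := abs_le.1 hθ
  exact Real.cos_nonneg_of_mem_Icc ⟨by nlinarith, by nlinarith⟩

lemma re_symbol_nonneg {α θ : ℝ} (hα : 0 < α) (hθ : |θ| ≤ 1) (κ : ℝ) : 0 ≤ (symbol α θ κ).re := by
  rw [re_symbol α θ κ hα]
  exact mul_nonneg (by positivity) (cos_nonneg_of_abs_le_one hθ)

lemma symbol_mul {c : ℝ} (hc : 0 < c) (α θ κ : ℝ) :
    symbol α θ (c * κ) = ((c ^ α : ℝ) : ℂ) * symbol α θ κ := by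
  have hs : Real.sign (c * κ) = Real.sign κ := by
    rcases lt_trichotomy κ 0 with h | rfl | h
    · rw [Real.sign_of_neg h, Real.sign_of_neg (mul_neg_of_pos_of_neg hc h)]
    · simp
    · rw [Real.sign_of_pos h, Real.sign_of_pos (by positivity)]
  rw [symbol, symbol, hs, abs_mul, abs_of_pos hc, Real.mul_rpow hc.le (abs_nonneg _)]
  push_cast; ring

lemma norm_exp_neg_symbol {α θ : ℝ} (hα : 0 < α) (κ : ℝ) :
    ‖Complex.exp (-symbol α θ κ)‖ = Real.exp (-Real.cos (θ * Real.pi / 2) * |κ| ^ α) := by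
  rw [Complex.norm_exp, Complex.neg_re, re_symbol α θ κ hα]
  congr 1; ring

lemma exp_neg_symbol_hermitian (α θ κ : ℝ) : Complex.exp (-symbol α θ (-κ)) =
    (starRingEnd ℂ) (Complex.exp (-symbol α θ κ)) := by
  rw [symbol_neg_eq_conj, ← Complex.exp_conj, map_neg]

lemma integrable_exp_neg_symbol {α θ : ℝ} (hα : 0 < α) (hθ : |θ| < 1) :
    Integrable fun κ => Complex.exp (-symbol α θ κ) := by
  refine integrable_of_hermitian (fun κ _ => exp_neg_symbol_hermitian α θ κ) ?_
  have h := integrableOn_rpow_mul_exp_neg_mul_rpow (s := 0) (by norm_num) hα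
    (cos_pos_of_abs_lt_one hθ)
  refine Integrable.mono' h
    (Complex.continuous_exp.comp (continuous_symbol hα θ).neg).aestronglyMeasurable.restrict ?_
  filter_upwards [self_mem_ae_restrict measurableSet_Ioi] with κ hκ
  rw [norm_exp_neg_symbol hα, abs_of_pos hκ, Real.rpow_zero, one_mul]

lemma hermitian_mul_exp {g : ℝ → ℂ} (hg : ∀ κ, 0 < κ → g (-κ) = (starRingEnd ℂ) (g κ)) (x κ : ℝ)
    (hκ : 0 < κ) :
    Complex.exp (-(Complex.I * ((-κ : ℝ) : ℂ) * x)) * g (-κ) =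
      (starRingEnd ℂ) (Complex.exp (-(Complex.I * κ * x)) * g κ) := by
  rw [map_mul, hg κ hκ, ← Complex.exp_conj]
  congr 2
  simp

lemma fourierPlusInv_of_hermitian {g : ℝ → ℂ} (hg : ∀ κ, 0 < κ → g (-κ) = (starRingEnd ℂ) (g κ))
    (hi : IntegrableOn g (Ioi 0)) (x : ℝ) :
    fourierPlusInv g x =
      ((Real.pi⁻¹ * (∫ κ in Ioi 0, Complex.exp (-(Complex.I * (κ : ℝ) * x)) * g κ).re : ℝ) : ℂ) := by
  rw [fourierPlusInv, integral_of_hermitian (hermitian_mul_exp hg x)]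
  · have h : ∀ R : ℝ, (2 * (Real.pi : ℂ))⁻¹ * ((2 * R : ℝ) : ℂ) = ((Real.pi⁻¹ * R : ℝ) : ℂ) := by
      intro R
      have : (Real.pi : ℂ) ≠ 0 := by exact_mod_cast Real.pi_ne_zero
      push_cast
      field_simp
    exact h _
  · exact (integrable_exp_I_mul (integrable_of_hermitian hg hi) x).integrableOn

lemma stableDensity_cast {α θ : ℝ} (hα : 0 < α) (hθ : |θ| < 1) (x : ℝ) :
    (stableDensity α θ x : ℂ) = fourierPlusInv (fun κ => Complex.exp (-symbol α θ κ)) x := by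
  rw [stableDensity, fourierPlusInv_of_hermitian (fun κ _ => exp_neg_symbol_hermitian α θ κ)
    (integrable_exp_neg_symbol hα hθ).integrableOn, Complex.ofReal_re]

lemma continuous_stableDensity {α θ : ℝ} (hα : 0 < α) (hθ : |θ| < 1) :
    Continuous (stableDensity α θ) :=
  Complex.continuous_re.comp (continuous_fourierPlusInv (integrable_exp_neg_symbol hα hθ))

lemma fourierNonneg_exp_neg_symbol {α θ : ℝ} (hα : 0 < α) (hα2 : α ≤ 2)
    (hθ : |θ| ≤ min α (2 - α)) (hθ1 : |θ| < 1) :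
    FourierNonneg fun κ => Complex.exp (-symbol α θ κ) :=
  (posMult_exp_neg_symbol hα hα2 hθ hθ1).fourierNonneg (integrable_exp_neg_symbol hα hθ1)

lemma FourierNonneg.fourierPlusInv_re_nonneg {g : ℝ → ℂ} (hg : FourierNonneg g) (x : ℝ) :
    0 ≤ (fourierPlusInv g x).re := by
  have : fourierPlusInv g x = (((2 * Real.pi)⁻¹ : ℝ) : ℂ) *
    ∫ κ : ℝ, Complex.exp (-(Complex.I * (κ : ℂ) * (x : ℂ))) * g κ := by
    rw [fourierPlusInv]; push_cast; rfl
  rw [this, Complex.re_ofReal_mul]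
  exact mul_nonneg (by have := Real.pi_pos; positivity) (hg.2 x)

lemma stableDensity_nonneg {α θ : ℝ} (hα : 0 < α) (hα2 : α ≤ 2)
    (hθ : |θ| ≤ min α (2 - α)) (hθ1 : |θ| < 1) (x : ℝ) : 0 ≤ stableDensity α θ x :=
  (fourierNonneg_exp_neg_symbol hα hα2 hθ hθ1).fourierPlusInv_re_nonneg x

lemma integrable_stableDensity {α θ : ℝ} (hα : 0 < α) (hα2 : α ≤ 2)
    (hθ : |θ| ≤ min α (2 - α)) (hθ1 : |θ| < 1) : Integrable (stableDensity α θ) := by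
  refine integrable_fourierPlusInv_re (B := 1) (fourierNonneg_exp_neg_symbol hα hα2 hθ hθ1) fun κ => ?_
  have := cos_pos_of_abs_lt_one hθ1
  rw [norm_exp_neg_symbol hα, Real.exp_le_one_iff, neg_mul, neg_nonpos]
  positivity

lemma fourierPlus_stableDensity {α θ : ℝ} (hα : 0 < α) (hα2 : α ≤ 2)
    (hθ : |θ| ≤ min α (2 - α)) (hθ1 : |θ| < 1) (κ : ℝ) :
    fourierPlus (fun x => (stableDensity α θ x : ℂ)) κ = Complex.exp (-symbol α θ κ) := by
  have h := (integrable_stableDensity hα hα2 hθ hθ1).ofReal (𝕜 := ℂ)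
  have e : (fun x => (stableDensity α θ x : ℂ)) =
    fourierPlusInv (fun κ => Complex.exp (-symbol α θ κ)) := funext (stableDensity_cast hα hθ1)
  have h' : Integrable (fourierPlusInv (fun κ => Complex.exp (-symbol α θ κ))) := by
    rw [← e]; exact h
  rw [e, fourierPlus_fourierPlusInv (integrable_exp_neg_symbol hα hθ1) h'
    (Complex.continuous_exp.comp (continuous_symbol hα θ).neg).continuousAt]

lemma parentDensity_nonneg {α θ : ℝ} (hα : 0 < α) (hα2 : α ≤ 2)
    (hθ : |θ| ≤ min α (2 - α)) (hθ1 : |θ| < 1) {τ : ℝ} (hτ : 0 ≤ τ) (x : ℝ) :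
    0 ≤ parentDensity α θ x τ :=
  mul_nonneg (by positivity) (stableDensity_nonneg hα hα2 hθ hθ1 _)

lemma integrable_parentDensity {α θ : ℝ} (hα : 0 < α) (hα2 : α ≤ 2)
    (hθ : |θ| ≤ min α (2 - α)) (hθ1 : |θ| < 1) {τ : ℝ} (hτ : 0 < τ) :
    Integrable fun x => parentDensity α θ x τ :=
  ((integrable_stableDensity hα hα2 hθ hθ1).comp_div (by positivity)).const_mul _

/-- The symbol is homogeneous of degree `α`, so dilation by `τ^{1/α}` multiplies it by `τ`. -/
lemma fourierPlus_parentDensity {α θ : ℝ} (hα : 0 < α) (hα2 : α ≤ 2)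
    (hθ : |θ| ≤ min α (2 - α)) (hθ1 : |θ| < 1) {τ : ℝ} (hτ : 0 < τ) (κ : ℝ) :
    fourierPlus (fun x => (parentDensity α θ x τ : ℂ)) κ =
      Complex.exp (-((τ : ℂ) * symbol α θ κ)) := by
  set c : ℝ := τ ^ (1 / α) with hc
  have hc0 : 0 < c := by positivity
  have h1 : c ^ α = τ := by
    rw [hc, ← Real.rpow_mul hτ.le, one_div_mul_cancel hα.ne', Real.rpow_one]
  have h2 := fourierPlus_stableDensity hα hα2 hθ hθ1 (c * κ)
  rw [symbol_mul hc0, h1] at h2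
  rw [← h2, fourierPlus, fourierPlus]
  have h3 := Measure.integral_comp_div (fun y : ℝ =>
    Complex.exp (Complex.I * (c * κ : ℝ) * y) * stableDensity α θ y) c
  rw [abs_of_pos hc0] at h3
  have h4 : (∫ y : ℝ, Complex.exp (Complex.I * (c * κ : ℝ) * y) * stableDensity α θ y) = (c⁻¹ : ℝ) •
      ∫ x : ℝ, Complex.exp (Complex.I * (c * κ : ℝ) * ((x / c : ℝ) : ℂ)) * stableDensity α θ (x / c) := by
    rw [h3, inv_smul_smul₀ hc0.ne']
  rw [h4, ← integral_smul]
  congr 1; ext x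
  have e1 : τ ^ (-(1 / α)) = c⁻¹ := by rw [Real.rpow_neg hτ.le]
  have e2 : Complex.I * (c * κ : ℝ) * ((x / c : ℝ) : ℂ) = Complex.I * κ * x := by
    have : (c : ℂ) ≠ 0 := by exact_mod_cast hc0.ne'
    push_cast; field_simp
  rw [e2, parentDensity, e1, Complex.real_smul]
  push_cast
  ring

lemma integral_parentDensity {α θ : ℝ} (hα : 0 < α) (hα2 : α ≤ 2)
    (hθ : |θ| ≤ min α (2 - α)) (hθ1 : |θ| < 1) {τ : ℝ} (hτ : 0 < τ) :
    ∫ x : ℝ, parentDensity α θ x τ = 1 := by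
  have h := fourierPlus_parentDensity hα hα2 hθ hθ1 hτ 0
  rw [symbol_zero hα, fourierPlus] at h
  simp only [Complex.ofReal_zero, mul_zero, zero_mul, Complex.exp_zero, one_mul, neg_zero] at h
  rw [integral_complex_ofReal] at h
  exact_mod_cast h

lemma stableDensity_le {α θ : ℝ} (x : ℝ) : |stableDensity α θ x| ≤
    (2 * Real.pi)⁻¹ * ∫ κ, ‖Complex.exp (-symbol α θ κ)‖ :=
  (Complex.abs_re_le_norm _).trans (norm_fourierPlusInv_le _ x)

/-- Integration by parts shows that the Fourier transform on a half-line of a stretched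
exponential is `O(1 / x)`. -/
lemma exists_abs_mul_norm_integral_le {α : ℝ} (hα : 0 < α) {a : ℂ} (ha : 0 < a.re) :
    ∃ C, ∀ x : ℝ, |x| * ‖∫ κ in Ioi (0 : ℝ), Complex.exp (-(Complex.I * (κ : ℝ) * x)) *
      Complex.exp (-(((κ ^ α : ℝ) : ℂ) * a))‖ ≤ C := by
  have hn : ∀ κ : ℝ, ‖Complex.exp (-(((κ ^ α : ℝ) : ℂ) * a))‖ = Real.exp (-a.re * κ ^ α) := by
    intro κ
    rw [Complex.norm_exp, Complex.neg_re, Complex.re_ofReal_mul]; congr 1; ring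
  have hcont : Continuous fun κ : ℝ => Complex.exp (-(((κ ^ α : ℝ) : ℂ) * a)) := by
    have : Continuous fun κ : ℝ => κ ^ α := Real.continuous_rpow_const hα.le
    fun_prop
  have hi0 : IntegrableOn (fun κ : ℝ => Complex.exp (-(((κ ^ α : ℝ) : ℂ) * a))) (Ioi 0) := by
    refine Integrable.mono' (integrableOn_rpow_mul_exp_neg_mul_rpow (s := 0) (by norm_num) hα ha)
      hcont.aestronglyMeasurable.restrict (Eventually.of_forall fun κ => ?_)
    rw [hn, Real.rpow_zero, one_mul]
  have hi1 := (integrableOn_rpow_mul_exp_neg_mul_rpow (s := α - 1) (by linarith) hα ha)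
  have hmeas : Measurable fun κ : ℝ => ((κ ^ (α - 1) : ℝ) : ℂ) := by fun_prop
  have hi2 : ∀ x : ℝ, IntegrableOn (fun κ : ℝ => Complex.exp (-(Complex.I * (κ : ℝ) * x)) *
      (((κ ^ (α - 1) : ℝ) : ℂ) * Complex.exp (-(((κ ^ α : ℝ) : ℂ) * a)))) (Ioi 0) := by
    intro x
    refine Integrable.mono' hi1 ((Continuous.aestronglyMeasurable (by fun_prop)).mul
      (hmeas.aestronglyMeasurable.mul hcont.aestronglyMeasurable)) ?_
    filter_upwards [self_mem_ae_restrict measurableSet_Ioi] with κ hκ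
    have hκ' : (0 : ℝ) < κ := hκ
    rw [norm_mul, norm_exp_I_mul, one_mul, norm_mul, hn, Complex.norm_real,
      Real.norm_of_nonneg (by positivity)]
  -- The `1` is the boundary term at `κ = 0`. The rest bounds the derivative of the stretched
  -- exponential, integrable at `0` because `α - 1 > -1`.
  refine ⟨1 + ‖(α : ℂ) * a‖ * ∫ κ in Ioi (0 : ℝ), κ ^ (α - 1) * Real.exp (-a.re * κ ^ α), fun x => ?_⟩
  have hi3 : IntegrableOn (fun κ : ℝ => Complex.exp (-(Complex.I * (κ : ℝ) * x)) *
      Complex.exp (-(((κ ^ α : ℝ) : ℂ) * a))) (Ioi 0) :=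
    Integrable.bdd_mul (c := 1) hi0 (Continuous.aestronglyMeasurable (by fun_prop))
      (Eventually.of_forall fun κ => (norm_exp_I_mul κ x).le)
  have hd : ∀ κ ∈ Ioi (0 : ℝ), HasDerivAt (fun κ : ℝ => Complex.exp (-(Complex.I * (κ : ℝ) * x)) *
      Complex.exp (-(((κ ^ α : ℝ) : ℂ) * a)))
      ((-(Complex.I * x)) * (Complex.exp (-(Complex.I * (κ : ℝ) * x)) *
        Complex.exp (-(((κ ^ α : ℝ) : ℂ) * a))) +
       (-(α * a)) * (Complex.exp (-(Complex.I * (κ : ℝ) * x)) *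
        (((κ ^ (α - 1) : ℝ) : ℂ) * Complex.exp (-(((κ ^ α : ℝ) : ℂ) * a))))) κ := by
    intro κ hκ
    have h1 : HasDerivAt (fun κ : ℝ => -(Complex.I * (κ : ℝ) * x)) (-(Complex.I * 1 * x)) κ :=
      (((hasDerivAt_id κ).ofReal_comp.const_mul Complex.I).mul_const (x : ℂ)).neg
    have h2 : HasDerivAt (fun κ : ℝ => -(((κ ^ α : ℝ) : ℂ) * a))
        (-(((α * κ ^ (α - 1) : ℝ) : ℂ) * a)) κ :=
      (((Real.hasDerivAt_rpow_const (Or.inl (ne_of_gt hκ))).ofReal_comp).mul_const a).neg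
    refine (h1.cexp.mul h2.cexp).congr_deriv ?_
    push_cast
    ring
  have htop : Tendsto (fun κ : ℝ => Complex.exp (-(Complex.I * (κ : ℝ) * x)) *
      Complex.exp (-(((κ ^ α : ℝ) : ℂ) * a))) atTop (𝓝 0) := by
    rw [tendsto_zero_iff_norm_tendsto_zero]
    simp_rw [norm_mul, norm_exp_I_mul, one_mul, hn]
    have := (tendsto_rpow_atTop hα).const_mul_atTop_of_neg (neg_neg_of_pos ha)
    exact Real.tendsto_exp_atBot.comp this
  have hint := integral_Ioi_of_hasDerivAt_of_tendsto
    (Continuous.continuousWithinAt (by fun_prop)) hd ((hi3.const_mul _).add ((hi2 x).const_mul _)) htop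
  rw [integral_add (hi3.const_mul _) ((hi2 x).const_mul _), integral_const_mul, integral_const_mul] at hint
  have h0 : Complex.exp (-(Complex.I * ((0 : ℝ) : ℂ) * x)) *
      Complex.exp (-((((0 : ℝ) ^ α : ℝ) : ℂ) * a)) = 1 := by simp [Real.zero_rpow hα.ne']
  rw [h0] at hint
  have h5 : ‖∫ κ in Ioi (0 : ℝ), Complex.exp (-(Complex.I * (κ : ℝ) * x)) *
      (((κ ^ (α - 1) : ℝ) : ℂ) * Complex.exp (-(((κ ^ α : ℝ) : ℂ) * a)))‖ ≤
      ∫ κ in Ioi (0 : ℝ), κ ^ (α - 1) * Real.exp (-a.re * κ ^ α) := by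
    refine norm_integral_le_of_norm_le hi1 ?_
    filter_upwards [self_mem_ae_restrict measurableSet_Ioi] with κ hκ
    have hκ' : (0 : ℝ) < κ := hκ
    rw [norm_mul, norm_exp_I_mul, one_mul, norm_mul, hn, Complex.norm_real,
      Real.norm_of_nonneg (by positivity)]
  have h6 : |x| * ‖∫ κ in Ioi (0 : ℝ), Complex.exp (-(Complex.I * (κ : ℝ) * x)) *
      Complex.exp (-(((κ ^ α : ℝ) : ℂ) * a))‖ = ‖(-(Complex.I * x)) * ∫ κ in Ioi (0 : ℝ),
        Complex.exp (-(Complex.I * (κ : ℝ) * x)) * Complex.exp (-(((κ ^ α : ℝ) : ℂ) * a))‖ := by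
    rw [norm_mul]; simp
  rw [h6, eq_sub_of_add_eq hint]
  refine (norm_sub_le _ _).trans (add_le_add (by simp) ?_)
  rw [norm_mul, norm_neg]
  exact mul_le_mul_of_nonneg_left h5 (norm_nonneg _)

lemma exists_abs_mul_stableDensity_le {α θ : ℝ} (hα : 0 < α) (hθ : |θ| < 1) :
    ∃ C, ∀ x, |x| * |stableDensity α θ x| ≤ C := by
  obtain ⟨C, hC⟩ := exists_abs_mul_norm_integral_le hα
    (a := Complex.exp (Complex.I * (θ * Real.pi / 2 : ℝ))) (by
      rw [mul_comm, Complex.exp_ofReal_mul_I_re]; exact cos_pos_of_abs_lt_one hθ)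
  refine ⟨Real.pi⁻¹ * C, fun x => ?_⟩
  have hπ := Real.pi_pos
  rw [stableDensity, fourierPlusInv_of_hermitian (fun κ _ => exp_neg_symbol_hermitian α θ κ)
    (integrable_exp_neg_symbol hα hθ).integrableOn, Complex.ofReal_re, abs_mul,
    abs_of_pos (inv_pos.2 hπ), mul_left_comm]
  refine mul_le_mul_of_nonneg_left ?_ (by positivity)
  refine (mul_le_mul_of_nonneg_left (Complex.abs_re_le_norm _) (abs_nonneg _)).trans ?_
  rw [setIntegral_congr_fun (g := fun κ : ℝ => Complex.exp (-(Complex.I * (κ : ℝ) * x)) *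
    Complex.exp (-(((κ ^ α : ℝ) : ℂ) * Complex.exp (Complex.I * (θ * Real.pi / 2 : ℝ)))))
    measurableSet_Ioi fun κ hκ => by simp only; rw [symbol_of_pos α θ hκ]]
  exact hC x

/-- In `|x| f(x, τ)` the scaling factor `τ^{-1/α}` turns `|x|` into the argument of the stable
density, so the `O(1/|x|)` bound is uniform in `τ`. Together with the trivial bound this controls
the subordination integral near `τ = 0`. -/
lemma exists_parentDensity_le {α θ : ℝ} (hα : 0 < α) (hθ : |θ| < 1) :
    ∃ C, 0 ≤ C ∧ ∀ x τ, 0 < τ → |parentDensity α θ x τ| ≤ C * τ ^ (-(1 / α)) ∧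
      |x| * |parentDensity α θ x τ| ≤ C := by
  obtain ⟨C, hC⟩ := exists_abs_mul_stableDensity_le hα hθ
  set D := (2 * Real.pi)⁻¹ * ∫ κ, ‖Complex.exp (-symbol α θ κ)‖ with hD
  have hD0 : 0 ≤ D := (abs_nonneg _).trans (stableDensity_le 0)
  refine ⟨max C D, le_max_of_le_right hD0, fun x τ hτ => ⟨?_, ?_⟩⟩
  · rw [parentDensity, abs_mul, abs_of_nonneg (by positivity), mul_comm]
    exact mul_le_mul_of_nonneg_right ((stableDensity_le _).trans (le_max_right _ _)) (by positivity)
  · have h := hC (x / τ ^ (1 / α))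
    have hp : 0 < τ ^ (1 / α) := by positivity
    rw [parentDensity, abs_mul, abs_of_nonneg (a := τ ^ (-(1 / α))) (by positivity), ← mul_assoc,
      Real.rpow_neg hτ.le, ← div_eq_mul_inv]
    rw [abs_div, abs_of_pos hp] at h
    exact h.trans (le_max_left _ _)

/-! ### Gamma integrals with complex rate -/

/-- This turns a termwise integrated exponential series into the binomial series of exponent `-a`.
-/
lemma Gamma_add_nat_eq {a : ℝ} (ha : 0 < a) (n : ℕ) :
    Real.Gamma (a + n) = Real.Gamma a * (n.factorial * binomCoeff (-a) n) := by
  induction n with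
  | zero => simp [binomCoeff_zero]
  | succ n ih =>
    have h : a + ((n + 1 : ℕ) : ℝ) = (a + n) + 1 := by push_cast; ring
    rw [h, Real.Gamma_add_one (by positivity), ih, binomCoeff_succ, Nat.factorial_succ]
    push_cast
    field_simp
    ring

lemma integrableOn_rpow_mul_exp_neg {a c : ℝ} (ha : 0 < a) (hc : 0 < c) :
    IntegrableOn (fun r : ℝ => r ^ (a - 1) * Real.exp (-(c * r))) (Ioi 0) := by
  have := integrableOn_rpow_mul_exp_neg_mul_rpow (s := a - 1) (p := 1) (by linarith) one_pos hc
  simpa using this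

/-- The Gamma integral with a complex rate. -/
lemma integral_rpow_mul_cexp_neg {a : ℝ} (ha : 0 < a) {w : ℂ} (hw : 0 < w.re) :
    ∫ r in Ioi (0 : ℝ), ((r ^ (a - 1) : ℝ) : ℂ) * Complex.exp (-(w * r)) =
      (Real.Gamma a : ℂ) * w ^ (-(a : ℂ)) := by
  -- This threshold is equivalent to `‖R - w‖ < R`. Hence `v = 1 - w/R` lies in the unit disc, and
  -- `e^{-wr} = e^{-Rr} e^{Rvr}` can be expanded in powers of `v`.
  obtain ⟨R, hR⟩ := exists_gt (‖w‖ ^ 2 / (2 * w.re))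
  have hR0 : 0 < R := lt_of_le_of_lt (by positivity) hR
  have hRc : (R : ℂ) ≠ 0 := by exact_mod_cast hR0.ne'
  set v : ℂ := 1 - w / R with hv
  have hwv : w = R * (1 - v) := by rw [hv]; field_simp; ring
  have hv1 : ‖v‖ < 1 := by
    have h1 : v = ((R : ℂ) - w) / R := by rw [hv]; field_simp
    rw [h1, norm_div, Complex.norm_real, Real.norm_of_nonneg hR0.le, div_lt_one hR0]
    refine lt_of_pow_lt_pow_left₀ 2 hR0.le ?_
    rw [div_lt_iff₀ (by positivity)] at hR
    rw [← Complex.normSq_eq_norm_sq, Complex.normSq_sub, Complex.normSq_ofReal,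
      Complex.normSq_eq_norm_sq, Complex.re_ofReal_mul, Complex.conj_re]
    nlinarith
  have hint : ∀ n : ℕ, ∀ r ∈ Ioi (0 : ℝ), ((r ^ (a - 1) * Real.exp (-(R * r)) : ℝ) : ℂ) *
      ((R * v * r) ^ n / n.factorial) = ((R : ℂ) * v) ^ n / n.factorial *
        ((r ^ (a + n - 1) * Real.exp (-(R * r)) : ℝ) : ℂ) := by
    intro n r hr
    have : r ^ (a + n - 1) = r ^ (a - 1) * r ^ n := by
      rw [show a + n - 1 = (a - 1) + n by ring, Real.rpow_add hr, Real.rpow_natCast]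
    rw [this]
    push_cast
    ring_nf
  -- A general `u` is kept because the formula serves twice: at `v` for the sum and at `‖v‖` for the
  -- summability of the norms.
  have hval : ∀ n : ℕ, ∀ u : ℂ, (R * u) ^ n / n.factorial *
      ((∫ r in Ioi (0 : ℝ), r ^ (a + n - 1) * Real.exp (-(R * r)) : ℝ) : ℂ) =
      (Real.Gamma a * R ^ (-a) : ℝ) * (binomCoeff (-a) n * u ^ n) := by
    intro n u
    rw [Real.integral_rpow_mul_exp_neg_mul_Ioi (by positivity) hR0, Gamma_add_nat_eq ha]
    have : (1 / R) ^ (a + n) = R ^ (-a) / R ^ n := by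
      rw [one_div, Real.inv_rpow hR0.le, Real.rpow_add hR0, Real.rpow_neg hR0.le, Real.rpow_natCast]
      field_simp
    rw [this]
    have hn : (n.factorial : ℂ) ≠ 0 := by exact_mod_cast n.factorial_ne_zero
    push_cast
    rw [mul_pow]
    field_simp
  have hi : ∀ n : ℕ, IntegrableOn (fun r : ℝ => r ^ (a + n - 1) * Real.exp (-(R * r))) (Ioi 0) :=
    fun n => integrableOn_rpow_mul_exp_neg (by positivity) hR0
  have hs := hasSum_integral_of_summable_integral_norm (μ := volume.restrict (Ioi (0 : ℝ)))
    (F := fun (n : ℕ) (r : ℝ) => ((R : ℂ) * v) ^ n / n.factorial *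
        ((r ^ (a + n - 1) * Real.exp (-(R * r)) : ℝ) : ℂ))
    (fun n => ((hi n).ofReal (𝕜 := ℂ)).const_mul _) (by
      have h1 : ∀ n : ℕ, ∫ r in Ioi (0 : ℝ), ‖((R : ℂ) * v) ^ n / n.factorial *
          ((r ^ (a + n - 1) * Real.exp (-(R * r)) : ℝ) : ℂ)‖ =
          (Real.Gamma a * R ^ (-a)) * (binomCoeff (-a) n * ‖v‖ ^ n) := by
        intro n
        have h2 := hval n (‖v‖ : ℂ)
        have h3 : ∫ r in Ioi (0 : ℝ), ‖((R : ℂ) * v) ^ n / n.factorial *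
          ((r ^ (a + n - 1) * Real.exp (-(R * r)) : ℝ) : ℂ)‖ = (R * ‖v‖) ^ n / n.factorial *
          ∫ r in Ioi (0 : ℝ), r ^ (a + n - 1) * Real.exp (-(R * r)) := by
          rw [← integral_const_mul]
          refine setIntegral_congr_fun measurableSet_Ioi fun r hr => ?_
          have hr' : (0 : ℝ) < r := hr
          rw [norm_mul, Complex.norm_real, Real.norm_of_nonneg (by positivity), norm_div, norm_pow,
            norm_mul, Complex.norm_real, Real.norm_of_nonneg hR0.le, Complex.norm_natCast]
        rw [h3]
        exact_mod_cast h2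
      simp_rw [h1]
      refine Summable.mul_left _ ?_
      have := (hasSum_binomCoeff (-a) (z := (‖v‖ : ℂ)) (by simpa using hv1)).summable
      rw [← Complex.summable_ofReal]
      push_cast
      exact this)
  have hsum : ∀ r : ℝ, r ∈ Ioi (0 : ℝ) → ∑' n : ℕ, ((R : ℂ) * v) ^ n / n.factorial *
        ((r ^ (a + n - 1) * Real.exp (-(R * r)) : ℝ) : ℂ) =
        ((r ^ (a - 1) : ℝ) : ℂ) * Complex.exp (-(w * r)) := by
    intro r hr
    have h1 := (NormedSpace.expSeries_div_hasSum_exp ((R : ℂ) * v * r)).mul_left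
      ((r ^ (a - 1) * Real.exp (-(R * r)) : ℝ) : ℂ)
    rw [← Complex.exp_eq_exp_ℂ] at h1
    simp_rw [hint _ r hr] at h1
    rw [h1.tsum_eq, hwv]
    push_cast
    rw [mul_assoc, ← Complex.exp_add]
    congr 2
    ring
  rw [setIntegral_congr_fun measurableSet_Ioi hsum] at hs
  have h4 : ∀ n : ℕ, ∫ r in Ioi (0 : ℝ), ((R : ℂ) * v) ^ n / n.factorial *
        ((r ^ (a + n - 1) * Real.exp (-(R * r)) : ℝ) : ℂ) =
        (Real.Gamma a * R ^ (-a) : ℝ) * (binomCoeff (-a) n * v ^ n) := by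
    intro n
    rw [integral_const_mul, ← hval, integral_complex_ofReal]
  simp_rw [h4] at hs
  have h5 := (hasSum_binomCoeff (-a) hv1).mul_left (((Real.Gamma a * R ^ (-a) : ℝ)) : ℂ)
  rw [hs.unique h5, hwv]
  have h6 := ofReal_mul_cpow hR0 (1 - v) (-a)
  push_cast at h6 ⊢
  rw [h6, mul_assoc]

lemma norm_cexp_neg_mul (w : ℂ) (r : ℝ) : ‖Complex.exp (-(w * r))‖ = Real.exp (-(w.re * r)) := by
  rw [Complex.norm_exp]; simp

/-- The reflection formula, valid also for integers `s ≥ 1`: there the sine vanishes and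
`Real.Gamma` takes the value `0` at its poles. Such `s` occur among the multiples of `β` in the
Wright series. -/
lemma inv_Gamma_one_sub {s : ℝ} (hs : 0 < s) :
    (Real.Gamma (1 - s))⁻¹ = Real.Gamma s * Real.sin (Real.pi * s) / Real.pi := by
  have h := Real.Gamma_mul_Gamma_one_sub s
  have hG := (Real.Gamma_pos_of_pos hs).ne'
  have hπ := Real.pi_ne_zero
  generalize Real.sin (Real.pi * s) = S at h ⊢
  rcases eq_or_ne S 0 with h0 | h0
  · rw [h0, div_zero] at h
    rw [(mul_eq_zero.1 h).resolve_left hG, h0]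
    simp
  · have h1 : Real.Gamma (1 - s) ≠ 0 := by
      intro h2
      rw [h2, mul_zero] at h
      exact (div_ne_zero hπ h0) h.symm
    field_simp at h ⊢
    linarith

lemma exists_mul_rpow_le {β c : ℝ} (hβ : 0 < β) (hβ1 : β < 1) (hc : 0 < c) (Z : ℝ) :
    ∃ K, ∀ r, 0 < r → Z * r ^ β ≤ c * r + K := by
  have h1 := (tendsto_rpow_neg_atTop (sub_pos.2 hβ1)).eventually_le_const
    (u := c / (|Z| + 1)) (by positivity)
  obtain ⟨U, hU⟩ := eventually_atTop.1 h1
  set V := max U 1 with hV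
  have hV0 : 0 < V := by positivity
  refine ⟨|Z| * V ^ β, fun r hr => ?_⟩
  have hrb : 0 ≤ r ^ β := by positivity
  have hZ : Z * r ^ β ≤ |Z| * r ^ β := mul_le_mul_of_nonneg_right (le_abs_self Z) hrb
  rcases le_total V r with h | h
  · have h2 := hU r ((le_max_left _ _).trans h)
    have h2' : r ^ β = r ^ (-(1 - β)) * r := by
      rw [← Real.rpow_add_one hr.ne']; congr 1; ring
    have h3 : |Z| * (c / (|Z| + 1)) ≤ c := by
      rw [mul_div_assoc', div_le_iff₀ (by positivity)]
      nlinarith [abs_nonneg Z]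
    have h4 : |Z| * r ^ β ≤ c * r := by
      calc |Z| * r ^ β ≤ |Z| * (c / (|Z| + 1) * r) := by rw [h2']; gcongr
        _ = |Z| * (c / (|Z| + 1)) * r := by ring
        _ ≤ c * r := by gcongr
    have : 0 ≤ |Z| * V ^ β := by positivity
    linarith
  · have h2 : r ^ β ≤ V ^ β := Real.rpow_le_rpow hr.le h hβ.le
    have h3 : |Z| * r ^ β ≤ |Z| * V ^ β := by gcongr
    have : 0 ≤ c * r := by positivity
    linarith

lemma integrableOn_rpow_mul_exp_mul_exp_rpow {a β c : ℝ} (ha : 0 < a) (hβ : 0 < β) (hβ1 : β < 1)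
    (hc : 0 < c) (Z : ℝ) :
    IntegrableOn (fun r : ℝ => r ^ (a - 1) * Real.exp (-(c * r)) * Real.exp (Z * r ^ β)) (Ioi 0) := by
  obtain ⟨K, hK⟩ := exists_mul_rpow_le hβ hβ1 (half_pos hc) Z
  refine Integrable.mono' ((integrableOn_rpow_mul_exp_neg ha (half_pos hc)).mul_const (Real.exp K))
    (by fun_prop) ?_
  filter_upwards [self_mem_ae_restrict measurableSet_Ioi] with r hr
  have hr' : (0 : ℝ) < r := hr
  rw [Real.norm_of_nonneg (by positivity), mul_assoc, mul_assoc, ← Real.exp_add, ← Real.exp_add]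
  have := hK r hr
  exact mul_le_mul_of_nonneg_left (Real.exp_le_exp.2 (by linarith)) (by positivity)

/-! ### Integral representation of `q_β` along rays -/

/-- The integrand of the Hankel-type representation of `operationalDensity` along the ray of
angle `φ`. -/
def rayIntegrand (β τ t φ r : ℝ) : ℂ :=
  Complex.exp (Complex.exp (Complex.I * φ) * (t * r : ℝ)) *
    (((r ^ (β - 1) : ℝ) : ℂ) * Complex.exp (Complex.I * (β * φ : ℝ))) *
    Complex.exp (-((τ * r ^ β : ℝ) * Complex.exp (Complex.I * (β * φ : ℝ))))

lemma re_exp_I_mul (y : ℝ) : (Complex.exp (Complex.I * y)).re = Real.cos y := by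
  rw [mul_comm, Complex.exp_ofReal_mul_I_re]

lemma im_exp_I_mul (y : ℝ) : (Complex.exp (Complex.I * y)).im = Real.sin y := by
  rw [mul_comm, Complex.exp_ofReal_mul_I_im]

lemma norm_exp_I_ofReal (y : ℝ) : ‖Complex.exp (Complex.I * y)‖ = 1 := by
  rw [mul_comm, Complex.norm_exp_ofReal_mul_I]

lemma norm_rayIntegrand (β τ t φ : ℝ) {r : ℝ} (hr : 0 < r) : ‖rayIntegrand β τ t φ r‖ =
    Real.exp (Real.cos φ * (t * r)) * r ^ (β - 1) *
      Real.exp (-(τ * r ^ β * Real.cos (β * φ))) := by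
  rw [rayIntegrand, norm_mul, norm_mul, norm_mul, norm_exp_I_ofReal, mul_one, Complex.norm_real,
    Real.norm_of_nonneg (by positivity), Complex.norm_exp, Complex.norm_exp, Complex.neg_re,
    Complex.re_ofReal_mul, re_exp_I_mul, Complex.re_mul_ofReal, re_exp_I_mul]

lemma measurable_rayIntegrand (β τ t φ : ℝ) : Measurable (rayIntegrand β τ t φ) := by
  unfold rayIntegrand
  fun_prop

/-- The representation of the kernel by an integral along a ray in the open left half-plane. -/
lemma operationalDensity_eq_ray {β : ℝ} (hβ : 0 < β) (hβ1 : β < 1) (τ : ℝ) {t : ℝ} (ht : 0 < t)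
    {φ : ℝ} (hφ : Real.pi / 2 < φ) (hφ1 : φ ≤ Real.pi) :
    operationalDensity β τ t = Real.pi⁻¹ * (∫ r in Ioi (0 : ℝ), rayIntegrand β τ t φ r).im := by
  have hπ := Real.pi_pos
  set w : ℂ := Complex.exp (Complex.I * (φ - Real.pi : ℝ)) with hw
  have hwφ : Complex.exp (Complex.I * φ) = -w := by
    rw [hw]; push_cast
    rw [mul_sub, Complex.exp_sub, mul_comm Complex.I (Real.pi : ℂ), Complex.exp_pi_mul_I, div_neg,
      div_one, neg_neg]
  have hwre : 0 < w.re := by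
    rw [hw, re_exp_I_mul]
    exact Real.cos_pos_of_mem_Ioo ⟨by linarith, by linarith⟩
  have htw : 0 < ((t : ℂ) * w).re := by rw [Complex.re_ofReal_mul]; positivity
  set e : ℂ := Complex.exp (Complex.I * (β * φ : ℝ)) with he
  have hen : ‖e‖ = 1 := norm_exp_I_ofReal _
  set s : ℕ → ℝ := fun n => β * (n + 1) with hs
  have hs0 : ∀ n, 0 < s n := fun n => by rw [hs]; positivity
  -- the terms of the expansion
  set F : ℕ → ℝ → ℂ := fun n r => ((-τ : ℂ)) ^ n / n.factorial * e ^ (n + 1) *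
    (((r ^ (s n - 1) : ℝ) : ℂ) * Complex.exp (-(t * w * r))) with hF
  have hFi : ∀ n, IntegrableOn (F n) (Ioi 0) := by
    intro n
    refine Integrable.const_mul ?_ _
    refine Integrable.mono' (integrableOn_rpow_mul_exp_neg (hs0 n) htw) (by fun_prop) ?_
    filter_upwards [self_mem_ae_restrict measurableSet_Ioi] with r hr
    have hr' : (0 : ℝ) < r := hr
    rw [norm_mul, norm_cexp_neg_mul, Complex.norm_real, Real.norm_of_nonneg (by positivity)]
  have hFn : ∀ n, ∀ r ∈ Ioi (0 : ℝ), ‖F n r‖ = r ^ (β - 1) * Real.exp (-(((t : ℂ) * w).re * r)) *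
      ((|τ| * r ^ β) ^ n / n.factorial) := by
    intro n r hr
    have hr' : (0 : ℝ) < r := hr
    have h1 : r ^ (s n - 1) = r ^ (β - 1) * (r ^ β) ^ n := by
      rw [← Real.rpow_natCast (r ^ β), ← Real.rpow_mul hr'.le, ← Real.rpow_add hr']
      congr 1; rw [hs]; ring
    simp only [hF]
    rw [norm_mul, norm_mul, norm_mul, norm_cexp_neg_mul, Complex.norm_real,
      Real.norm_of_nonneg (by positivity), norm_pow, hen, one_pow, mul_one, norm_div, norm_pow,
      norm_neg, Complex.norm_real, Complex.norm_natCast, Real.norm_eq_abs, h1]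
    ring
  have hFs : Summable fun n => ∫ r in Ioi (0 : ℝ), ‖F n r‖ := by
    have hb := integrableOn_rpow_mul_exp_mul_exp_rpow hβ hβ hβ1 htw |τ|
    refine summable_of_sum_range_le (c := ∫ r in Ioi (0 : ℝ), r ^ (β - 1) *
      Real.exp (-(((t : ℂ) * w).re * r)) * Real.exp (|τ| * r ^ β))
      (fun n => integral_nonneg fun _ => norm_nonneg _) fun n => ?_
    rw [← integral_finsetSum _ fun i _ => (hFi i).norm]
    refine setIntegral_mono_on (integrable_finsetSum _ fun i _ => (hFi i).norm) hb
      measurableSet_Ioi fun r hr => ?_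
    have hr' : (0 : ℝ) < r := hr
    rw [Finset.sum_congr rfl fun i _ => hFn i r hr, ← Finset.mul_sum]
    exact mul_le_mul_of_nonneg_left (Real.sum_le_exp_of_nonneg (by positivity) _) (by positivity)
  have hFsum : ∀ r ∈ Ioi (0 : ℝ), ∑' n, F n r = rayIntegrand β τ t φ r := by
    intro r hr
    have hr' : (0 : ℝ) < r := hr
    have h1 := (NormedSpace.expSeries_div_hasSum_exp (-((τ * r ^ β : ℝ) * e) : ℂ)).mul_left
      (Complex.exp (-(t * w * r)) * (((r ^ (β - 1) : ℝ) : ℂ) * e))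
    rw [← Complex.exp_eq_exp_ℂ] at h1
    have h2 : rayIntegrand β τ t φ r = Complex.exp (-(t * w * r)) * (((r ^ (β - 1) : ℝ) : ℂ) * e) *
        Complex.exp (-((τ * r ^ β : ℝ) * e)) := by
      rw [rayIntegrand, hwφ, ← he]
      congr 3
      push_cast; ring
    rw [h2, ← h1.tsum_eq]
    congr 1; ext n
    have h3 : r ^ (s n - 1) = r ^ (β - 1) * (r ^ β) ^ n := by
      rw [← Real.rpow_natCast (r ^ β), ← Real.rpow_mul hr'.le, ← Real.rpow_add hr']
      congr 1; rw [hs]; ring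
    simp only [hF]
    rw [h3]
    push_cast
    rw [neg_pow ((τ : ℂ) * _ * e), mul_pow, mul_pow, neg_pow (τ : ℂ)]
    ring
  have h1 := hasSum_integral_of_summable_integral_norm hFi hFs
  rw [setIntegral_congr_fun measurableSet_Ioi hFsum] at h1
  have h2 := Complex.imCLM.hasSum h1
  -- The phase `e^{i s_n (π - φ)}` of the Gamma integral combines with `e^{i s_n φ}` to `e^{iπ
  -- s_n}`, which is independent of the ray. Its imaginary part becomes `1 / Γ(1 - s_n)` by
  -- reflection, the Wright coefficient.
  have h3 : ∀ n, (∫ r in Ioi (0 : ℝ), F n r).im = t ^ (-β) * (Real.pi * ((-(τ / t ^ β)) ^ n /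
      (n.factorial * Real.Gamma (-β * n + (1 - β))))) := by
    intro n
    have e1 : Real.Gamma (-β * n + (1 - β)) = Real.Gamma (1 - s n) := by congr 1; rw [hs]; ring
    have e2 : ((t : ℂ) * w) ^ (-(s n : ℂ)) = ((t ^ (-s n) : ℝ) : ℂ) *
        Complex.exp (Complex.I * (s n * (Real.pi - φ) : ℝ)) := by
      have := ofReal_mul_cpow ht w (-s n)
      rw [Complex.ofReal_neg] at this
      rw [this, hw, Complex.cpow_def_of_ne_zero (Complex.exp_ne_zero _), Complex.log_exp]
      · congr 2; push_cast; ring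
      · simp; linarith
      · simp; linarith
    have e3 : e ^ (n + 1) * Complex.exp (Complex.I * (s n * (Real.pi - φ) : ℝ)) =
        Complex.exp (Complex.I * (Real.pi * s n : ℝ)) := by
      rw [he, ← Complex.exp_nat_mul, ← Complex.exp_add]
      congr 1
      rw [hs]; push_cast; ring
    have e4 : t ^ (-s n) = t ^ (-β) * ((t ^ β) ^ n)⁻¹ := by
      rw [← Real.rpow_natCast (t ^ β), ← Real.rpow_mul ht.le, ← Real.rpow_neg ht.le, ← Real.rpow_add ht]
      congr 1; rw [hs]; ring
    have e5 : ∫ r in Ioi (0 : ℝ), F n r = (((-τ) ^ n / n.factorial * Real.Gamma (s n) * t ^ (-s n) : ℝ) : ℂ) *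
        Complex.exp (Complex.I * (Real.pi * s n : ℝ)) := by
      simp only [hF]
      rw [integral_const_mul, integral_rpow_mul_cexp_neg (hs0 n) htw, e2, ← e3]
      push_cast
      ring
    rw [e5, Complex.im_ofReal_mul, im_exp_I_mul, e1, div_mul_eq_div_div, div_eq_mul_inv _ (Real.Gamma _),
      inv_Gamma_one_sub (hs0 n), e4, neg_pow τ, neg_pow (τ / _), div_pow]
    field_simp
  have h4 : HasSum (fun n : ℕ => t ^ (-β) * (Real.pi * ((-(τ / t ^ β)) ^ n /
      (n.factorial * Real.Gamma (-β * n + (1 - β)))))) (∫ r in Ioi (0 : ℝ), rayIntegrand β τ t φ r).im :=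
    h2.congr_fun fun n => (h3 n).symm
  rw [← h4.tsum_eq, operationalDensity, wrightM, wright, tsum_mul_left, tsum_mul_left]
  field_simp

lemma wrightM_eq_operationalDensity (β z : ℝ) : wrightM β z = operationalDensity β z 1 := by
  simp [operationalDensity]

/-- On the ray `φ = π` the factor `e^{-r}` dominates `exp((|z| + 1) r^β)`, which gives a majorant
locally uniform in `z`. -/
lemma continuous_wrightM {β : ℝ} (hβ : 0 < β) (hβ1 : β < 1) : Continuous (wrightM β) := by
  have hπ := Real.pi_pos
  have h : wrightM β = fun z => Real.pi⁻¹ * (∫ r in Ioi (0 : ℝ), rayIntegrand β z 1 Real.pi r).im := by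
    ext z
    rw [wrightM_eq_operationalDensity,
      operationalDensity_eq_ray hβ hβ1 z one_pos (by linarith) le_rfl]
  rw [h]
  refine continuous_const.mul (Complex.continuous_im.comp (continuous_iff_continuousAt.2 fun z => ?_))
  refine continuousAt_of_dominated (bound := fun r => r ^ (β - 1) * Real.exp (-(1 * r)) *
    Real.exp ((|z| + 1) * r ^ β)) (Eventually.of_forall fun y =>
      (measurable_rayIntegrand β y 1 Real.pi).aestronglyMeasurable) ?_
    (integrableOn_rpow_mul_exp_mul_exp_rpow hβ hβ hβ1 one_pos _) ?_
  · have hz : ∀ᶠ y in 𝓝 z, |y| < |z| + 1 :=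
      (continuous_abs.tendsto z).eventually_lt_const (by linarith)
    filter_upwards [hz] with y hy
    filter_upwards [self_mem_ae_restrict measurableSet_Ioi] with r hr
    have hr' : (0 : ℝ) < r := hr
    rw [norm_rayIntegrand β y 1 Real.pi hr, Real.cos_pi, mul_comm (Real.exp _) (r ^ _)]
    have h1 : -(y * r ^ β * Real.cos (β * Real.pi)) ≤ (|z| + 1) * r ^ β := by
      have hc := Real.abs_cos_le_one (β * Real.pi)
      have hrb : 0 ≤ r ^ β := by positivity
      calc _ ≤ |y * r ^ β * Real.cos (β * Real.pi)| := neg_le_abs _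
        _ = |y| * r ^ β * |Real.cos (β * Real.pi)| := by rw [abs_mul, abs_mul, abs_of_nonneg hrb]
        _ ≤ |y| * r ^ β * 1 := by gcongr
        _ ≤ _ := by rw [mul_one]; gcongr
    have h2 : -1 * (1 * r) = -(1 * r) := by ring
    rw [h2]
    exact mul_le_mul_of_nonneg_left (Real.exp_le_exp.2 h1) (by positivity)
  · refine Eventually.of_forall fun r => Continuous.continuousAt ?_
    unfold rayIntegrand
    fun_prop

/-! ### The kernel `s^{β-1} exp(-τ s^β)` and positivity of `q_β` -/

/-- The Laplace transform in time of `operationalDensity β τ`. -/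
def laplaceKernel (β τ : ℝ) (s : ℂ) : ℂ :=
  s ^ ((β : ℂ) - 1) * Complex.exp (-((τ : ℂ) * s ^ (β : ℂ)))

lemma cos_mul_pi_div_two_pos {β : ℝ} (hβ : 0 < β) (hβ1 : β < 1) : 0 < Real.cos (β * (Real.pi / 2)) := by
  have hπ := Real.pi_pos
  exact Real.cos_pos_of_mem_Ioo ⟨by nlinarith, by nlinarith⟩

/-- On the closed right half-plane `|arg s| ≤ π/2`, and the cosine decreases on `[0, π]`. -/
lemma cpow_re_ge {β : ℝ} (hβ : 0 < β) (hβ1 : β ≤ 1) {s : ℂ} (hs : 0 ≤ s.re) :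
    ‖s‖ ^ β * Real.cos (β * (Real.pi / 2)) ≤ (s ^ (β : ℂ)).re := by
  rcases eq_or_ne s 0 with rfl | h0
  · have : (β : ℂ) ≠ 0 := by exact_mod_cast hβ.ne'
    simp [Real.zero_rpow hβ.ne', this]
  have hn : 0 < ‖s‖ := norm_pos_iff.2 h0
  have e : s ^ (β : ℂ) = ((‖s‖ ^ β : ℝ) : ℂ) * Complex.exp (Complex.I * (β * Complex.arg s : ℝ)) := by
    rw [Complex.cpow_def_of_ne_zero h0, Complex.log, add_mul, Complex.exp_add, Real.rpow_def_of_pos hn]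
    push_cast
    congr 2
    ring
  rw [e, Complex.re_ofReal_mul, re_exp_I_mul]
  have ha := Complex.abs_arg_le_pi_div_two_iff.2 hs
  refine mul_le_mul_of_nonneg_left ?_ (by positivity)
  rw [← Real.cos_abs (β * Complex.arg s), abs_mul, abs_of_pos hβ]
  have hπ := Real.pi_pos
  exact Real.cos_le_cos_of_nonneg_of_le_pi (by positivity) (by nlinarith) (by gcongr)

/-- The bound involves only `|im s|`, so a single integrable majorant serves all vertical lines in
the closed right half-plane. -/
lemma norm_laplaceKernel_le {β : ℝ} (hβ : 0 < β) (hβ1 : β < 1) {τ : ℝ} (hτ : 0 ≤ τ) {s : ℂ}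
    (hs : 0 ≤ s.re) (him : s.im ≠ 0) : ‖laplaceKernel β τ s‖ ≤
      |s.im| ^ (β - 1) * Real.exp (-(τ * Real.cos (β * (Real.pi / 2))) * |s.im| ^ β) := by
  have h1 := Complex.abs_im_le_norm s
  have h2 : 0 < |s.im| := abs_pos.2 him
  have hc := cos_mul_pi_div_two_pos hβ hβ1
  have e : (β : ℂ) - 1 = ((β - 1 : ℝ) : ℂ) := by push_cast; rfl
  rw [laplaceKernel, norm_mul, e, Complex.norm_cpow_real, Complex.norm_exp, Complex.neg_re,
    Complex.re_ofReal_mul]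
  refine mul_le_mul (Real.rpow_le_rpow_of_nonpos h2 h1 (by linarith)) (Real.exp_le_exp.2 ?_)
    (Real.exp_pos _).le (by positivity)
  have h3 := cpow_re_ge hβ hβ1.le hs
  have h4 : |s.im| ^ β ≤ ‖s‖ ^ β := Real.rpow_le_rpow h2.le h1 hβ.le
  have h5 : |s.im| ^ β * Real.cos (β * (Real.pi / 2)) ≤ (s ^ (β : ℂ)).re :=
    (mul_le_mul_of_nonneg_right h4 hc.le).trans h3
  have := mul_le_mul_of_nonneg_left h5 hτ
  linarith

lemma integrable_laplaceBound {β : ℝ} (hβ : 0 < β) {c : ℝ} (hc : 0 < c) :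
    Integrable fun κ : ℝ => |κ| ^ (β - 1) * Real.exp (-c * |κ| ^ β) := by
  have h := integrableOn_rpow_mul_exp_neg_mul_rpow (s := β - 1) (by linarith) hβ hc
  -- A real even function is Hermitian once viewed as complex valued, so the half-line suffices.
  have h1 : IntegrableOn (fun κ : ℝ => ((|κ| ^ (β - 1) * Real.exp (-c * |κ| ^ β) : ℝ) : ℂ)) (Ioi 0) := by
    refine IntegrableOn.congr_fun (h.ofReal (𝕜 := ℂ)) (fun κ hκ => ?_) measurableSet_Ioi
    have : (0 : ℝ) < κ := hκ
    simp only [abs_of_pos this]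
    rfl
  have h2 := integrable_of_hermitian (fun κ _ => by simp only [abs_neg, Complex.conj_ofReal]) h1
  refine h2.re.congr (Eventually.of_forall fun κ => ?_)
  exact Complex.ofReal_re _

lemma mul_cpow_I {β r : ℝ} (hr : 0 < r) : (Complex.I * r) ^ (β : ℂ) =
    ((r ^ β : ℝ) : ℂ) * Complex.exp (Complex.I * (β * (Real.pi / 2) : ℝ)) := by
  rw [cpow_I_mul_pos β hr]; congr 3; push_cast; ring

lemma rayIntegrand_pi_div_two (β τ t : ℝ) {r : ℝ} (hr : 0 < r) :
    rayIntegrand β τ t (Real.pi / 2) r =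
      Complex.I * (Complex.exp (-(Complex.I * (r : ℝ) * (-t : ℝ))) * laplaceKernel β τ (Complex.I * r)) := by
  have e : (β : ℂ) - 1 = ((β - 1 : ℝ) : ℂ) := by push_cast; rfl
  have eI : Complex.exp (Complex.I * (Real.pi / 2 : ℝ)) = Complex.I := by
    push_cast; rw [mul_comm]; exact Complex.exp_pi_div_two_mul_I
  have e2 : Complex.I * Complex.exp (Complex.I * ((β - 1) * (Real.pi / 2) : ℝ)) =
      Complex.exp (Complex.I * (β * (Real.pi / 2) : ℝ)) := by
    nth_rewrite 1 [← eI]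
    rw [← Complex.exp_add]; congr 1; push_cast; ring
  rw [rayIntegrand, laplaceKernel, e, mul_cpow_I hr, mul_cpow_I hr, eI, ← e2]
  have e3 : Complex.I * ((t * r : ℝ) : ℂ) = -(Complex.I * (r : ℝ) * ((-t : ℝ) : ℂ)) := by push_cast; ring
  rw [e3]
  push_cast
  ring_nf

lemma laplaceKernel_hermitian {β τ : ℝ} (κ : ℝ) (hκ : 0 < κ) :
    laplaceKernel β τ (Complex.I * ((-κ : ℝ) : ℂ)) =
      (starRingEnd ℂ) (laplaceKernel β τ (Complex.I * κ)) := by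
  have e1 : Complex.I * ((-κ : ℝ) : ℂ) = (starRingEnd ℂ) (Complex.I * κ) := by simp
  have harg : (Complex.I * κ).arg ≠ Real.pi := by
    rw [mul_comm, Complex.arg_real_mul _ hκ, Complex.arg_I]
    have := Real.pi_pos
    linarith
  have hc : ∀ b : ℝ, (starRingEnd ℂ) (Complex.I * κ) ^ (b : ℂ) =
      (starRingEnd ℂ) ((Complex.I * κ) ^ (b : ℂ)) := by
    intro b
    rw [Complex.conj_cpow _ _ harg, Complex.conj_ofReal]
  have e : (β : ℂ) - 1 = ((β - 1 : ℝ) : ℂ) := by push_cast; rfl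
  rw [e1, laplaceKernel, laplaceKernel, e, hc, hc, map_mul, ← Complex.exp_conj, map_neg, map_mul,
    Complex.conj_ofReal]

lemma measurable_laplaceKernel (β τ : ℝ) : Measurable (laplaceKernel β τ) := by
  unfold laplaceKernel; fun_prop

lemma integrable_laplaceKernel {β : ℝ} (hβ : 0 < β) (hβ1 : β < 1) {τ : ℝ} (hτ : 0 < τ) {σ : ℝ}
    (hσ : 0 ≤ σ) : Integrable fun κ : ℝ => laplaceKernel β τ (σ + Complex.I * κ) := by
  refine (integrable_laplaceBound hβ (mul_pos hτ (cos_mul_pi_div_two_pos hβ hβ1))).mono'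
    ((measurable_laplaceKernel β τ).comp (by fun_prop)).aestronglyMeasurable ?_
  filter_upwards [Measure.ae_ne volume (0 : ℝ)] with κ hκ
  simpa using norm_laplaceKernel_le hβ hβ1 hτ.le (s := σ + Complex.I * κ) (by simpa using hσ)
    (by simpa using hκ)

lemma integrable_laplaceKernel_I {β : ℝ} (hβ : 0 < β) (hβ1 : β < 1) {τ : ℝ} (hτ : 0 < τ) :
    Integrable fun κ : ℝ => laplaceKernel β τ (Complex.I * κ) := by
  simpa using integrable_laplaceKernel hβ hβ1 hτ (σ := 0) le_rfl

/-- For `φ > π/2` the ray integral converges because of `e^{tr cos φ}`. This decay is lost as `φ ↓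
π/2`, but for `τ > 0` the factor `exp(-τ r^β cos(βφ))` still dominates. -/
lemma operationalDensity_eq_fourier {β : ℝ} (hβ : 0 < β) (hβ1 : β < 1) {τ : ℝ} (hτ : 0 < τ)
    {t : ℝ} (ht : 0 < t) : (operationalDensity β τ t : ℂ) =
      fourierPlusInv (fun κ => laplaceKernel β τ (Complex.I * κ)) (-t) := by
  have hπ := Real.pi_pos
  have hc := cos_mul_pi_div_two_pos hβ hβ1
  -- Half the limiting cosine, so that `cos(βφ) > c` for all `φ` close to `π/2`.
  set c := Real.cos (β * (Real.pi / 2)) / 2 with hcdef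
  have hcpos : 0 < c := by positivity
  rw [fourierPlusInv_of_hermitian laplaceKernel_hermitian
    (integrable_laplaceKernel_I hβ hβ1 hτ).integrableOn]
  congr 1
  have h1 : (∫ κ in Ioi (0 : ℝ), Complex.exp (-(Complex.I * (κ : ℝ) * (-t : ℝ))) *
      laplaceKernel β τ (Complex.I * κ)).re =
      (∫ r in Ioi (0 : ℝ), rayIntegrand β τ t (Real.pi / 2) r).im := by
    rw [setIntegral_congr_fun measurableSet_Ioi fun r hr => rayIntegrand_pi_div_two β τ t hr,
      integral_const_mul, Complex.I_mul_im]
  rw [h1]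
  have hlim : Tendsto (fun φ => ∫ r in Ioi (0 : ℝ), rayIntegrand β τ t φ r) (𝓝[>] (Real.pi / 2))
      (𝓝 (∫ r in Ioi (0 : ℝ), rayIntegrand β τ t (Real.pi / 2) r)) := by
    refine tendsto_integral_filter_of_dominated_convergence
      (fun r => r ^ (β - 1) * Real.exp (-(τ * c) * r ^ β))
      (Eventually.of_forall fun φ => (measurable_rayIntegrand β τ t φ).aestronglyMeasurable) ?_
      (integrableOn_rpow_mul_exp_neg_mul_rpow (by linarith) hβ (by positivity)) ?_
    · have h2 : ∀ᶠ φ in 𝓝[>] (Real.pi / 2), c < Real.cos (β * φ) := by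
        have : Continuous fun φ => Real.cos (β * φ) := by fun_prop
        exact ((this.tendsto _).mono_left nhdsWithin_le_nhds).eventually_const_lt (by linarith)
      have h3 : ∀ᶠ φ in 𝓝[>] (Real.pi / 2), φ ∈ Ioo (Real.pi / 2) Real.pi :=
        Ioo_mem_nhdsGT (by linarith)
      filter_upwards [h2, h3] with φ hφ hφ2
      filter_upwards [self_mem_ae_restrict measurableSet_Ioi] with r hr
      have hr' : (0 : ℝ) < r := hr
      rw [norm_rayIntegrand β τ t φ hr]
      have hcos : Real.cos φ ≤ 0 :=
        Real.cos_nonpos_of_pi_div_two_le_of_le hφ2.1.le (by linarith [hφ2.2])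
      have h4 : Real.exp (Real.cos φ * (t * r)) ≤ 1 := by
        rw [Real.exp_le_one_iff]
        exact mul_nonpos_of_nonpos_of_nonneg hcos (by positivity)
      have h5 : Real.exp (-(τ * r ^ β * Real.cos (β * φ))) ≤ Real.exp (-(τ * c) * r ^ β) := by
        rw [Real.exp_le_exp]
        have : τ * r ^ β * c ≤ τ * r ^ β * Real.cos (β * φ) := by gcongr
        linarith
      calc _ ≤ 1 * r ^ (β - 1) * Real.exp (-(τ * c) * r ^ β) := by gcongr
        _ = _ := by ring
    · refine Eventually.of_forall fun r => ?_
      have : Continuous fun φ => rayIntegrand β τ t φ r := by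
        unfold rayIntegrand; fun_prop
      exact (this.tendsto _).mono_left nhdsWithin_le_nhds
  have h6 := ((Complex.continuous_im.tendsto _).comp hlim).const_mul Real.pi⁻¹
  refine tendsto_nhds_unique (tendsto_const_nhds.congr' ?_) h6
  have h3 : ∀ᶠ φ in 𝓝[>] (Real.pi / 2), φ ∈ Ioo (Real.pi / 2) Real.pi :=
    Ioo_mem_nhdsGT (by linarith)
  filter_upwards [h3] with φ hφ
  exact operationalDensity_eq_ray hβ hβ1 τ ht hφ.1 hφ.2.le

/-- The factor `(iκ)^{β-1}` is unbounded at `0` and so is not a multiplier. It is the limit of the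
multipliers `(1/(n+1) + iκ)^{β-1}`, applied to the integrable function `exp(-τ (iκ)^β)`. -/
lemma fourierNonneg_laplaceKernel {β : ℝ} (hβ : 0 < β) (hβ1 : β < 1) {τ : ℝ} (hτ : 0 < τ) :
    FourierNonneg fun κ : ℝ => laplaceKernel β τ (Complex.I * κ) := by
  have hc := cos_mul_pi_div_two_pos hβ hβ1
  have e : (β : ℂ) - 1 = ((β - 1 : ℝ) : ℂ) := by push_cast; rfl
  have hP := posMult_exp_neg_cpow_I hβ hβ1.le hτ.le 1
  have hnorm : ∀ κ : ℝ, ‖Complex.exp (-(τ * (Complex.I * (1 : ℝ) * κ : ℂ) ^ (β : ℂ)))‖ ≤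
      Real.exp (-(τ * Real.cos (β * (Real.pi / 2))) * |κ| ^ β) := by
    intro κ
    rw [Complex.norm_exp, Complex.neg_re, Complex.re_ofReal_mul, Real.exp_le_exp]
    have h := cpow_re_ge hβ hβ1.le (s := Complex.I * (1 : ℝ) * κ) (by simp)
    have h2 : ‖Complex.I * ((1 : ℝ) : ℂ) * κ‖ = |κ| := by simp
    rw [h2] at h
    have := mul_le_mul_of_nonneg_left h hτ.le
    linarith
  have hI : Integrable fun κ : ℝ => Complex.exp (-(τ * (Complex.I * (1 : ℝ) * κ : ℂ) ^ (β : ℂ))) := by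
    refine Integrable.mono' (g := fun κ : ℝ =>
      Real.exp (-(τ * Real.cos (β * (Real.pi / 2))) * |κ| ^ β)) ?_ hP.measurable.aestronglyMeasurable
      (Eventually.of_forall hnorm)
    -- The symbol with order and skewness both `β` is `(iκ)^β`. Its exponential has the required
    -- modulus after rescaling by `τ^{1/β}`.
    have h := (integrable_exp_neg_symbol (α := β) (θ := β) hβ (by rwa [abs_of_pos hβ]))
    have h' := ((fun n : ℕ => h) 0).norm.comp_mul_left' (R := τ ^ (1 / β)) (by positivity)
    refine h'.congr (Eventually.of_forall fun κ => ?_)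
    simp only
    rw [norm_exp_neg_symbol hβ, abs_mul, abs_of_pos (a := τ ^ (1 / β)) (by positivity),
      Real.mul_rpow (by positivity) (abs_nonneg _), ← Real.rpow_mul hτ.le,
      one_div_mul_cancel hβ.ne', Real.rpow_one]
    congr 1
    rw [mul_div_assoc]; ring
  refine FourierNonneg.of_tendsto (w := fun (n : ℕ) (κ : ℝ) =>
    (((1 / ((n : ℝ) + 1) : ℝ) : ℂ) + Complex.I * (1 : ℝ) * κ) ^ ((β - 1 : ℝ) : ℂ) *
      Complex.exp (-(τ * (Complex.I * (1 : ℝ) * κ : ℂ) ^ (β : ℂ))))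
    (b := fun κ => |κ| ^ (β - 1) * Real.exp (-(τ * Real.cos (β * (Real.pi / 2))) * |κ| ^ β))
    (fun n => (posMult_cpow_of_nonpos (by linarith) (by positivity) 1).mul_fourierNonneg _
      (hP.fourierNonneg hI)) (integrable_laplaceBound hβ (mul_pos hτ hc)) (fun n => ?_) ?_
  · filter_upwards [Measure.ae_ne volume (0 : ℝ)] with κ hκ
    rw [norm_mul, Complex.norm_cpow_real]
    refine mul_le_mul (Real.rpow_le_rpow_of_nonpos (abs_pos.2 hκ) ?_ (by linarith)) (hnorm κ)
      (norm_nonneg _) (by positivity)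
    have := Complex.abs_im_le_norm (((1 / ((n : ℝ) + 1) : ℝ) : ℂ) + Complex.I * (1 : ℝ) * κ)
    have h2 : (((1 / ((n : ℝ) + 1) : ℝ) : ℂ) + Complex.I * (1 : ℝ) * κ).im = κ := by
      rw [Complex.add_im, Complex.ofReal_im]; simp
    rwa [h2] at this
  · filter_upwards [Measure.ae_ne volume (0 : ℝ)] with κ hκ
    have h1 : Tendsto (fun n : ℕ => (((1 / ((n : ℝ) + 1) : ℝ)) : ℂ) + Complex.I * (1 : ℝ) * κ) atTop
        (𝓝 (((0 : ℝ) : ℂ) + Complex.I * (1 : ℝ) * κ)) :=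
      ((Complex.continuous_ofReal.tendsto _).comp
        tendsto_one_div_add_atTop_nhds_zero_nat).add_const _
    have h2 : (((0 : ℝ) : ℂ) + Complex.I * (1 : ℝ) * κ) = Complex.I * κ := by simp
    rw [h2] at h1
    have h3 : Complex.I * κ ∈ Complex.slitPlane := by
      right; simpa using hκ
    have h4 : Complex.I * ((1 : ℝ) : ℂ) * κ = Complex.I * κ := by simp
    rw [h4] at h1 ⊢
    rw [laplaceKernel, e]
    exact (((continuousAt_cpow_const (b := ((β - 1 : ℝ) : ℂ)) h3).tendsto).comp h1).mul_const _

lemma wrightM_zero (β : ℝ) : wrightM β 0 = (Real.Gamma (1 - β))⁻¹ := by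
  rw [wrightM, wright, tsum_eq_single 0]
  · simp
  · intro n hn
    simp [hn]

lemma operationalDensity_zero (β t : ℝ) :
    operationalDensity β 0 t = t ^ (-β) * (Real.Gamma (1 - β))⁻¹ := by
  rw [operationalDensity, zero_div, wrightM_zero]

lemma operationalDensity_nonneg {β : ℝ} (hβ : 0 < β) (hβ1 : β < 1) {τ : ℝ} (hτ : 0 ≤ τ)
    {t : ℝ} (ht : 0 < t) : 0 ≤ operationalDensity β τ t := by
  rcases hτ.eq_or_lt with rfl | hτ
  · rw [operationalDensity_zero]
    have := Real.Gamma_pos_of_pos (sub_pos.2 hβ1)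
    positivity
  · have h := (fourierNonneg_laplaceKernel hβ hβ1 hτ).fourierPlusInv_re_nonneg (-t)
    rwa [← operationalDensity_eq_fourier hβ hβ1 hτ ht, Complex.ofReal_re] at h

lemma differentiableAt_laplaceKernel (β τ : ℝ) {s : ℂ} (hs : 0 < s.re) :
    DifferentiableAt ℂ (laplaceKernel β τ) s := by
  have h : s ∈ Complex.slitPlane := Or.inl hs
  have h1 : ∀ b : ℂ, DifferentiableAt ℂ (fun z : ℂ => z ^ b) s := fun b =>
    DifferentiableAt.cpow_const differentiableAt_id h
  unfold laplaceKernel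
  exact (h1 _).mul (((h1 _).const_mul _).neg.cexp)

/-! ### Contour shift and the Laplace transform of `q_β` in time -/

/-- The inverse Laplace integral along the line `re s = σ`. -/
def bromwich (β τ t σ : ℝ) : ℂ :=
  ∫ κ : ℝ, laplaceKernel β τ (σ + Complex.I * κ) * Complex.exp ((σ + Complex.I * κ) * t)

lemma norm_exp_line (σ κ t : ℝ) : ‖Complex.exp ((σ + Complex.I * κ) * t)‖ = Real.exp (σ * t) := by
  rw [Complex.norm_exp]; simp

lemma norm_laplaceKernel_line {β : ℝ} (hβ : 0 < β) (hβ1 : β < 1) {τ : ℝ} (hτ : 0 ≤ τ) {σ κ : ℝ}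
    (hσ : 0 ≤ σ) (hκ : κ ≠ 0) : ‖laplaceKernel β τ (σ + Complex.I * κ)‖ ≤
      |κ| ^ (β - 1) * Real.exp (-(τ * Real.cos (β * (Real.pi / 2))) * |κ| ^ β) := by
  simpa using norm_laplaceKernel_le hβ hβ1 hτ (s := σ + Complex.I * κ) (by simpa using hσ)
    (by simpa using hκ)

lemma integrable_bromwich {β : ℝ} (hβ : 0 < β) (hβ1 : β < 1) {τ : ℝ} (hτ : 0 < τ) (t : ℝ) {σ : ℝ}
    (hσ : 0 ≤ σ) : Integrable fun κ : ℝ =>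
      laplaceKernel β τ (σ + Complex.I * κ) * Complex.exp ((σ + Complex.I * κ) * t) :=
  (integrable_laplaceKernel hβ hβ1 hτ hσ).mul_bdd (c := Real.exp (σ * t))
    (Continuous.aestronglyMeasurable (by fun_prop))
    (Eventually.of_forall fun κ => (norm_exp_line σ κ t).le)

/-- Cauchy's theorem on the rectangle with vertical sides at `σ` and `σ'`: the integrand decays on
the horizontal sides at height `±T` as `T → ∞`. -/
lemma bromwich_eq_of_pos {β : ℝ} (hβ : 0 < β) (hβ1 : β < 1) {τ : ℝ} (hτ : 0 < τ) (t : ℝ)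
    {σ σ' : ℝ} (hσ : 0 < σ) (hσ' : σ ≤ σ') : bromwich β τ t σ' = bromwich β τ t σ := by
  set f : ℂ → ℂ := fun s => laplaceKernel β τ s * Complex.exp (s * t) with hf
  set c := τ * Real.cos (β * (Real.pi / 2)) with hc
  have hc0 : 0 < c := mul_pos hτ (cos_mul_pi_div_two_pos hβ hβ1)
  have hrect : ∀ T : ℝ, (((∫ x : ℝ in σ..σ', f (x + ((-T : ℝ) : ℂ) * Complex.I)) -
      ∫ x : ℝ in σ..σ', f (x + (T : ℂ) * Complex.I)) +
      Complex.I • ∫ y : ℝ in (-T)..T, f (σ' + y * Complex.I)) -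
      Complex.I • ∫ y : ℝ in (-T)..T, f (σ + y * Complex.I) = 0 := by
    intro T
    have h := Complex.integral_boundary_rect_eq_zero_of_differentiableOn f
      (⟨σ, -T⟩ : ℂ) (⟨σ', T⟩ : ℂ) (fun s hs => ?_)
    · exact h
    · have hre : 0 < s.re := by
        have := hs.1
        simp only [uIcc_of_le hσ', mem_preimage, mem_Icc] at this
        linarith [this.1]
      refine DifferentiableAt.differentiableWithinAt ?_
      exact (differentiableAt_laplaceKernel β τ hre).mul (by fun_prop)
  have hline : ∀ u : ℝ, 0 < u → Tendsto (fun T : ℝ => ∫ y : ℝ in (-T)..T, f (u + y * Complex.I)) atTop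
      (𝓝 (bromwich β τ t u)) := by
    intro u hu
    have h1 := intervalIntegral_tendsto_integral (integrable_bromwich hβ hβ1 hτ t hu.le)
      tendsto_neg_atTop_atBot tendsto_id
    simp only [id] at h1
    refine h1.congr fun T => ?_
    refine intervalIntegral.integral_congr fun y _ => ?_
    simp only [hf]
    rw [mul_comm Complex.I]
  have hbd : Tendsto (fun T : ℝ => T ^ (β - 1) * Real.exp (-c * T ^ β)) atTop (𝓝 0) := by
    have h1 : Tendsto (fun T : ℝ => T ^ (β - 1)) atTop (𝓝 0) := by
      have := tendsto_rpow_neg_atTop (sub_pos.2 hβ1)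
      simpa using this
    have h2 : Tendsto (fun T : ℝ => Real.exp (-c * T ^ β)) atTop (𝓝 0) :=
      Real.tendsto_exp_atBot.comp ((tendsto_rpow_atTop hβ).const_mul_atTop_of_neg (by linarith))
    simpa using h1.mul h2
  have hhor : ∀ ε : ℝ, |ε| = 1 → Tendsto (fun T : ℝ => ∫ x : ℝ in σ..σ', f (x + ((ε * T : ℝ) : ℂ) * Complex.I)) atTop
      (𝓝 0) := by
    intro ε hε
    have h1 : Tendsto (fun T : ℝ => T ^ (β - 1) * Real.exp (-c * T ^ β) * Real.exp (σ' * |t|) * |σ' - σ|)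
        atTop (𝓝 0) := by
      simpa using (hbd.mul_const (Real.exp (σ' * |t|))).mul_const |σ' - σ|
    refine squeeze_zero_norm' ?_ h1
    filter_upwards [eventually_gt_atTop 0] with T hT
    refine intervalIntegral.norm_integral_le_of_norm_le_const fun x hx => ?_
    rw [uIoc_of_le hσ'] at hx
    have hx0 : 0 < x := hσ.trans hx.1
    have hεT : |ε * T| = T := by rw [abs_mul, hε, one_mul, abs_of_pos hT]
    have hεT0 : ε * T ≠ 0 := by
      intro h; rw [h, abs_zero] at hεT; linarith
    have h2 := norm_laplaceKernel_line hβ hβ1 hτ.le hx0.le hεT0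
    rw [hεT] at h2
    simp only [hf]
    rw [norm_mul, mul_comm _ Complex.I, norm_exp_line]
    refine mul_le_mul h2 (Real.exp_le_exp.2 ?_) (Real.exp_pos _).le (by positivity)
    calc x * t ≤ x * |t| := by gcongr; exact le_abs_self t
      _ ≤ σ' * |t| := by gcongr; exact hx.2
  have h1 := hhor (-1) (by simp)
  have h2 := hhor 1 (by simp)
  simp only [neg_mul, one_mul] at h1 h2
  have h3 := ((h1.sub h2).add ((hline σ' (hσ.trans_le hσ')).const_smul Complex.I)).sub
    ((hline σ hσ).const_smul Complex.I)
  have h4 := tendsto_nhds_unique (tendsto_const_nhds.congr fun T => (hrect T).symm) h3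
  rw [sub_zero, zero_add, smul_eq_mul, smul_eq_mul, ← mul_sub] at h4
  exact sub_eq_zero.1 ((mul_eq_zero.1 h4.symm).resolve_left Complex.I_ne_zero)

/-- The imaginary axis passes through the branch point `0`, so it is reached by dominated
convergence from the right rather than by Cauchy's theorem. -/
lemma bromwich_eq {β : ℝ} (hβ : 0 < β) (hβ1 : β < 1) {τ : ℝ} (hτ : 0 < τ) (t : ℝ)
    {σ : ℝ} (hσ : 0 < σ) : bromwich β τ t σ = bromwich β τ t 0 := by
  have hc := cos_mul_pi_div_two_pos hβ hβ1
  have hlim : Tendsto (fun u : ℝ => bromwich β τ t u) (𝓝[>] 0) (𝓝 (bromwich β τ t 0)) := by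
    refine tendsto_integral_filter_of_dominated_convergence
      (fun κ => (|κ| ^ (β - 1) * Real.exp (-(τ * Real.cos (β * (Real.pi / 2))) * |κ| ^ β)) *
        Real.exp |t|) ?_ ?_ ((integrable_laplaceBound hβ (mul_pos hτ hc)).mul_const _) ?_
    · filter_upwards [self_mem_nhdsWithin] with u hu
      exact (integrable_bromwich hβ hβ1 hτ t (le_of_lt hu)).1
    · filter_upwards [Ioo_mem_nhdsGT (zero_lt_one' ℝ)] with u hu
      filter_upwards [Measure.ae_ne volume (0 : ℝ)] with κ hκ
      rw [norm_mul, norm_exp_line]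
      refine mul_le_mul (norm_laplaceKernel_line hβ hβ1 hτ.le hu.1.le hκ) (Real.exp_le_exp.2 ?_)
        (Real.exp_pos _).le (by positivity)
      calc u * t ≤ u * |t| := mul_le_mul_of_nonneg_left (le_abs_self t) hu.1.le
        _ ≤ 1 * |t| := by gcongr; exact hu.2.le
        _ = |t| := one_mul _
    · filter_upwards [Measure.ae_ne volume (0 : ℝ)] with κ hκ
      have h1 : Tendsto (fun u : ℝ => (u + Complex.I * κ : ℂ)) (𝓝[>] 0)
          (𝓝 (((0 : ℝ) : ℂ) + Complex.I * κ)) := by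
        have : Continuous fun u : ℝ => (u + Complex.I * κ : ℂ) := by fun_prop
        exact (this.tendsto 0).mono_left nhdsWithin_le_nhds
      have hs : (((0 : ℝ) : ℂ) + Complex.I * κ) ∈ Complex.slitPlane := by
        right; simpa using hκ
      have h2 : ∀ b : ℂ, ContinuousAt (fun z : ℂ => z ^ b) (((0 : ℝ) : ℂ) + Complex.I * κ) :=
        fun b => continuousAt_cpow_const hs
      have h3 : ContinuousAt (laplaceKernel β τ) (((0 : ℝ) : ℂ) + Complex.I * κ) :=
        (h2 _).mul (Complex.continuous_exp.continuousAt.comp ((h2 _).const_mul _).neg)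
      exact (h3.tendsto.comp h1).mul ((Complex.continuous_exp.tendsto _).comp (h1.mul_const _))
  refine tendsto_nhds_unique (tendsto_const_nhds.congr' ?_) hlim
  filter_upwards [Ioo_mem_nhdsGT hσ] with u hu
  exact bromwich_eq_of_pos hβ hβ1 hτ t hu.1 hu.2.le

/-- The integral does not depend on the abscissa `u` and is at most `D e^{ut}`, which tends to `0`
as `u → ∞` for `t < 0`. -/
lemma bromwich_of_neg {β : ℝ} (hβ : 0 < β) (hβ1 : β < 1) {τ : ℝ} (hτ : 0 < τ) {t : ℝ}
    (ht : t < 0) {σ : ℝ} (hσ : 0 ≤ σ) : bromwich β τ t σ = 0 := by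
  have hc := cos_mul_pi_div_two_pos hβ hβ1
  set D := ∫ κ : ℝ, |κ| ^ (β - 1) * Real.exp (-(τ * Real.cos (β * (Real.pi / 2))) * |κ| ^ β) with hD
  have hb : ∀ u : ℝ, 0 < u → ‖bromwich β τ t σ‖ ≤ D * Real.exp (u * t) := by
    intro u hu
    have h0 : bromwich β τ t σ = bromwich β τ t u := by
      rw [bromwich_eq hβ hβ1 hτ t hu]
      rcases hσ.eq_or_lt with rfl | h
      · rfl
      · exact bromwich_eq hβ hβ1 hτ t h
    rw [h0, hD, ← integral_mul_const]
    refine norm_integral_le_of_norm_le ((integrable_laplaceBound hβ (mul_pos hτ hc)).mul_const _) ?_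
    filter_upwards [Measure.ae_ne volume (0 : ℝ)] with κ hκ
    rw [norm_mul, norm_exp_line]
    exact mul_le_mul_of_nonneg_right (norm_laplaceKernel_line hβ hβ1 hτ.le hu.le hκ) (Real.exp_pos _).le
  have hlim : Tendsto (fun u : ℝ => D * Real.exp (u * t)) atTop (𝓝 0) := by
    have := (Real.tendsto_exp_atBot.comp (tendsto_id.atTop_mul_const_of_neg ht)).const_mul D
    simpa [Function.comp_def] using this
  have := ge_of_tendsto hlim ((eventually_gt_atTop 0).mono hb)
  exact norm_le_zero_iff.1 this

lemma fourierPlusInv_laplaceKernel_line {β : ℝ} (τ t σ : ℝ) :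
    fourierPlusInv (fun κ => laplaceKernel β τ (σ + Complex.I * κ)) (-t) =
      (2 * (Real.pi : ℂ))⁻¹ * ((Real.exp (-(σ * t)) : ℝ) : ℂ) * bromwich β τ t σ := by
  rw [fourierPlusInv, bromwich, mul_assoc,
    ← integral_const_mul ((Real.exp (-(σ * t)) : ℝ) : ℂ)]
  refine congrArg _ (integral_congr_ae (Eventually.of_forall fun κ => ?_))
  simp only
  rw [Complex.ofReal_exp, mul_left_comm, ← Complex.exp_add, mul_comm]
  congr 2
  push_cast; ring

lemma fourierPlusInv_laplaceKernel_line_of_pos {β : ℝ} (hβ : 0 < β) (hβ1 : β < 1) {τ : ℝ} (hτ : 0 < τ)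
    {t : ℝ} (ht : 0 < t) {σ : ℝ} (hσ : 0 < σ) :
    fourierPlusInv (fun κ => laplaceKernel β τ (σ + Complex.I * κ)) (-t) =
      ((Real.exp (-(σ * t)) : ℝ) : ℂ) * operationalDensity β τ t := by
  have h := fourierPlusInv_laplaceKernel_line (β := β) τ t 0
  simp only [Complex.ofReal_zero, zero_add] at h
  rw [operationalDensity_eq_fourier hβ hβ1 hτ ht, h, fourierPlusInv_laplaceKernel_line,
    bromwich_eq hβ hβ1 hτ t hσ]
  simp
  ring

lemma fourierPlusInv_laplaceKernel_line_of_neg {β : ℝ} (hβ : 0 < β) (hβ1 : β < 1) {τ : ℝ} (hτ : 0 < τ)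
    {t : ℝ} (ht : t < 0) {σ : ℝ} (hσ : 0 < σ) :
    fourierPlusInv (fun κ => laplaceKernel β τ (σ + Complex.I * κ)) (-t) = 0 := by
  rw [fourierPlusInv_laplaceKernel_line, bromwich_of_neg hβ hβ1 hτ ht hσ.le, mul_zero]

lemma measurable_operationalDensity {β : ℝ} (hβ : 0 < β) (hβ1 : β < 1) :
    Measurable fun p : ℝ × ℝ => operationalDensity β p.1 p.2 := by
  unfold operationalDensity
  have := (continuous_wrightM hβ hβ1).measurable
  fun_prop

lemma integrableOn_exp_mul_operationalDensity {β : ℝ} (hβ : 0 < β) (hβ1 : β < 1) {τ : ℝ}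
    (hτ : 0 ≤ τ) {s : ℂ} (hs : 0 < s.re) :
    IntegrableOn (fun t : ℝ => Complex.exp (-(s * (t : ℂ))) * (operationalDensity β τ t : ℂ)) (Ioi 0) := by
  have hmeas : AEStronglyMeasurable (fun t : ℝ => Complex.exp (-(s * (t : ℂ))) *
      (operationalDensity β τ t : ℂ)) (volume.restrict (Ioi 0)) := by
    have h : Measurable fun t : ℝ => operationalDensity β τ t :=
      (measurable_operationalDensity hβ hβ1).comp (measurable_const.prodMk measurable_id)
    exact Measurable.aestronglyMeasurable (by fun_prop)
  rcases hτ.eq_or_lt with rfl | hτ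
  · have h1 := (integrableOn_rpow_mul_exp_neg (sub_pos.2 hβ1) hs).mul_const ((Real.Gamma (1 - β))⁻¹)
    refine Integrable.mono' h1 hmeas ?_
    filter_upwards [self_mem_ae_restrict measurableSet_Ioi] with t ht
    have ht' : (0 : ℝ) < t := ht
    have hG := Real.Gamma_pos_of_pos (sub_pos.2 hβ1)
    rw [norm_mul, norm_cexp_neg_mul, Complex.norm_real, Real.norm_of_nonneg
      (operationalDensity_nonneg hβ hβ1 le_rfl ht), operationalDensity_zero]
    have e : 1 - β - 1 = -β := by ring
    rw [e]
    exact le_of_eq (by ring)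
  · set D := (2 * Real.pi)⁻¹ * ∫ κ : ℝ, ‖laplaceKernel β τ (Complex.I * κ)‖
    have h1 : IntegrableOn (fun t : ℝ => Real.exp (-(s.re * t)) * D) (Ioi 0) := by
      have := (integrableOn_rpow_mul_exp_neg one_pos hs).mul_const D
      simpa [IntegrableOn] using this
    refine Integrable.mono' h1 hmeas ?_
    filter_upwards [self_mem_ae_restrict measurableSet_Ioi] with t ht
    rw [norm_mul, norm_cexp_neg_mul, operationalDensity_eq_fourier hβ hβ1 hτ ht]
    exact mul_le_mul_of_nonneg_left (norm_fourierPlusInv_le _ _) (Real.exp_pos _).le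

/-- The Laplace transform of the kernel in time. -/
lemma laplace_operationalDensity {β : ℝ} (hβ : 0 < β) (hβ1 : β < 1) {τ : ℝ}
    (hτ : 0 ≤ τ) {s : ℂ} (hs : 0 < s.re) :
    ∫ t in Ioi (0 : ℝ), Complex.exp (-(s * (t : ℂ))) * (operationalDensity β τ t : ℂ) =
      laplaceKernel β τ s := by
  rcases hτ.eq_or_lt with rfl | hτ
  -- At `τ = 0` the kernel `s^{β-1}` is not integrable on vertical lines, but `q_β(0, t)` is an
  -- explicit power of `t`.
  · have h1 := integral_rpow_mul_cexp_neg (sub_pos.2 hβ1) hs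
    have hG : (Real.Gamma (1 - β) : ℂ) ≠ 0 := by
      exact_mod_cast (Real.Gamma_pos_of_pos (sub_pos.2 hβ1)).ne'
    have h2 : ∀ t : ℝ, Complex.exp (-(s * (t : ℂ))) * (operationalDensity β 0 t : ℂ) =
        (Real.Gamma (1 - β) : ℂ)⁻¹ * (((t ^ (1 - β - 1) : ℝ) : ℂ) * Complex.exp (-(s * t))) := by
      intro t
      rw [operationalDensity_zero, show 1 - β - 1 = -β by ring]
      push_cast; ring
    simp_rw [h2]
    rw [integral_const_mul, h1, inv_mul_cancel_left₀ hG, laplaceKernel]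
    push_cast
    simp
  · set σ := s.re
    set κ := s.im
    have hsκ : s = (σ : ℂ) + Complex.I * κ := by
      rw [mul_comm]; exact (Complex.re_add_im s).symm
    -- Fourier inversion along the line `re s = σ`: the inverse transform of `g` is `e^{-σt} q_β(τ,
    -- t)` for `t > 0` and `0` for `t < 0`, hence integrable. Transforming back returns the kernel.
    set g : ℝ → ℂ := fun κ => laplaceKernel β τ (σ + Complex.I * κ) with hg
    have hgi : Integrable g := integrable_laplaceKernel hβ hβ1 hτ hs.le
    have hgc : ContinuousAt g κ := by
      have h1 : ContinuousAt (laplaceKernel β τ) (σ + Complex.I * κ) :=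
        (differentiableAt_laplaceKernel β τ (by simpa using hs)).continuousAt
      have h2 : ContinuousAt (fun κ : ℝ => (σ + Complex.I * κ : ℂ)) κ := by fun_prop
      exact ContinuousAt.comp (g := laplaceKernel β τ) h1 h2
    have hq : ∀ t : ℝ, 0 < t → fourierPlusInv g (-t) =
        ((Real.exp (-(σ * t)) : ℝ) : ℂ) * operationalDensity β τ t :=
      fun t ht => fourierPlusInv_laplaceKernel_line_of_pos hβ hβ1 hτ ht hs
    have hz : ∀ t : ℝ, t < 0 → fourierPlusInv g (-t) = 0 :=
      fun t ht => fourierPlusInv_laplaceKernel_line_of_neg hβ hβ1 hτ ht hs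
    have hint : Integrable fun t : ℝ => fourierPlusInv g (-t) := by
      rw [← integrableOn_univ, ← Iic_union_Ioi (a := (0 : ℝ))]
      refine IntegrableOn.union ?_ ?_
      · refine (integrableOn_Iic_iff_integrableOn_Iio (by simp)).2 ?_
        exact IntegrableOn.congr_fun integrableOn_zero (fun t ht => (hz t ht).symm) measurableSet_Iio
      · refine IntegrableOn.congr_fun (integrableOn_exp_mul_operationalDensity hβ hβ1 hτ.le
          (s := (σ : ℂ)) (by simpa using hs)) (fun t ht => ?_) measurableSet_Ioi
        rw [hq t ht]
        push_cast; rfl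
    have hint' : Integrable (fourierPlusInv g) := by
      have := hint.comp_neg
      simpa using this
    have h1 := fourierPlus_fourierPlusInv hgi hint' hgc
    have h2 : g κ = laplaceKernel β τ s := by rw [hg, hsκ]
    have hfi : Integrable fun t : ℝ => Complex.exp (Complex.I * κ * ((-t : ℝ) : ℂ)) * fourierPlusInv g (-t) :=
      (integrable_exp_mul_fourierPlus hint' κ).comp_neg
    rw [← h2, ← h1, fourierPlus, ← integral_neg_eq_self
      (fun x : ℝ => Complex.exp (Complex.I * κ * x) * fourierPlusInv g x), ← intervalIntegral.integral_Iic_add_Ioi (b := 0)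
      hfi.integrableOn hfi.integrableOn]
    have h3 : ∫ t in Iic (0 : ℝ), Complex.exp (Complex.I * κ * ((-t : ℝ) : ℂ)) * fourierPlusInv g (-t) = 0 := by
      rw [integral_Iic_eq_integral_Iio]
      refine setIntegral_eq_zero_of_forall_eq_zero fun t ht => ?_
      rw [hz t ht, mul_zero]
    rw [h3, zero_add]
    refine setIntegral_congr_fun measurableSet_Ioi fun t ht => ?_
    rw [hq t ht, ← mul_assoc, Complex.ofReal_exp, ← Complex.exp_add]
    congr 2
    rw [hsκ]
    push_cast; ring

lemma laplaceKernel_ofReal (β τ : ℝ) {σ : ℝ} (hσ : 0 < σ) :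
    laplaceKernel β τ σ = ((σ ^ (β - 1) * Real.exp (-(τ * σ ^ β)) : ℝ) : ℂ) := by
  have e : (β : ℂ) - 1 = ((β - 1 : ℝ) : ℂ) := by push_cast; rfl
  rw [laplaceKernel, e, ← Complex.ofReal_cpow hσ.le, ← Complex.ofReal_cpow hσ.le]
  push_cast; rfl

lemma integral_exp_mul_operationalDensity {β : ℝ} (hβ : 0 < β) (hβ1 : β < 1) {τ : ℝ}
    (hτ : 0 ≤ τ) {σ : ℝ} (hσ : 0 < σ) :
    ∫ t in Ioi (0 : ℝ), Real.exp (-(σ * t)) * operationalDensity β τ t =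
      σ ^ (β - 1) * Real.exp (-(τ * σ ^ β)) := by
  have h := laplace_operationalDensity hβ hβ1 hτ (s := (σ : ℂ)) (by simpa using hσ)
  rw [laplaceKernel_ofReal β τ hσ] at h
  have h2 : ∀ t : ℝ, Complex.exp (-((σ : ℂ) * t)) * (operationalDensity β τ t : ℂ) =
      ((Real.exp (-(σ * t)) * operationalDensity β τ t : ℝ) : ℂ) := by intro t; push_cast; rfl
  simp_rw [h2] at h
  rw [integral_complex_ofReal] at h
  exact_mod_cast h

/-! ### Fubini in time and operational time; mass and moments of the M-Wright function -/

/-- Integrating in `t` first is explicit because `q_β ≥ 0`: the norm integrates to a Laplace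
transform at `re s`, and the hypothesis on `ω` remains. -/
lemma integrable_prod_laplace {β : ℝ} (hβ : 0 < β) (hβ1 : β < 1) {ω : ℝ → ℂ} (hω : Measurable ω)
    {s : ℂ} (hs : 0 < s.re)
    (h : IntegrableOn (fun τ => ‖ω τ‖ * Real.exp (-(τ * s.re ^ β))) (Ioi 0)) :
    Integrable (fun p : ℝ × ℝ => Complex.exp (-(s * p.1)) * (ω p.2 * operationalDensity β p.2 p.1))
      ((volume.restrict (Ioi 0)).prod (volume.restrict (Ioi 0))) := by
  have hq : Measurable fun p : ℝ × ℝ => operationalDensity β p.2 p.1 :=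
    (measurable_operationalDensity hβ hβ1).comp measurable_swap
  have hmeas : Measurable fun p : ℝ × ℝ =>
      Complex.exp (-(s * p.1)) * (ω p.2 * operationalDensity β p.2 p.1) := by fun_prop
  rw [integrable_prod_iff' hmeas.aestronglyMeasurable]
  constructor
  · filter_upwards [self_mem_ae_restrict measurableSet_Ioi] with τ hτ
    have h1 := (integrableOn_exp_mul_operationalDensity hβ hβ1 (le_of_lt hτ) hs).const_mul (ω τ)
    refine h1.congr (Eventually.of_forall fun t => ?_)
    simp only; ring
  · refine (h.const_mul (s.re ^ (β - 1))).congr ?_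
    filter_upwards [self_mem_ae_restrict measurableSet_Ioi] with τ hτ
    have h1 : ∫ t in Ioi (0 : ℝ), ‖Complex.exp (-(s * (t : ℝ))) * (ω τ * operationalDensity β τ t)‖ =
        ∫ t in Ioi (0 : ℝ), ‖ω τ‖ * (Real.exp (-(s.re * t)) * operationalDensity β τ t) := by
      refine setIntegral_congr_fun measurableSet_Ioi fun t ht => ?_
      rw [norm_mul, norm_mul, norm_cexp_neg_mul, Complex.norm_real,
        Real.norm_of_nonneg (operationalDensity_nonneg hβ hβ1 (le_of_lt hτ) ht)]
      ring
    rw [h1, integral_const_mul, integral_exp_mul_operationalDensity hβ hβ1 (le_of_lt hτ) hs]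
    ring

lemma integrableOn_laplace_weighted {β : ℝ} (hβ : 0 < β) (hβ1 : β < 1) {ω : ℝ → ℂ}
    (hω : Measurable ω) {s : ℂ} (hs : 0 < s.re)
    (h : IntegrableOn (fun τ => ‖ω τ‖ * Real.exp (-(τ * s.re ^ β))) (Ioi 0)) :
    IntegrableOn (fun t : ℝ => Complex.exp (-(s * t)) *
      ∫ τ in Ioi (0 : ℝ), ω τ * operationalDensity β τ t) (Ioi 0) := by
  have := (integrable_prod_laplace hβ hβ1 hω hs h).integral_prod_left
  simpa [integral_const_mul, IntegrableOn] using this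

lemma integral_laplace_weighted {β : ℝ} (hβ : 0 < β) (hβ1 : β < 1) {ω : ℝ → ℂ}
    (hω : Measurable ω) {s : ℂ} (hs : 0 < s.re)
    (h : IntegrableOn (fun τ => ‖ω τ‖ * Real.exp (-(τ * s.re ^ β))) (Ioi 0)) :
    ∫ t in Ioi (0 : ℝ), Complex.exp (-(s * t)) *
      ∫ τ in Ioi (0 : ℝ), ω τ * operationalDensity β τ t =
      ∫ τ in Ioi (0 : ℝ), ω τ * laplaceKernel β τ s := by
  have h1 := integral_integral_swap (f := fun (t τ : ℝ) =>
    Complex.exp (-(s * t)) * (ω τ * operationalDensity β τ t)) (integrable_prod_laplace hβ hβ1 hω hs h)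
  simp_rw [integral_const_mul] at h1
  rw [h1]
  refine setIntegral_congr_fun measurableSet_Ioi fun τ hτ => ?_
  rw [← laplace_operationalDensity hβ hβ1 (le_of_lt hτ) hs, ← integral_const_mul]
  congr 1; ext t; ring

lemma integral_operationalDensity_smul {E : Type*} [NormedAddCommGroup E] [NormedSpace ℝ E] {β : ℝ}
    {t : ℝ} (ht : 0 < t) (f : ℝ → E) :
    ∫ τ in Ioi (0 : ℝ), operationalDensity β τ t • f τ =
      ∫ z in Ioi (0 : ℝ), wrightM β z • f (t ^ β * z) := by
  have hp : 0 < t ^ β := by positivity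
  have h := integral_comp_mul_left_Ioi (fun τ => operationalDensity β τ t • f τ) 0 hp
  rw [mul_zero] at h
  rw [← smul_inv_smul₀ (inv_pos.2 hp).ne' (∫ τ in Ioi (0 : ℝ), operationalDensity β τ t • f τ),
    inv_inv, smul_comm, ← h, ← integral_smul]
  congr 1; ext z
  rw [operationalDensity, mul_div_cancel_left₀ _ hp.ne', smul_smul, Real.rpow_neg ht.le,
    mul_inv_cancel_left₀ hp.ne']

lemma integrableOn_operationalDensity_smul_iff {E : Type*} [NormedAddCommGroup E] [NormedSpace ℝ E]
    {β : ℝ} {t : ℝ} (ht : 0 < t) (f : ℝ → E) :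
    IntegrableOn (fun τ => operationalDensity β τ t • f τ) (Ioi 0) ↔
      IntegrableOn (fun z => wrightM β z • f (t ^ β * z)) (Ioi 0) := by
  have hp : 0 < t ^ β := by positivity
  have h := integrableOn_Ioi_comp_mul_left_iff (fun τ => operationalDensity β τ t • f τ) 0 hp
  rw [mul_zero] at h
  rw [← h, IntegrableOn, IntegrableOn, ← integrable_smul_iff (c := t ^ β) hp.ne']
  refine iff_of_eq (congrArg (fun F => Integrable F _) (funext fun z => ?_))
  rw [Pi.smul_apply, operationalDensity, mul_div_cancel_left₀ _ hp.ne', smul_smul, Real.rpow_neg ht.le,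
    mul_inv_cancel_left₀ hp.ne']

/-- Fubini with weight `τ^k` gives integrability of `τ^k q_β(τ, t)` for almost every `t > 0`. One
such `t` is enough, since self-similarity transfers the result to the M-Wright function. -/
lemma integrableOn_rpow_mul_wrightM {β : ℝ} (hβ : 0 < β) (hβ1 : β < 1) {k : ℝ} (hk : 0 ≤ k) :
    IntegrableOn (fun z => z ^ k * wrightM β z) (Ioi 0) := by
  have hω : Measurable fun τ : ℝ => ((τ ^ k : ℝ) : ℂ) := by fun_prop
  have h0 : IntegrableOn (fun τ : ℝ => ‖((τ ^ k : ℝ) : ℂ)‖ * Real.exp (-(τ * (1 : ℂ).re ^ β))) (Ioi 0) := by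
    refine IntegrableOn.congr_fun (integrableOn_rpow_mul_exp_neg (a := k + 1) (by linarith) one_pos)
      (fun τ hτ => ?_) measurableSet_Ioi
    have hτ' : (0 : ℝ) < τ := hτ
    rw [Complex.norm_real, Real.norm_of_nonneg (by positivity), Complex.one_re, Real.one_rpow]
    simp
  have h1 := ((integrable_prod_laplace hβ hβ1 hω (s := 1) (by simp) h0).prod_right_ae).and
    (self_mem_ae_restrict (μ := volume) (measurableSet_Ioi (a := (0 : ℝ))))
  have : (ae (volume.restrict (Ioi (0 : ℝ)))).NeBot := by
    rw [ae_neBot]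
    intro h
    have := congrArg (fun m => m univ) h
    simp at this
  obtain ⟨t, ht, ht0⟩ := h1.exists
  have ht0' : (0 : ℝ) < t := ht0
  have h2 : IntegrableOn (fun τ => operationalDensity β τ t • ((τ ^ k : ℝ) : ℂ)) (Ioi 0) := by
    have h3 := ht.const_mul (Complex.exp t)
    refine h3.congr (Eventually.of_forall fun τ => ?_)
    simp only
    rw [← mul_assoc, ← Complex.exp_add, Complex.real_smul]
    simp
    ring
  rw [integrableOn_operationalDensity_smul_iff ht0'] at h2
  have h3 := h2.re.const_mul ((t ^ β) ^ k)⁻¹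
  refine IntegrableOn.congr_fun h3 (fun z hz => ?_) measurableSet_Ioi
  have hz' : (0 : ℝ) < z := hz
  have hp : 0 < (t ^ β) ^ k := by positivity
  rw [Complex.real_smul, ← Complex.ofReal_mul]
  change _ * (((wrightM β z * (t ^ β * z) ^ k : ℝ) : ℂ)).re = _
  rw [Complex.ofReal_re, Real.mul_rpow (by positivity) hz'.le]
  field_simp

lemma integrableOn_wrightM {β : ℝ} (hβ : 0 < β) (hβ1 : β < 1) : IntegrableOn (wrightM β) (Ioi 0) := by
  simpa using integrableOn_rpow_mul_wrightM hβ hβ1 le_rfl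

/-- By self-similarity the mass of `q_β(·, t)` is a constant `c`. Its Laplace transform at `s = 1`
is `c`, and by Fubini it is also `∫ e^{-τ} dτ = 1`. -/
lemma integral_wrightM {β : ℝ} (hβ : 0 < β) (hβ1 : β < 1) : ∫ z in Ioi (0 : ℝ), wrightM β z = 1 := by
  have he : IntegrableOn (fun τ : ℝ => Real.exp (-(τ * (1 : ℂ).re ^ β))) (Ioi 0) := by
    have := integrableOn_rpow_mul_exp_neg (a := 1) one_pos one_pos
    simpa using this
  have h0 : IntegrableOn (fun τ : ℝ => ‖(1 : ℂ)‖ * Real.exp (-(τ * (1 : ℂ).re ^ β))) (Ioi 0) := by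
    simpa using he
  have h := integral_laplace_weighted hβ hβ1 (ω := fun _ => 1) measurable_const (s := 1) (by simp) h0
  set c : ℂ := ((∫ z in Ioi (0 : ℝ), wrightM β z : ℝ) : ℂ) with hc
  have h1 : ∀ t ∈ Ioi (0 : ℝ), Complex.exp (-(1 * (t : ℝ))) *
      ∫ τ in Ioi (0 : ℝ), (1 : ℂ) * operationalDensity β τ t = c * Complex.exp (-(1 * (t : ℝ))) := by
    intro t ht
    have h2 := integral_operationalDensity_smul (β := β) ht (fun _ => (1 : ℂ))
    simp only [Complex.real_smul, mul_one] at h2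
    simp only [one_mul]
    rw [h2, hc, integral_complex_ofReal]
    ring
  rw [setIntegral_congr_fun measurableSet_Ioi h1, integral_const_mul] at h
  have h3 := integral_rpow_mul_cexp_neg (a := 1) one_pos (w := 1) (by simp)
  simp only [sub_self, Real.rpow_zero, Complex.ofReal_one, one_mul, Real.Gamma_one, Complex.one_cpow] at h3
  simp only [one_mul] at h
  rw [h3, mul_one] at h
  have h4 : ∀ τ : ℝ, laplaceKernel β τ 1 = Complex.exp (-τ) := by intro τ; simp [laplaceKernel]
  simp_rw [h4] at h
  rw [h3] at h
  rw [hc] at h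
  exact_mod_cast h

lemma integrableOn_operationalDensity {β : ℝ} (hβ : 0 < β) (hβ1 : β < 1) {t : ℝ} (ht : 0 < t) :
    IntegrableOn (fun τ => operationalDensity β τ t) (Ioi 0) := by
  have := (integrableOn_operationalDensity_smul_iff (β := β) ht (fun _ => (1 : ℝ)))
  simp only [smul_eq_mul, mul_one] at this
  exact this.2 (integrableOn_wrightM hβ hβ1)

lemma integral_operationalDensity {β : ℝ} (hβ : 0 < β) (hβ1 : β < 1) {t : ℝ} (ht : 0 < t) :
    ∫ τ in Ioi (0 : ℝ), operationalDensity β τ t = 1 := by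
  have := (integral_operationalDensity_smul (β := β) ht (fun _ => (1 : ℝ)))
  simp only [smul_eq_mul, mul_one] at this
  rw [this, integral_wrightM hβ hβ1]

/-! ### The operational law, with the Dirac case `β = 1` included -/

lemma integral_operationalLaw {E : Type*} [NormedAddCommGroup E] [NormedSpace ℝ E]
    {β : ℝ} (hβ : 0 < β) (hβ1 : β < 1) {t : ℝ} (ht : 0 < t) (f : ℝ → E) :
    ∫ τ, f τ ∂(operationalLaw β t) = ∫ τ in Ioi (0 : ℝ), operationalDensity β τ t • f τ := by
  have hq : Measurable fun τ : ℝ => operationalDensity β τ t :=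
    (measurable_operationalDensity hβ hβ1).comp (measurable_id.prodMk measurable_const)
  rw [operationalLaw, if_neg hβ1.ne,
    integral_withDensity_eq_integral_toReal_smul (by fun_prop) (by simp)]
  refine setIntegral_congr_fun measurableSet_Ioi fun τ hτ => ?_
  rw [ENNReal.toReal_ofReal (operationalDensity_nonneg hβ hβ1 (le_of_lt hτ) ht)]

lemma integrable_operationalLaw_iff {E : Type*} [NormedAddCommGroup E] [NormedSpace ℝ E]
    {β : ℝ} (hβ : 0 < β) (hβ1 : β < 1) {t : ℝ} (ht : 0 < t) (f : ℝ → E) :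
    Integrable f (operationalLaw β t) ↔
      IntegrableOn (fun τ => operationalDensity β τ t • f τ) (Ioi 0) := by
  have hq : Measurable fun τ : ℝ => operationalDensity β τ t :=
    (measurable_operationalDensity hβ hβ1).comp (measurable_id.prodMk measurable_const)
  rw [operationalLaw, if_neg hβ1.ne, integrable_withDensity_iff_integrable_smul' (by fun_prop) (by simp)]
  refine integrable_congr ?_
  filter_upwards [self_mem_ae_restrict measurableSet_Ioi] with τ hτ
  rw [ENNReal.toReal_ofReal (operationalDensity_nonneg hβ hβ1 (le_of_lt hτ) ht)]

lemma isProbabilityMeasure_operationalLaw {β : ℝ} (hβ : 0 < β) (hβ1 : β ≤ 1) {t : ℝ} (ht : 0 < t) :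
    IsProbabilityMeasure (operationalLaw β t) := by
  rcases hβ1.eq_or_lt with rfl | hβ1
  · rw [operationalLaw, if_pos rfl]; infer_instance
  · constructor
    rw [operationalLaw, if_neg hβ1.ne, withDensity_apply _ MeasurableSet.univ, Measure.restrict_univ,
      ← ofReal_integral_eq_lintegral_ofReal (integrableOn_operationalDensity hβ hβ1 ht),
      integral_operationalDensity hβ hβ1 ht, ENNReal.ofReal_one]
    filter_upwards [self_mem_ae_restrict measurableSet_Ioi] with τ hτ
    exact operationalDensity_nonneg hβ hβ1 (le_of_lt hτ) ht

lemma ae_operationalLaw_pos (β : ℝ) {t : ℝ} (ht : 0 < t) : ∀ᵐ τ ∂(operationalLaw β t), 0 < τ := by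
  rw [operationalLaw]
  split_ifs
  · rw [ae_dirac_eq]; exact ht
  · exact (withDensity_absolutelyContinuous _ _).ae_le (self_mem_ae_restrict measurableSet_Ioi)

lemma integral_operationalLaw_scale {E : Type*} [NormedAddCommGroup E] [NormedSpace ℝ E] [CompleteSpace E]
    {β : ℝ} (hβ : 0 < β) (hβ1 : β ≤ 1) {t : ℝ} (ht : 0 < t) (f : ℝ → E) :
    ∫ τ, f τ ∂(operationalLaw β t) = ∫ z, f (t ^ β * z) ∂(operationalLaw β 1) := by
  rcases hβ1.eq_or_lt with rfl | hβ1
  · rw [operationalLaw, operationalLaw, if_pos rfl, if_pos rfl, integral_dirac, integral_dirac]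
    simp
  · rw [integral_operationalLaw hβ hβ1 ht, integral_operationalLaw hβ hβ1 one_pos,
      integral_operationalDensity_smul ht]
    simp_rw [← wrightM_eq_operationalDensity]

lemma integrable_id_operationalLaw {β : ℝ} (hβ : 0 < β) (hβ1 : β ≤ 1) :
    Integrable (fun z : ℝ => z) (operationalLaw β 1) := by
  rcases hβ1.eq_or_lt with rfl | hβ1
  · rw [operationalLaw, if_pos rfl]; exact integrable_dirac (by simp)
  · rw [integrable_operationalLaw_iff hβ hβ1 one_pos]
    simp_rw [← wrightM_eq_operationalDensity]
    have := integrableOn_rpow_mul_wrightM hβ hβ1 zero_le_one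
    simpa [mul_comm] using this

/-! ### Beta integrals and the relaxation function -/

lemma integral_sub_rpow_mul_rpow {a b t : ℝ} (ha : 0 < a) (hb : 0 < b) (ht : 0 < t) :
    ∫ τ in (0 : ℝ)..t, (t - τ) ^ (a - 1) * τ ^ (b - 1) =
      t ^ (a + b - 1) * (Real.Gamma a * Real.Gamma b / Real.Gamma (a + b)) := by
  have h := Complex.betaIntegral_scaled (b : ℂ) (a : ℂ) ht
  have hG := Complex.Gamma_mul_Gamma_eq_betaIntegral (s := (b : ℂ)) (t := (a : ℂ))
    (by simpa using hb) (by simpa using ha)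
  have hne : Real.Gamma (a + b) ≠ 0 := (Real.Gamma_pos_of_pos (by linarith)).ne'
  have hB : Complex.betaIntegral b a = ((Real.Gamma a * Real.Gamma b / Real.Gamma (a + b) : ℝ) : ℂ) := by
    rw [← Complex.ofReal_add, Complex.Gamma_ofReal, Complex.Gamma_ofReal, Complex.Gamma_ofReal,
      add_comm b a] at hG
    have hne' : (Real.Gamma (a + b) : ℂ) ≠ 0 := by exact_mod_cast hne
    push_cast
    rw [eq_div_iff hne', mul_comm, ← hG, mul_comm]
  have hc : ∫ x in (0 : ℝ)..t, (x : ℂ) ^ ((b : ℂ) - 1) * ((t : ℂ) - x) ^ ((a : ℂ) - 1) =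
      ∫ x in (0 : ℝ)..t, (((t - x) ^ (a - 1) * x ^ (b - 1) : ℝ) : ℂ) := by
    refine intervalIntegral.integral_congr fun x hx => ?_
    rw [uIcc_of_le ht.le] at hx
    have h1 : (0 : ℝ) ≤ t - x := sub_nonneg.2 hx.2
    push_cast [Complex.ofReal_cpow h1, Complex.ofReal_cpow hx.1]
    ring
  rw [hc, intervalIntegral.integral_ofReal, hB] at h
  have e : (b : ℂ) + a - 1 = ((a + b - 1 : ℝ) : ℂ) := by push_cast; ring
  rw [e, ← Complex.ofReal_cpow ht.le, ← Complex.ofReal_mul] at h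
  exact Complex.ofReal_injective h

/-- A non-integrable function has integral `0` by convention, while the Beta value is positive. -/
lemma intervalIntegrable_sub_rpow_mul_rpow {a b t : ℝ} (ha : 0 < a) (hb : 0 < b) (ht : 0 < t) :
    IntervalIntegrable (fun τ => (t - τ) ^ (a - 1) * τ ^ (b - 1)) volume 0 t := by
  by_contra h
  have h1 := integral_sub_rpow_mul_rpow ha hb ht
  rw [intervalIntegral.integral_undef h] at h1
  have := Real.Gamma_pos_of_pos ha
  have := Real.Gamma_pos_of_pos hb
  have := Real.Gamma_pos_of_pos (add_pos ha hb)
  have : 0 < t ^ (a + b - 1) * (Real.Gamma a * Real.Gamma b / Real.Gamma (a + b)) := by positivity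
  linarith

/-- The weighted relaxation function `∫ w(z) exp(-λ t^β z) dq_β(z, 1)`. -/
def relaxInt (β : ℝ) (w : ℝ → ℝ) (l : ℂ) (t : ℝ) : ℂ :=
  ∫ z, (w z : ℂ) * Complex.exp (-(l * (t ^ β * z : ℝ))) ∂(operationalLaw β 1)

/-- The relaxation function `E_β(-λ t^β)`, as a Laplace transform of the operational law. -/
def relax (β : ℝ) (l : ℂ) (t : ℝ) : ℂ := relaxInt β (fun _ => 1) l t

/-- One null set serves all rates and times, as dominated convergence in these parameters requires.
-/
lemma norm_relaxInt_integrand_le (β : ℝ) (w : ℝ → ℝ) :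
    ∀ᵐ z ∂(operationalLaw β 1), ∀ (l : ℂ), 0 ≤ l.re → ∀ u : ℝ, 0 ≤ u →
      ‖(w z : ℂ) * Complex.exp (-(l * (u * z : ℝ)))‖ ≤ ‖w z‖ := by
  filter_upwards [ae_operationalLaw_pos β one_pos] with z hz l hl u hu
  rw [norm_mul, Complex.norm_real, Complex.norm_exp]
  refine mul_le_of_le_one_right (norm_nonneg _) (Real.exp_le_one_iff.2 ?_)
  rw [Complex.neg_re, Complex.re_mul_ofReal, neg_nonpos]
  positivity

lemma norm_relaxInt_le {β : ℝ} {w : ℝ → ℝ} (hw : Integrable w (operationalLaw β 1)) {l : ℂ}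
    (hl : 0 ≤ l.re) {t : ℝ} (ht : 0 ≤ t) :
    ‖relaxInt β w l t‖ ≤ ∫ z, ‖w z‖ ∂(operationalLaw β 1) := by
  refine norm_integral_le_of_norm_le hw.norm ?_
  filter_upwards [norm_relaxInt_integrand_le β w] with z hz
  exact hz l hl _ (by positivity)

lemma continuousOn_relaxInt {β : ℝ} (hβ : 0 < β) {w : ℝ → ℝ}
    (hw : Integrable w (operationalLaw β 1)) :
    ContinuousOn (fun p : ℂ × ℝ => relaxInt β w p.1 p.2) {p | 0 ≤ p.1.re ∧ 0 ≤ p.2} := by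
  refine continuousOn_of_dominated (bound := fun z => ‖w z‖) (fun p _ => ?_) (fun p hp => ?_) hw.norm
    (Eventually.of_forall fun z => ?_)
  · exact (Complex.continuous_ofReal.comp_aestronglyMeasurable hw.1).mul (by fun_prop)
  · filter_upwards [norm_relaxInt_integrand_le β w] with z hz
    exact hz p.1 hp.1 _ (Real.rpow_nonneg hp.2 _)
  · have h : Continuous fun p : ℂ × ℝ => (p.2 ^ β * z : ℝ) :=
      (continuous_snd.rpow_const fun _ => Or.inr hβ.le).mul continuous_const
    fun_prop

lemma integrable_one_operationalLaw {β : ℝ} (hβ : 0 < β) (hβ1 : β ≤ 1) :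
    Integrable (fun _ : ℝ => (1 : ℝ)) (operationalLaw β 1) := by
  have := isProbabilityMeasure_operationalLaw hβ hβ1 one_pos
  exact integrable_const _

lemma norm_relax_le {β : ℝ} (hβ : 0 < β) (hβ1 : β ≤ 1) {l : ℂ} (hl : 0 ≤ l.re) {t : ℝ}
    (ht : 0 ≤ t) : ‖relax β l t‖ ≤ 1 := by
  have := isProbabilityMeasure_operationalLaw hβ hβ1 one_pos
  simpa [relax] using norm_relaxInt_le (integrable_one_operationalLaw hβ hβ1) hl ht

lemma relax_zero_right {β : ℝ} (hβ : 0 < β) (hβ1 : β ≤ 1) (l : ℂ) : relax β l 0 = 1 := by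
  have := isProbabilityMeasure_operationalLaw hβ hβ1 one_pos
  simp [relax, relaxInt, Real.zero_rpow hβ.ne']

lemma continuousOn_relax {β : ℝ} (hβ : 0 < β) (hβ1 : β ≤ 1) :
    ContinuousOn (fun p : ℂ × ℝ => relax β p.1 p.2) {p | 0 ≤ p.1.re ∧ 0 ≤ p.2} :=
  continuousOn_relaxInt hβ (integrable_one_operationalLaw hβ hβ1)

lemma continuousOn_relax_right {β : ℝ} (hβ : 0 < β) (hβ1 : β ≤ 1) {l : ℂ} (hl : 0 ≤ l.re) :
    ContinuousOn (relax β l) (Ici 0) :=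
  (continuousOn_relax hβ hβ1).comp (f := fun t : ℝ => (l, t)) (by fun_prop) fun _ ht => ⟨hl, ht⟩

/-- The derivative in time of the relaxation function. -/
def relaxDeriv (β : ℝ) (l : ℂ) (t : ℝ) : ℂ :=
  -(l * (β * t ^ (β - 1) : ℝ)) * relaxInt β (fun z => z) l t

lemma continuousOn_relaxDeriv {β : ℝ} (hβ : 0 < β) (hβ1 : β ≤ 1) :
    ContinuousOn (fun p : ℂ × ℝ => relaxDeriv β p.1 p.2) {p | 0 ≤ p.1.re ∧ 0 < p.2} := by
  have h1 := (continuousOn_relaxInt hβ (integrable_id_operationalLaw hβ hβ1)).mono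
    (t := {p : ℂ × ℝ | 0 ≤ p.1.re ∧ 0 < p.2}) fun p hp => ⟨hp.1, hp.2.le⟩
  have h2 : ContinuousOn (fun p : ℂ × ℝ => p.2 ^ (β - 1)) {p : ℂ × ℝ | 0 ≤ p.1.re ∧ 0 < p.2} :=
    continuousOn_snd.rpow_const fun p hp => Or.inl hp.2.ne'
  refine ContinuousOn.mul (ContinuousOn.neg (continuousOn_fst.mul ?_)) h1
  exact Complex.continuous_ofReal.comp_continuousOn (continuousOn_const.mul h2)

lemma continuousOn_relaxDeriv_right {β : ℝ} (hβ : 0 < β) (hβ1 : β ≤ 1) {l : ℂ} (hl : 0 ≤ l.re) :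
    ContinuousOn (relaxDeriv β l) (Ioi 0) :=
  (continuousOn_relaxDeriv hβ hβ1).comp (f := fun t : ℝ => (l, t)) (by fun_prop) fun _ ht => ⟨hl, ht⟩

lemma exists_norm_relaxDeriv_le {β : ℝ} (hβ : 0 < β) (hβ1 : β ≤ 1) :
    ∃ C, 0 ≤ C ∧ ∀ l : ℂ, 0 ≤ l.re → ∀ t, 0 < t → ‖relaxDeriv β l t‖ ≤ C * ‖l‖ * t ^ (β - 1) := by
  refine ⟨β * ∫ z, ‖z‖ ∂(operationalLaw β 1), by positivity, fun l hl t ht => ?_⟩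
  have h := norm_relaxInt_le (integrable_id_operationalLaw hβ hβ1) hl ht.le
  rw [relaxDeriv, norm_mul, norm_neg, norm_mul, Complex.norm_real, Real.norm_of_nonneg (by positivity)]
  calc ‖l‖ * (β * t ^ (β - 1)) * ‖relaxInt β (fun z => z) l t‖
      ≤ ‖l‖ * (β * t ^ (β - 1)) * ∫ z, ‖z‖ ∂(operationalLaw β 1) := by gcongr
    _ = _ := by ring

/-- The integral is differentiated in `u = t^β`, with the finite first moment of the operational law
as majorant. The singular factor `t^{β-1}` comes only from the chain rule. -/
lemma hasDerivAt_relax {β : ℝ} (hβ : 0 < β) (hβ1 : β ≤ 1) {l : ℂ} (hl : 0 ≤ l.re) {t : ℝ}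
    (ht : 0 < t) : HasDerivAt (relax β l) (relaxDeriv β l t) t := by
  have hu : 0 < t ^ β := by positivity
  have key := hasDerivAt_integral_of_dominated_loc_of_deriv_le (μ := operationalLaw β 1)
    (F := fun (u z : ℝ) => ((1 : ℝ) : ℂ) * Complex.exp (-(l * (u * z : ℝ))))
    (F' := fun (u z : ℝ) => -l * ((z : ℂ) * Complex.exp (-(l * (u * z : ℝ)))))
    (x₀ := t ^ β) (s := Ioi 0) (bound := fun z => ‖l‖ * ‖z‖) (Ioi_mem_nhds hu)
    (Eventually.of_forall fun u => by fun_prop) ?_ (by fun_prop) ?_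
    ((integrable_id_operationalLaw hβ hβ1).norm.const_mul _) (Eventually.of_forall fun z u _ => ?_)
  · have h := key.2.scomp t (Real.hasDerivAt_rpow_const (p := β) (Or.inl ht.ne'))
    refine h.congr_deriv ?_
    rw [integral_const_mul, relaxDeriv, relaxInt, Complex.real_smul]
    ring
  · refine (integrable_one_operationalLaw hβ hβ1).norm.mono' (by fun_prop) ?_
    filter_upwards [norm_relaxInt_integrand_le β fun _ => 1] with z hz
    exact hz l hl _ hu.le
  · filter_upwards [norm_relaxInt_integrand_le β fun z => z] with z hz u hu
    rw [norm_mul, norm_neg]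
    gcongr
    exact hz l hl u (le_of_lt hu)
  · have h1 : HasDerivAt (fun u : ℝ => ((u * z : ℝ) : ℂ)) (z : ℂ) u := by
      simpa using ((hasDerivAt_id u).mul_const z).ofReal_comp
    have h2 := (h1.const_mul l).neg.cexp.const_mul ((1 : ℝ) : ℂ)
    refine h2.congr_deriv ?_
    simp only [Pi.neg_apply]
    push_cast; ring

/-- A function whose Laplace transform vanishes on a vertical line vanishes wherever it is
continuous. -/
lemma eq_zero_of_laplace_eq_zero {F : ℝ → ℂ}
    (hi : IntegrableOn (fun t : ℝ => Complex.exp (-((1 : ℂ) * t)) * F t) (Ioi 0))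
    (h : ∀ s : ℂ, s.re = 1 → ∫ t in Ioi (0 : ℝ), Complex.exp (-(s * t)) * F t = 0)
    {t : ℝ} (ht : 0 < t) (hc : ContinuousAt F t) : F t = 0 := by
  set f : ℝ → ℂ := indicator (Ioi 0) fun t : ℝ => Complex.exp (-((1 : ℂ) * t)) * F t with hf
  have h1 : Integrable f := (integrable_indicator_iff measurableSet_Ioi).2 hi
  have h2 : fourierPlus f = fun _ => 0 := by
    funext κ
    have e : ∀ x : ℝ, Complex.exp (Complex.I * κ * x) * f x =
        indicator (Ioi 0) (fun t : ℝ => Complex.exp (-((1 - Complex.I * κ) * t)) * F t) x := by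
      intro x
      by_cases hx : x ∈ Ioi (0 : ℝ)
      · rw [hf, indicator_of_mem hx, indicator_of_mem hx, ← mul_assoc, ← Complex.exp_add]
        congr 2; ring
      · rw [hf, indicator_of_notMem hx, indicator_of_notMem hx, mul_zero]
    rw [fourierPlus]
    simp_rw [e]
    rw [integral_indicator measurableSet_Ioi]
    exact h _ (by simp)
  have h3 : ContinuousAt f t := by
    have : ContinuousAt (fun t : ℝ => Complex.exp (-((1 : ℂ) * t)) * F t) t :=
      (by fun_prop : ContinuousAt (fun t : ℝ => Complex.exp (-((1 : ℂ) * t))) t).mul hc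
    refine this.congr ?_
    filter_upwards [Ioi_mem_nhds ht] with x hx
    rw [hf, indicator_of_mem (show x ∈ Ioi (0 : ℝ) from hx)]
  have h4 := fourierPlusInv_fourierPlus h1 (by rw [h2]; exact integrable_zero _ _ _) h3
  rw [h2, hf, indicator_of_mem (show t ∈ Ioi (0 : ℝ) from ht)] at h4
  have h5 : fourierPlusInv (fun _ => 0) t = 0 := by simp [fourierPlusInv]
  rw [h5] at h4
  exact (mul_eq_zero.1 h4.symm).resolve_left (Complex.exp_ne_zero _)

lemma intervalIntegrable_sub_rpow_mul {F : ℝ → ℂ} (hF : ContinuousOn F (Ioi 0)) {a β C : ℝ}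
    (ha : 0 < a) (hβ : 0 < β) (h : ∀ τ, 0 < τ → ‖F τ‖ ≤ C * τ ^ (β - 1)) {t : ℝ} (ht : 0 < t) :
    IntervalIntegrable (fun τ => (((t - τ) ^ (a - 1) : ℝ) : ℂ) * F τ) volume 0 t := by
  have hb := (intervalIntegrable_sub_rpow_mul_rpow ha hβ ht).const_mul C
  refine hb.mono_fun' ?_ ?_
  · rw [uIoc_of_le ht.le]
    refine AEStronglyMeasurable.mul (by fun_prop : Measurable fun τ : ℝ =>
      (((t - τ) ^ (a - 1) : ℝ) : ℂ)).aestronglyMeasurable ?_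
    exact (hF.mono fun x hx => hx.1).aestronglyMeasurable measurableSet_Ioc
  · rw [uIoc_of_le ht.le]
    filter_upwards [self_mem_ae_restrict measurableSet_Ioc] with τ hτ
    rw [norm_mul, Complex.norm_real, Real.norm_of_nonneg (Real.rpow_nonneg (sub_nonneg.2 hτ.2) _)]
    have := Real.rpow_nonneg (sub_nonneg.2 hτ.2) (a - 1)
    calc _ ≤ (t - τ) ^ (a - 1) * (C * τ ^ (β - 1)) := by gcongr; exact h τ hτ.1
      _ = _ := by ring

lemma integral_sub_rpow_mul_eq (F : ℝ → ℂ) (a : ℝ) {t : ℝ} (ht : 0 < t) :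
    ∫ τ in (0 : ℝ)..t, (((t - τ) ^ (a - 1) : ℝ) : ℂ) * F τ =
      ∫ v in (0 : ℝ)..1, (((t ^ a * (1 - v) ^ (a - 1)) : ℝ) : ℂ) * F (t * v) := by
  have h := intervalIntegral.integral_comp_mul_left (a := 0) (b := 1)
    (fun τ => (((t - τ) ^ (a - 1) : ℝ) : ℂ) * F τ) ht.ne'
  rw [mul_zero, mul_one] at h
  rw [← smul_inv_smul₀ (inv_pos.2 ht).ne' (∫ τ in (0 : ℝ)..t, (((t - τ) ^ (a - 1) : ℝ) : ℂ) * F τ),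
    inv_inv, smul_comm, ← h, ← intervalIntegral.integral_smul]
  refine intervalIntegral.integral_congr fun v hv => ?_
  rw [uIcc_of_le zero_le_one] at hv
  have e : t - t * v = t * (1 - v) := by ring
  have e2 : t ^ a = t * t ^ (a - 1) := by
    rw [Real.rpow_sub_one ht.ne', mul_div_cancel₀ _ ht.ne']
  rw [e, Real.mul_rpow ht.le (sub_nonneg.2 hv.2), e2, Complex.real_smul]
  push_cast; ring

/-- After rescaling to `[0, 1]` the powers `t^{1-β}` and `t^{β-1}` cancel in the bound, which leaves
a Beta integrand independent of `t` as majorant. -/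
lemma continuousOn_integral_sub_rpow_mul {F : ℝ → ℂ} (hF : ContinuousOn F (Ioi 0)) {β C : ℝ}
    (hβ : 0 < β) (hβ1 : β < 1) (h : ∀ τ, 0 < τ → ‖F τ‖ ≤ C * τ ^ (β - 1)) :
    ContinuousOn (fun t => ∫ τ in (0 : ℝ)..t, (((t - τ) ^ (1 - β - 1) : ℝ) : ℂ) * F τ) (Ioi 0) := by
  refine ContinuousOn.congr (f := fun t => ∫ v in (0 : ℝ)..1,
    (((t ^ (1 - β) * (1 - v) ^ (1 - β - 1)) : ℝ) : ℂ) * F (t * v)) ?_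
    fun t ht => integral_sub_rpow_mul_eq F _ ht
  intro t₀ ht₀
  refine ContinuousAt.continuousWithinAt ?_
  have hb := (intervalIntegrable_sub_rpow_mul_rpow (a := 1 - β) (b := β) (by linarith) hβ
    one_pos).const_mul C
  refine intervalIntegral.continuousAt_of_dominated_interval
    (bound := fun v => C * ((1 - v) ^ (1 - β - 1) * v ^ (β - 1))) ?_ ?_ hb ?_
  · filter_upwards [Ioi_mem_nhds ht₀] with t ht
    rw [uIoc_of_le zero_le_one]
    refine AEStronglyMeasurable.mul (by fun_prop : Measurable fun v : ℝ =>
      ((t ^ (1 - β) * (1 - v) ^ (1 - β - 1) : ℝ) : ℂ)).aestronglyMeasurable ?_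
    refine ContinuousOn.aestronglyMeasurable ?_ measurableSet_Ioc
    exact hF.comp (by fun_prop) fun v hv => mul_pos ht hv.1
  · filter_upwards [Ioi_mem_nhds ht₀] with t ht
    have ht' : (0 : ℝ) < t := ht
    refine Eventually.of_forall fun v hv => ?_
    rw [uIoc_of_le zero_le_one] at hv
    have h1 := Real.rpow_nonneg (sub_nonneg.2 hv.2) (1 - β - 1)
    have e : t ^ (1 - β) * t ^ (β - 1) = 1 := by
      rw [← Real.rpow_add ht']; simp
    rw [norm_mul, Complex.norm_real, Real.norm_of_nonneg (by positivity)]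
    calc _ ≤ t ^ (1 - β) * (1 - v) ^ (1 - β - 1) * (C * (t * v) ^ (β - 1)) := by
          gcongr; exact h _ (mul_pos ht' hv.1)
      _ = (t ^ (1 - β) * t ^ (β - 1)) * (C * ((1 - v) ^ (1 - β - 1) * v ^ (β - 1))) := by
          rw [Real.mul_rpow ht'.le hv.1.le]; ring
      _ = _ := by rw [e, one_mul]
  · refine Eventually.of_forall fun v hv => ?_
    rw [uIoc_of_le zero_le_one] at hv
    have h1 : ContinuousAt (fun t : ℝ => t ^ (1 - β)) t₀ :=
      Real.continuousAt_rpow_const _ _ (Or.inl (ne_of_gt ht₀))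
    have h2 : ContinuousAt (fun t : ℝ => F (t * v)) t₀ :=
      ContinuousAt.comp (f := fun t : ℝ => t * v)
        (hF.continuousAt (Ioi_mem_nhds (mul_pos ht₀ hv.1))) (by fun_prop)
    refine ContinuousAt.mul ?_ h2
    exact Complex.continuous_ofReal.continuousAt.comp (h1.mul continuousAt_const)

lemma relax_eq_integral_operationalDensity {β : ℝ} (hβ : 0 < β) (hβ1 : β < 1) (l : ℂ) {t : ℝ}
    (ht : 0 < t) : relax β l t =
      ∫ τ in Ioi (0 : ℝ), Complex.exp (-(l * τ)) * operationalDensity β τ t := by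
  have h := integral_operationalLaw_scale hβ hβ1.le ht fun τ : ℝ => Complex.exp (-(l * τ))
  rw [integral_operationalLaw hβ hβ1 ht] at h
  simp_rw [relax, relaxInt, Complex.ofReal_one, one_mul]
  rw [← h]
  refine integral_congr_ae (Eventually.of_forall fun τ => ?_)
  simp only [Complex.real_smul]; exact mul_comm _ _

lemma cpow_re_pos {β : ℝ} (hβ : 0 < β) (hβ1 : β < 1) {s : ℂ} (hs : 0 < s.re) :
    0 < (s ^ (β : ℂ)).re := by
  have hn : 0 < ‖s‖ := norm_pos_iff.2 fun h => by simp [h] at hs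
  exact (mul_pos (by positivity) (cos_mul_pi_div_two_pos hβ hβ1)).trans_le
    (cpow_re_ge hβ hβ1.le hs.le)

section Laplace

variable {β : ℝ} (hβ : 0 < β) (hβ1 : β < 1) {l : ℂ} (hl : 0 ≤ l.re) {s : ℂ} (hs : 0 < s.re)

include hβ hβ1 hl hs

/-- By Fubini the time transform may be taken inside, and then `τ` is integrated against `exp(-τ
(s^β + l))`, which decays because `re s^β > 0` and `re l ≥ 0`. -/
lemma laplace_relax : IntegrableOn (fun t : ℝ => Complex.exp (-(s * t)) * relax β l t) (Ioi 0) ∧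
    ∫ t in Ioi (0 : ℝ), Complex.exp (-(s * t)) * relax β l t =
      s ^ ((β : ℂ) - 1) * (s ^ (β : ℂ) + l)⁻¹ := by
  have hω : Measurable fun τ : ℝ => Complex.exp (-(l * τ)) := by fun_prop
  have hi : IntegrableOn (fun τ : ℝ => ‖Complex.exp (-(l * τ))‖ * Real.exp (-(τ * s.re ^ β)))
      (Ioi 0) := by
    have hp : 0 < l.re + s.re ^ β := by positivity
    refine IntegrableOn.congr_fun (integrableOn_rpow_mul_exp_neg one_pos hp) (fun τ _ => ?_)
      measurableSet_Ioi
    rw [Complex.norm_exp, ← Real.exp_add, sub_self, Real.rpow_zero, one_mul, Complex.neg_re,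
      Complex.re_mul_ofReal]
    congr 1; ring
  have e : ∀ t ∈ Ioi (0 : ℝ), Complex.exp (-(s * t)) * relax β l t = Complex.exp (-(s * t)) *
      ∫ τ in Ioi (0 : ℝ), Complex.exp (-(l * τ)) * operationalDensity β τ t := fun t ht => by
    rw [relax_eq_integral_operationalDensity hβ hβ1 l ht]
  constructor
  · exact (integrableOn_laplace_weighted hβ hβ1 hω hs hi).congr_fun (fun t ht => (e t ht).symm)
      measurableSet_Ioi
  · rw [setIntegral_congr_fun measurableSet_Ioi e, integral_laplace_weighted hβ hβ1 hω hs hi]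
    have hw : 0 < (s ^ (β : ℂ) + l).re := by
      rw [Complex.add_re]; exact add_pos_of_pos_of_nonneg (cpow_re_pos hβ hβ1 hs) hl
    have h := integral_rpow_mul_cexp_neg (a := 1) one_pos hw
    rw [Real.Gamma_one, Complex.ofReal_one, one_mul, Complex.cpow_neg_one] at h
    rw [← h, ← integral_const_mul]
    refine integral_congr_ae (Eventually.of_forall fun τ => ?_)
    simp only [laplaceKernel, sub_self, Real.rpow_zero, Complex.ofReal_one, one_mul]
    rw [mul_left_comm, ← Complex.exp_add]
    congr 2; ring

lemma integrableOn_exp_mul_relaxDeriv :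
    IntegrableOn (fun t : ℝ => Complex.exp (-(s * t)) * relaxDeriv β l t) (Ioi 0) := by
  obtain ⟨C, hC, h⟩ := exists_norm_relaxDeriv_le hβ hβ1.le
  refine ((integrableOn_rpow_mul_exp_neg hβ hs).const_mul (C * ‖l‖)).mono' ?_ ?_
  · refine AEStronglyMeasurable.mul (by fun_prop) ?_
    exact (continuousOn_relaxDeriv_right hβ hβ1.le hl).aestronglyMeasurable measurableSet_Ioi
  · filter_upwards [self_mem_ae_restrict measurableSet_Ioi] with t ht
    rw [norm_mul, norm_cexp_neg_mul]
    calc _ ≤ Real.exp (-(s.re * t)) * (C * ‖l‖ * t ^ (β - 1)) := by gcongr; exact h l hl t ht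
      _ = _ := by ring

lemma laplace_relaxDeriv : ∫ t in Ioi (0 : ℝ), Complex.exp (-(s * t)) * relaxDeriv β l t =
    s * (s ^ ((β : ℂ) - 1) * (s ^ (β : ℂ) + l)⁻¹) - 1 := by
  obtain ⟨h1, h2⟩ := laplace_relax hβ hβ1 hl hs
  have h3 := integrableOn_exp_mul_relaxDeriv hβ hβ1 hl hs
  have h4 : ∫ t in Ioi (0 : ℝ), (Complex.exp (-(s * t)) * relaxDeriv β l t -
      s * (Complex.exp (-(s * t)) * relax β l t)) = 0 - Complex.exp (-(s * (0 : ℝ))) * relax β l 0 := by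
    refine integral_Ioi_of_hasDerivAt_of_tendsto
      (f := fun t : ℝ => Complex.exp (-(s * t)) * relax β l t) ?_ (fun t ht => ?_)
      (h3.sub (h1.const_mul s)) ?_
    · exact ContinuousWithinAt.mul (by fun_prop) (continuousOn_relax_right hβ hβ1.le hl 0 self_mem_Ici)
    · have ha : HasDerivAt (fun t : ℝ => (t : ℂ)) 1 t := by simpa using (hasDerivAt_id t).ofReal_comp
      have hb := (ha.const_mul s).neg.cexp
      refine (hb.mul (hasDerivAt_relax hβ hβ1.le hl ht)).congr_deriv ?_
      simp only [Pi.neg_apply]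
      ring
    · refine squeeze_zero_norm' (a := fun t => Real.exp (-(s.re * t))) ?_ ?_
      · filter_upwards [eventually_ge_atTop 0] with t ht
        rw [norm_mul, norm_cexp_neg_mul]
        exact mul_le_of_le_one_right (by positivity) (norm_relax_le hβ hβ1.le hl ht)
      · exact Real.tendsto_exp_neg_atTop_nhds_zero.comp (tendsto_id.const_mul_atTop hs)
  rw [integral_sub h3 (h1.const_mul s), integral_const_mul, h2, relax_zero_right hβ hβ1.le] at h4
  simp only [Complex.ofReal_zero, mul_zero, neg_zero, Complex.exp_zero, mul_one, zero_sub] at h4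
  linear_combination h4

end Laplace

/-- Laplace transform of a Riemann–Liouville fractional integral. -/
lemma laplace_integral_sub_rpow_mul {F : ℝ → ℂ} {a : ℝ} (ha : 0 < a) {s : ℂ} (hs : 0 < s.re)
    (hF : IntegrableOn (fun t : ℝ => Complex.exp (-(s * t)) * F t) (Ioi 0)) :
    IntegrableOn (fun t : ℝ => Complex.exp (-(s * t)) *
      ∫ τ in (0 : ℝ)..t, (((t - τ) ^ (a - 1) : ℝ) : ℂ) * F τ) (Ioi 0) ∧
    ∫ t in Ioi (0 : ℝ), Complex.exp (-(s * t)) *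
      ∫ τ in (0 : ℝ)..t, (((t - τ) ^ (a - 1) : ℝ) : ℂ) * F τ =
      (∫ t in Ioi (0 : ℝ), Complex.exp (-(s * t)) * F t) * (Real.Gamma a * s ^ (-(a : ℂ))) := by
  set g : ℝ → ℂ := fun u => ((u ^ (a - 1) : ℝ) : ℂ) * Complex.exp (-(s * u)) with hg
  have hgi : IntegrableOn g (Ioi 0) := by
    refine (integrableOn_rpow_mul_exp_neg ha hs).mono' (by fun_prop) ?_
    filter_upwards [self_mem_ae_restrict measurableSet_Ioi] with u hu
    rw [hg, norm_mul, norm_cexp_neg_mul, Complex.norm_real,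
      Real.norm_of_nonneg (Real.rpow_nonneg (le_of_lt hu) _)]
  have e : ∀ t : ℝ, Complex.exp (-(s * t)) * ∫ τ in (0 : ℝ)..t, (((t - τ) ^ (a - 1) : ℝ) : ℂ) * F τ =
      ∫ τ in (0 : ℝ)..t, ContinuousLinearMap.mul ℝ ℂ (Complex.exp (-(s * τ)) * F τ) (g (t - τ)) := by
    intro t
    rw [← intervalIntegral.integral_const_mul]
    refine intervalIntegral.integral_congr fun τ _ => ?_
    have : Complex.exp (-(s * t)) = Complex.exp (-(s * τ)) * Complex.exp (-(s * (t - τ : ℝ))) := by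
      rw [← Complex.exp_add]; congr 1; push_cast; ring
    simp only [hg, ContinuousLinearMap.mul_apply']
    rw [this]; ring
  simp_rw [e]
  constructor
  · have h := integrable_posConvolution (μ := volume) (ν := volume) hF hgi (ContinuousLinearMap.mul ℝ ℂ)
    rw [posConvolution] at h
    exact (integrable_indicator_iff measurableSet_Ioi).1 h
  · rw [integral_posConvolution hF hgi (ContinuousLinearMap.mul ℝ ℂ), hg,
      integral_rpow_mul_cexp_neg ha hs]
    rfl

/-- The Laplace transform of the difference of the two sides is `s^{β-1} (s^β/(s^β + l) - 1) + l
s^{β-1}/(s^β + l) = 0`. The difference is continuous for `t > 0`, hence zero at every such `t`. -/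
lemma caputo_relax {β : ℝ} (hβ : 0 < β) (hβ1 : β < 1) {l : ℂ} (hl : 0 ≤ l.re) {t : ℝ} (ht : 0 < t) :
    (((Real.Gamma (1 - β))⁻¹ : ℝ) : ℂ) *
      ∫ τ in (0 : ℝ)..t, (((t - τ) ^ (-β) : ℝ) : ℂ) * relaxDeriv β l τ = -l * relax β l t := by
  have hβ' : 0 < 1 - β := by linarith
  have hΓ : (Real.Gamma (1 - β) : ℂ) ≠ 0 := by exact_mod_cast (Real.Gamma_pos_of_pos hβ').ne'
  obtain ⟨C, -, hC⟩ := exists_norm_relaxDeriv_le hβ hβ1.le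
  have hD := continuousOn_integral_sub_rpow_mul (continuousOn_relaxDeriv_right hβ hβ1.le hl) hβ hβ1
    (hC l hl)
  have eβ : ∀ x : ℝ, x ^ (-β) = x ^ (1 - β - 1) := fun x => by congr 1; ring
  simp_rw [eβ]
  set F : ℝ → ℂ := fun t => (((Real.Gamma (1 - β))⁻¹ : ℝ) : ℂ) *
    (∫ τ in (0 : ℝ)..t, (((t - τ) ^ (1 - β - 1) : ℝ) : ℂ) * relaxDeriv β l τ) + l * relax β l t with hF
  have hi : ∀ s : ℂ, 0 < s.re → IntegrableOn (fun t : ℝ => Complex.exp (-(s * t)) * F t) (Ioi 0) ∧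
      ∫ t in Ioi (0 : ℝ), Complex.exp (-(s * t)) * F t = 0 := by
    intro s hs
    have hs0 : s ≠ 0 := fun h => by simp [h] at hs
    obtain ⟨h1, h2⟩ := laplace_relax hβ hβ1 hl hs
    obtain ⟨h3, h4⟩ := laplace_integral_sub_rpow_mul hβ' hs
      (integrableOn_exp_mul_relaxDeriv hβ hβ1 hl hs)
    have e : ∀ t : ℝ, Complex.exp (-(s * t)) * F t = (((Real.Gamma (1 - β))⁻¹ : ℝ) : ℂ) *
      (Complex.exp (-(s * t)) *
        ∫ τ in (0 : ℝ)..t, (((t - τ) ^ (1 - β - 1) : ℝ) : ℂ) * relaxDeriv β l τ) +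
      l * (Complex.exp (-(s * t)) * relax β l t) := fun t => by rw [hF]; ring
    simp_rw [e]
    refine ⟨(h3.const_mul _).add (h1.const_mul _), ?_⟩
    rw [integral_add (h3.const_mul _) (h1.const_mul _), integral_const_mul, integral_const_mul, h2, h4,
      laplace_relaxDeriv hβ hβ1 hl hs]
    have hw : s ^ (β : ℂ) + l ≠ 0 := fun h => by
      have : 0 < (s ^ (β : ℂ) + l).re := by
        rw [Complex.add_re]; exact add_pos_of_pos_of_nonneg (cpow_re_pos hβ hβ1 hs) hl
      rw [h] at this; simp at this
    have e1 : s ^ (-((1 - β : ℝ) : ℂ)) = s ^ ((β : ℂ) - 1) := by congr 1; push_cast; ring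
    have e2 : s * s ^ ((β : ℂ) - 1) = s ^ (β : ℂ) := by
      rw [Complex.cpow_sub _ _ hs0, Complex.cpow_one, mul_div_cancel₀ _ hs0]
    rw [e1, Complex.ofReal_inv, ← mul_assoc s, e2]
    field_simp
    ring
  have h0 : F t = 0 := by
    refine eq_zero_of_laplace_eq_zero (by simpa using (hi 1 (by simp)).1)
      (fun s hs => (hi s (by rw [hs]; exact one_pos)).2) ht ?_
    have h5 := (continuousOn_relax_right hβ hβ1.le hl).continuousAt (Ici_mem_nhds ht)
    exact (continuousAt_const.mul (hD.continuousAt (Ioi_mem_nhds ht))).add (continuousAt_const.mul h5)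
  rw [hF] at h0
  linear_combination h0

/-- For `β = 1` the operational law at time `1` is the unit mass at `1`, and the relaxation function
is `e^{-lt}`. -/
lemma relaxDeriv_one {l : ℂ} {t : ℝ} : relaxDeriv 1 l t = -l * relax 1 l t := by
  simp [relaxDeriv, relax, relaxInt, operationalLaw]

/-! ### The parent law and the subordinated law -/

lemma measurable_parentDensity {α θ : ℝ} (hα : 0 < α) (hθ : |θ| < 1) :
    Measurable fun p : ℝ × ℝ => parentDensity α θ p.2 p.1 := by
  have h := (continuous_stableDensity hα hθ).measurable
  unfold parentDensity
  fun_prop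

lemma abs_le_one_of_le_min {α θ : ℝ} (hθ : |θ| ≤ min α (2 - α)) : |θ| ≤ 1 := by
  have := le_min_iff.1 hθ
  linarith [this.1, this.2]

lemma eq_one_of_abs_eq_one {α θ : ℝ} (hθ : |θ| ≤ min α (2 - α)) (h : |θ| = 1) : α = 1 := by
  have := le_min_iff.1 hθ
  linarith [this.1, this.2]

lemma measurable_parentLaw {α θ : ℝ} (hα : 0 < α) (hθ : |θ| ≤ min α (2 - α)) :
    Measurable (parentLaw α θ) := by
  by_cases h : |θ| = 1
  · have : parentLaw α θ = fun τ => Measure.dirac (-(θ * τ)) := by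
      funext τ; rw [parentLaw, if_pos h]
    rw [this]
    exact Measure.measurable_dirac.comp (by fun_prop)
  · have h1 : |θ| < 1 := lt_of_le_of_ne (abs_le_one_of_le_min hθ) h
    refine Measure.measurable_of_measurable_coe _ fun s hs => ?_
    simp_rw [parentLaw, if_neg h, withDensity_apply _ hs]
    exact (measurable_parentDensity hα h1).ennreal_ofReal.lintegral_prod_right'

lemma isProbabilityMeasure_parentLaw {α θ : ℝ} (hα : 0 < α) (hα2 : α ≤ 2)
    (hθ : |θ| ≤ min α (2 - α)) {τ : ℝ} (hτ : 0 < τ) : IsProbabilityMeasure (parentLaw α θ τ) := by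
  rw [parentLaw]
  split_ifs with h
  · infer_instance
  · have h1 : |θ| < 1 := lt_of_le_of_ne (abs_le_one_of_le_min hθ) h
    constructor
    rw [withDensity_apply _ MeasurableSet.univ, Measure.restrict_univ,
      ← ofReal_integral_eq_lintegral_ofReal (integrable_parentDensity hα hα2 hθ h1 hτ)
        (Eventually.of_forall fun x => parentDensity_nonneg hα hα2 hθ h1 hτ.le x),
      integral_parentDensity hα hα2 hθ h1 hτ, ENNReal.ofReal_one]

/-- Since `e^{±iπ/2} = ±i`, the symbol is linear and generates a pure translation. This is why the
degenerate parent law is a Dirac mass. -/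
lemma symbol_one_of_abs_eq_one {θ : ℝ} (h : |θ| = 1) (κ : ℝ) : symbol 1 θ κ = Complex.I * κ * θ := by
  have he : Complex.exp (Complex.I * (θ * Real.pi / 2 : ℝ)) = θ * Complex.I := by
    have h1 : Complex.exp (Real.pi / 2 * Complex.I) = Complex.I := Complex.exp_pi_div_two_mul_I
    rcases eq_or_eq_neg_of_abs_eq h with rfl | rfl
    · rw [show Complex.I * ((1 * Real.pi / 2 : ℝ) : ℂ) = Real.pi / 2 * Complex.I by push_cast; ring, h1]
      simp
    · rw [show Complex.I * ((-1 * Real.pi / 2 : ℝ) : ℂ) = -(Real.pi / 2 * Complex.I) by push_cast; ring,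
        Complex.exp_neg, h1, Complex.inv_I]
      simp
  have hθ : (θ : ℂ) * θ = 1 := by
    have : θ * θ = 1 := by rw [← abs_mul_abs_self, h, one_mul]
    exact_mod_cast this
  rcases lt_trichotomy κ 0 with hκ | rfl | hκ
  · have hi : (θ * Complex.I)⁻¹ = -(θ * Complex.I) := by
      refine inv_eq_of_mul_eq_one_right ?_
      linear_combination -Complex.I ^ 2 * hθ - Complex.I_sq
    rw [symbol_of_neg 1 θ hκ, Complex.exp_neg, he, Real.rpow_one, hi]
    push_cast; ring
  · simp [symbol_zero]
  · rw [symbol_of_pos 1 θ hκ, he, Real.rpow_one]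
    ring

lemma integral_exp_parentLaw {α θ : ℝ} (hα : 0 < α) (hα2 : α ≤ 2)
    (hθ : |θ| ≤ min α (2 - α)) {τ : ℝ} (hτ : 0 < τ) (κ : ℝ) :
    ∫ x, Complex.exp (Complex.I * κ * x) ∂(parentLaw α θ τ) =
      Complex.exp (-(symbol α θ κ * τ)) := by
  rw [parentLaw]
  split_ifs with h
  · obtain rfl := eq_one_of_abs_eq_one hθ h
    rw [integral_dirac, symbol_one_of_abs_eq_one h]
    congr 1; push_cast; ring
  · have h1 : |θ| < 1 := lt_of_le_of_ne (abs_le_one_of_le_min hθ) h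
    have hm : Measurable fun x => parentDensity α θ x τ :=
      (measurable_parentDensity hα h1).comp (measurable_const.prodMk measurable_id)
    rw [integral_withDensity_eq_integral_toReal_smul (by fun_prop) (by simp),
      mul_comm (symbol α θ κ), ← fourierPlus_parentDensity hα hα2 hθ h1 hτ κ, fourierPlus]
    refine integral_congr_ae (Eventually.of_forall fun x => ?_)
    simp only
    rw [ENNReal.toReal_ofReal (parentDensity_nonneg hα hα2 hθ h1 hτ.le x), Complex.real_smul, mul_comm]

/-- The mixture of the parent laws with respect to the operational law. -/
def subordinatedLaw (α θ β t : ℝ) : Measure ℝ := (operationalLaw β t).bind (parentLaw α θ)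

lemma isProbabilityMeasure_subordinatedLaw {α θ β : ℝ} (hα : 0 < α) (hα2 : α ≤ 2)
    (hθ : |θ| ≤ min α (2 - α)) (hβ : 0 < β) (hβ1 : β ≤ 1) {t : ℝ} (ht : 0 < t) :
    IsProbabilityMeasure (subordinatedLaw α θ β t) := by
  have := isProbabilityMeasure_operationalLaw hβ hβ1 ht
  constructor
  rw [subordinatedLaw, Measure.bind_apply MeasurableSet.univ (measurable_parentLaw hα hθ).aemeasurable]
  have h : ∀ᵐ τ ∂(operationalLaw β t), parentLaw α θ τ univ = 1 := by
    filter_upwards [ae_operationalLaw_pos β ht] with τ hτ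
    have := isProbabilityMeasure_parentLaw hα hα2 hθ hτ
    exact measure_univ
  rw [lintegral_congr_ae h]; simp

lemma real_subordinatedLaw {α θ β : ℝ} (hα : 0 < α) (hα2 : α ≤ 2)
    (hθ : |θ| ≤ min α (2 - α)) {t : ℝ} (ht : 0 < t)
    {A : Set ℝ} (hA : MeasurableSet A) :
    (subordinatedLaw α θ β t).real A = ∫ τ, (parentLaw α θ τ).real A ∂(operationalLaw β t) := by
  have hm := measurable_parentLaw hα hθ
  rw [Measure.real, subordinatedLaw, Measure.bind_apply hA hm.aemeasurable]
  refine (integral_toReal ((Measure.measurable_coe hA).comp hm).aemeasurable ?_).symm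
  filter_upwards [ae_operationalLaw_pos β ht] with τ hτ
  have := isProbabilityMeasure_parentLaw hα hα2 hθ hτ
  exact measure_lt_top _ _

lemma integral_subordinatedLaw {α θ β : ℝ} (hα : 0 < α)
    (hθ : |θ| ≤ min α (2 - α)) (t : ℝ) {f : ℝ → ℂ} (hf : Integrable f (subordinatedLaw α θ β t)) :
    ∫ x, f x ∂(subordinatedLaw α θ β t) = ∫ τ, ∫ x, f x ∂(parentLaw α θ τ) ∂(operationalLaw β t) := by
  let K : ProbabilityTheory.Kernel ℝ ℝ := ⟨parentLaw α θ, measurable_parentLaw hα hθ⟩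
  have e : (K.comp (ProbabilityTheory.Kernel.const Unit (operationalLaw β t))) () =
      subordinatedLaw α θ β t := by
    rw [ProbabilityTheory.Kernel.comp_apply]; rfl
  have := ProbabilityTheory.Kernel.integral_comp (η := K)
    (κ := ProbabilityTheory.Kernel.const Unit (operationalLaw β t)) (a := ()) (f := f) (by rwa [e])
  rw [e] at this
  exact this

/-- The subordination principle: the parent characteristic function `exp(-ψ τ)`, averaged over the
operational law, is a relaxation function with rate `ψ`. -/
lemma integral_exp_subordinatedLaw {α θ β : ℝ} (hα : 0 < α) (hα2 : α ≤ 2)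
    (hθ : |θ| ≤ min α (2 - α)) (hβ : 0 < β) (hβ1 : β ≤ 1) {t : ℝ} (ht : 0 < t) (κ : ℝ) :
    ∫ x, Complex.exp (Complex.I * κ * x) ∂(subordinatedLaw α θ β t) =
      relax β (symbol α θ κ) t := by
  have := isProbabilityMeasure_subordinatedLaw hα hα2 hθ hβ hβ1 ht
  have hi : Integrable (fun x : ℝ => Complex.exp (Complex.I * κ * x)) (subordinatedLaw α θ β t) := by
    refine (integrable_const (1 : ℝ)).mono' (by fun_prop) (Eventually.of_forall fun x => ?_)
    rw [norm_exp_I_mul']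
  rw [integral_subordinatedLaw hα hθ t hi]
  have h : ∀ᵐ τ ∂(operationalLaw β t), ∫ x, Complex.exp (Complex.I * κ * x) ∂(parentLaw α θ τ) =
      Complex.exp (-(symbol α θ κ * τ)) := by
    filter_upwards [ae_operationalLaw_pos β ht] with τ hτ
    exact integral_exp_parentLaw hα hα2 hθ hτ κ
  rw [integral_congr_ae h, integral_operationalLaw_scale hβ hβ1 ht, relax, relaxInt]
  simp

/-! ### Superpositions of relaxation functions over frequencies -/

section Mixture

variable {β : ℝ} (hβ : 0 < β) (hβ1 : β ≤ 1) {ψ h : ℝ → ℂ} (hψ : Continuous ψ)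
  (hψ0 : ∀ κ, 0 ≤ (ψ κ).re) (hh : Continuous h)

include hβ hβ1 hψ hψ0

lemma continuous_relax_comp {t : ℝ} (ht : 0 ≤ t) : Continuous fun κ => relax β (ψ κ) t :=
  (continuousOn_relax hβ hβ1).comp_continuous (f := fun κ => (ψ κ, t)) (by fun_prop)
    fun κ => ⟨hψ0 κ, ht⟩

lemma continuous_relaxDeriv_comp {t : ℝ} (ht : 0 < t) : Continuous fun κ => relaxDeriv β (ψ κ) t :=
  (continuousOn_relaxDeriv hβ hβ1).comp_continuous (f := fun κ => (ψ κ, t)) (by fun_prop)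
    fun κ => ⟨hψ0 κ, ht⟩

include hh

lemma continuousOn_integral_mul_relax (hi : Integrable h) :
    ContinuousOn (fun t => ∫ κ, h κ * relax β (ψ κ) t) (Ici 0) := by
  refine continuousOn_of_dominated (bound := fun κ => ‖h κ‖) (fun t ht => ?_) (fun t ht => ?_) hi.norm
    (Eventually.of_forall fun κ => ?_)
  · exact (hh.mul (continuous_relax_comp hβ hβ1 hψ hψ0 ht)).aestronglyMeasurable
  · refine Eventually.of_forall fun κ => ?_
    rw [norm_mul]
    exact mul_le_of_le_one_right (norm_nonneg _) (norm_relax_le hβ hβ1 (hψ0 κ) ht)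
  · exact continuousOn_const.mul (continuousOn_relax_right hβ hβ1 (hψ0 κ))

lemma integrable_mul_relax (hi : Integrable h) {t : ℝ} (ht : 0 ≤ t) :
    Integrable fun κ => h κ * relax β (ψ κ) t := by
  refine hi.norm.mono' (hh.mul (continuous_relax_comp hβ hβ1 hψ hψ0 ht)).aestronglyMeasurable
    (Eventually.of_forall fun κ => ?_)
  rw [norm_mul]
  exact mul_le_of_le_one_right (norm_nonneg _) (norm_relax_le hβ hβ1 (hψ0 κ) ht)

variable (hi' : Integrable fun κ => ‖ψ κ‖ * ‖h κ‖)

include hi'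

lemma hasDerivAt_integral_mul_relax (hi : Integrable h) {t : ℝ} (ht : 0 < t) :
    HasDerivAt (fun t => ∫ κ, h κ * relax β (ψ κ) t) (∫ κ, h κ * relaxDeriv β (ψ κ) t) t := by
  obtain ⟨C, hC0, hC⟩ := exists_norm_relaxDeriv_le hβ hβ1
  refine (hasDerivAt_integral_of_dominated_loc_of_deriv_le (s := Ioi (t / 2))
    (F := fun t κ => h κ * relax β (ψ κ) t) (F' := fun t κ => h κ * relaxDeriv β (ψ κ) t)
    (bound := fun κ => C * (t / 2) ^ (β - 1) * (‖ψ κ‖ * ‖h κ‖)) (Ioi_mem_nhds (by linarith)) ?_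
    (integrable_mul_relax hβ hβ1 hψ hψ0 hh hi ht.le) ?_ (Eventually.of_forall fun κ u hu => ?_)
    (hi'.const_mul _) (Eventually.of_forall fun κ u hu => ?_)).2
  · filter_upwards [Ioi_mem_nhds ht] with u hu
    exact (hh.mul (continuous_relax_comp hβ hβ1 hψ hψ0 (le_of_lt hu))).aestronglyMeasurable
  · exact (hh.mul (continuous_relaxDeriv_comp hβ hβ1 hψ hψ0 ht)).aestronglyMeasurable
  · have hu' : t / 2 < u := hu
    have h1 : u ^ (β - 1) ≤ (t / 2) ^ (β - 1) :=
      Real.rpow_le_rpow_of_nonpos (by linarith) hu'.le (by linarith)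
    rw [norm_mul]
    calc _ ≤ ‖h κ‖ * (C * ‖ψ κ‖ * u ^ (β - 1)) := by
          gcongr; exact hC _ (hψ0 κ) u (by linarith)
      _ ≤ ‖h κ‖ * (C * ‖ψ κ‖ * (t / 2) ^ (β - 1)) := by gcongr
      _ = _ := by ring
  · have hu' : t / 2 < u := hu
    exact (hasDerivAt_relax hβ hβ1 (hψ0 κ) (by linarith)).const_mul _

lemma continuousOn_integral_mul_relaxDeriv :
    ContinuousOn (fun t => ∫ κ, h κ * relaxDeriv β (ψ κ) t) (Ioi 0) := by
  obtain ⟨C, hC0, hC⟩ := exists_norm_relaxDeriv_le hβ hβ1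
  intro t ht
  have ht' : (0 : ℝ) < t := ht
  refine ContinuousAt.continuousWithinAt (continuousAt_of_dominated
    (bound := fun κ => C * (t / 2) ^ (β - 1) * (‖ψ κ‖ * ‖h κ‖)) ?_ ?_ (hi'.const_mul _)
    (Eventually.of_forall fun κ => ?_))
  · filter_upwards [Ioi_mem_nhds ht] with u hu
    exact (hh.mul (continuous_relaxDeriv_comp hβ hβ1 hψ hψ0 hu)).aestronglyMeasurable
  · filter_upwards [Ioi_mem_nhds (show t / 2 < t by linarith)] with u hu
    refine Eventually.of_forall fun κ => ?_
    have hu' : t / 2 < u := hu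
    have h1 : u ^ (β - 1) ≤ (t / 2) ^ (β - 1) :=
      Real.rpow_le_rpow_of_nonpos (by linarith) hu'.le (by linarith)
    rw [norm_mul]
    calc _ ≤ ‖h κ‖ * (C * ‖ψ κ‖ * u ^ (β - 1)) := by
          gcongr; exact hC _ (hψ0 κ) u (by linarith)
      _ ≤ ‖h κ‖ * (C * ‖ψ κ‖ * (t / 2) ^ (β - 1)) := by gcongr
      _ = _ := by ring
  · exact continuousAt_const.mul
      ((continuousOn_relaxDeriv_right hβ hβ1 (hψ0 κ)).continuousAt (Ioi_mem_nhds ht))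

omit hψ hh in
lemma exists_norm_integral_mul_relaxDeriv_le :
    ∃ C, ∀ t, 0 < t → ‖∫ κ, h κ * relaxDeriv β (ψ κ) t‖ ≤ C * t ^ (β - 1) := by
  obtain ⟨C, hC0, hC⟩ := exists_norm_relaxDeriv_le hβ hβ1
  refine ⟨C * ∫ κ, ‖ψ κ‖ * ‖h κ‖, fun t ht => ?_⟩
  rw [mul_right_comm, ← integral_const_mul]
  refine norm_integral_le_of_norm_le (hi'.const_mul _) (Eventually.of_forall fun κ => ?_)
  rw [norm_mul]
  calc _ ≤ ‖h κ‖ * (C * ‖ψ κ‖ * t ^ (β - 1)) := by gcongr; exact hC _ (hψ0 κ) t ht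
    _ = _ := by ring

/-- Fubini on `(0, t] × ℝ`: the bound on `relaxDeriv` majorizes the integrand by the product of `(t
- τ)^{-β} τ^{β-1}` and `‖ψ‖ ‖h‖`, and `caputo_relax` applies frequency by frequency. -/
lemma caputo_integral_mul_relax (hβ2 : β < 1) {t : ℝ} (ht : 0 < t) :
    (((Real.Gamma (1 - β))⁻¹ : ℝ) : ℂ) * ∫ τ in (0 : ℝ)..t, (((t - τ) ^ (-β) : ℝ) : ℂ) *
      ∫ κ, h κ * relaxDeriv β (ψ κ) τ = ∫ κ, -ψ κ * h κ * relax β (ψ κ) t := by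
  obtain ⟨C, hC0, hC⟩ := exists_norm_relaxDeriv_le hβ hβ1
  have hk := intervalIntegrable_sub_rpow_mul_rpow (a := 1 - β) (b := β) (by linarith) hβ ht
  rw [intervalIntegrable_iff_integrableOn_Ioc_of_le ht.le, IntegrableOn] at hk
  have hprod := (hk.mul_prod hi').const_mul C
  have hint : Integrable (Function.uncurry fun (τ κ : ℝ) =>
      (((t - τ) ^ (-β) : ℝ) : ℂ) * (h κ * relaxDeriv β (ψ κ) τ))
      ((volume.restrict (Ioc 0 t)).prod volume) := by
    have hr : (volume.restrict (Ioc 0 t)).prod (volume : Measure ℝ) =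
        ((volume : Measure ℝ).prod volume).restrict (Ioc 0 t ×ˢ univ) := by
      rw [← Measure.prod_restrict, Measure.restrict_univ]
    refine hprod.mono' ?_ ?_
    · refine AEStronglyMeasurable.mul (by fun_prop : Measurable fun p : ℝ × ℝ =>
        (((t - p.1) ^ (-β) : ℝ) : ℂ)).aestronglyMeasurable ?_
      rw [hr]
      refine ContinuousOn.aestronglyMeasurable ?_ (measurableSet_Ioc.prod MeasurableSet.univ)
      refine (hh.comp continuous_snd).continuousOn.mul ?_
      exact (continuousOn_relaxDeriv hβ hβ1).comp (f := fun p : ℝ × ℝ => (ψ p.2, p.1))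
        (by fun_prop) fun p hp => ⟨hψ0 _, hp.1.1⟩
    · rw [hr]
      filter_upwards [self_mem_ae_restrict (measurableSet_Ioc.prod MeasurableSet.univ)] with p hp
      have h1 := Real.rpow_nonneg (sub_nonneg.2 hp.1.2) (-β)
      have e : (1 - β - 1 : ℝ) = -β := by ring
      rw [e]
      simp only [Function.uncurry]
      rw [norm_mul, norm_mul, Complex.norm_real, Real.norm_of_nonneg h1]
      calc _ ≤ (t - p.1) ^ (-β) * (‖h p.2‖ * (C * ‖ψ p.2‖ * p.1 ^ (β - 1))) := by
            gcongr; exact hC _ (hψ0 _) _ hp.1.1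
        _ = _ := by ring
  simp_rw [← integral_const_mul]
  rw [intervalIntegral.integral_of_le ht.le, integral_integral_swap hint, ← integral_const_mul]
  refine integral_congr_ae (Eventually.of_forall fun κ => ?_)
  have h1 := caputo_relax hβ hβ2 (hψ0 κ) ht
  rw [intervalIntegral.integral_of_le ht.le] at h1
  simp_rw [mul_left_comm _ (h κ)]
  rw [integral_const_mul, mul_left_comm, h1]
  ring

end Mixture

/-! ### Caputo regularity and Fourier transforms of Schwartz functions -/

/-- The growth `t^{β-1}` of the derivative at `0` is what the Beta integral tolerates, with or
without the Caputo kernel. -/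
lemma caputoRegular_of_hasDerivAt {β : ℝ} (hβ : 0 < β) {g g' : ℝ → ℂ}
    (hc : ContinuousOn g (Ici 0)) (hd : ∀ t, 0 < t → HasDerivAt g (g' t) t)
    (hg' : ContinuousOn g' (Ioi 0)) {C : ℝ} (hC : ∀ t, 0 < t → ‖g' t‖ ≤ C * t ^ (β - 1)) :
    CaputoRegular β g := by
  have e : ∀ {t : ℝ} (k : ℝ → ℂ), 0 < t →
      EqOn (fun τ => k τ * g' τ) (fun τ => k τ * deriv g τ) (uIoc 0 t) := by
    intro t k ht τ hτ
    rw [uIoc_of_le ht.le] at hτ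
    simp only [(hd τ hτ.1).deriv]
  refine ⟨hc, fun t ht => (hd t ht).differentiableAt, fun t ht => ?_, fun hβ1 t ht => ?_⟩
  · have := (intervalIntegrable_sub_rpow_mul hg' one_pos hβ hC ht).congr (e _ ht)
    simpa using this
  · have := (intervalIntegrable_sub_rpow_mul hg' (a := 1 - β) (by linarith) hβ hC ht).congr (e _ ht)
    simpa using this

lemma caputoDeriv_of_hasDerivAt (β : ℝ) {g g' : ℝ → ℂ} (hd : ∀ t, 0 < t → HasDerivAt g (g' t) t)
    {t : ℝ} (ht : 0 < t) : caputoDeriv β g t = if β = 1 then g' t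
      else (((Real.Gamma (1 - β))⁻¹ : ℝ) : ℂ) *
        ∫ τ in (0 : ℝ)..t, (((t - τ) ^ (-β) : ℝ) : ℂ) * g' τ := by
  rw [caputoDeriv, (hd t ht).deriv]
  congr 2
  refine intervalIntegral.integral_congr_ae (Eventually.of_forall fun τ hτ => ?_)
  rw [uIoc_of_le ht.le] at hτ
  rw [(hd τ hτ.1).deriv]

lemma abs_rpow_le_one_add_sq {α : ℝ} (hα : 0 ≤ α) (hα2 : α ≤ 2) (x : ℝ) : |x| ^ α ≤ 1 + x ^ 2 := by
  rcases le_total |x| 1 with h | h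
  · have := Real.rpow_le_one (abs_nonneg x) h hα
    nlinarith [sq_nonneg x]
  · have := Real.rpow_le_rpow_of_exponent_le h hα2
    rw [Real.rpow_two, sq_abs] at this
    linarith

section Schwartz

variable (φ : 𝓢(ℝ, ℂ))

lemma fourierPlus_schwartz (κ : ℝ) :
    fourierPlus φ κ = (FourierTransformInv.fourierInv φ : 𝓢(ℝ, ℂ)) (κ / (2 * Real.pi)) := by
  rw [fourierPlus_eq_fourierInv, SchwartzMap.fourierInv_coe]

lemma continuous_fourierPlus_schwartz : Continuous (fourierPlus φ) :=
  continuous_fourierPlus φ.integrable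

lemma integrable_fourierPlus_schwartz : Integrable (fourierPlus φ) := by
  rw [show fourierPlus φ = _ from funext (fourierPlus_schwartz φ)]
  exact (SchwartzMap.integrable _).comp_div (by positivity)

lemma integrable_sq_mul_fourierPlus_schwartz : Integrable fun κ => κ ^ 2 * ‖fourierPlus φ κ‖ := by
  have h := (SchwartzMap.integrable_pow_mul volume
    (FourierTransformInv.fourierInv φ : 𝓢(ℝ, ℂ)) 2).comp_div (R := 2 * Real.pi) (by positivity)
  refine (h.const_mul ((2 * Real.pi) ^ 2)).congr (Eventually.of_forall fun κ => ?_)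
  have hπ := Real.pi_pos
  simp only [fourierPlus_schwartz, Real.norm_eq_abs, sq_abs]
  field_simp

lemma integrable_symbol_mul_fourierPlus_schwartz {α : ℝ} (hα : 0 < α) (hα2 : α ≤ 2) (θ : ℝ) :
    Integrable fun κ => ‖symbol α θ κ‖ * ‖fourierPlus φ κ‖ := by
  refine ((integrable_fourierPlus_schwartz φ).norm.add
    (integrable_sq_mul_fourierPlus_schwartz φ)).mono' ?_ (Eventually.of_forall fun κ => ?_)
  · exact ((continuous_symbol hα θ).norm.mul
      (continuous_fourierPlus_schwartz φ).norm).aestronglyMeasurable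
  · rw [Real.norm_of_nonneg (by positivity), norm_symbol]
    have := mul_le_mul_of_nonneg_right (abs_rpow_le_one_add_sq hα.le hα2 κ)
      (norm_nonneg (fourierPlus φ κ))
    simp only [Pi.add_apply]
    linarith

lemma fourierPlusInv_fourierPlus_schwartz (x : ℝ) : fourierPlusInv (fourierPlus φ) x = φ x :=
  fourierPlusInv_fourierPlus φ.integrable (integrable_fourierPlus_schwartz φ) φ.continuous.continuousAt

end Schwartz

/-! ### Existence -/

/-- Parseval's identity for the integral of an inverse Fourier transform against a finite measure. -/
lemma integral_fourierPlusInv {ν : Measure ℝ} [IsFiniteMeasure ν] {h : ℝ → ℂ} (hh : Integrable h) :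
    ∫ x, fourierPlusInv h x ∂ν = (2 * (Real.pi : ℂ))⁻¹ *
      ∫ κ, h κ * ∫ x, Complex.exp (Complex.I * (-κ : ℝ) * x) ∂ν := by
  have hm : AEStronglyMeasurable (fun p : ℝ × ℝ => Complex.exp (-(Complex.I * p.2 * p.1)) * h p.2)
      (ν.prod volume) :=
    (by fun_prop : Measurable fun p : ℝ × ℝ => Complex.exp (-(Complex.I * p.2 * p.1))).aestronglyMeasurable.mul
      hh.1.comp_snd
  have hint : Integrable (Function.uncurry fun (x κ : ℝ) => Complex.exp (-(Complex.I * κ * x)) * h κ)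
      (ν.prod volume) := by
    refine ((integrable_const (1 : ℝ)).mul_prod hh.norm).mono' hm (Eventually.of_forall fun p => ?_)
    rw [Function.uncurry, norm_mul, norm_exp_I_mul]
  simp only [fourierPlusInv]
  rw [integral_const_mul, integral_integral_swap hint]
  congr 1
  refine integral_congr_ae (Eventually.of_forall fun κ => ?_)
  simp only
  rw [integral_mul_const, mul_comm]
  congr 2
  funext x
  congr 1; push_cast; ring

/-- Parseval evaluates the characteristic function at `-κ`, which reverses the skewness; this
matches the transposed operator in the weak equation. -/
lemma integral_fourierPlusInv_subordinatedLaw {α θ β : ℝ} (hα : 0 < α) (hα2 : α ≤ 2)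
    (hθ : |θ| ≤ min α (2 - α)) (hβ : 0 < β) (hβ1 : β ≤ 1) {t : ℝ} (ht : 0 < t) {h : ℝ → ℂ}
    (hh : Integrable h) : ∫ x, fourierPlusInv h x ∂(subordinatedLaw α θ β t) =
      (2 * (Real.pi : ℂ))⁻¹ * ∫ κ, h κ * relax β (symbol α (-θ) κ) t := by
  have := isProbabilityMeasure_subordinatedLaw hα hα2 hθ hβ hβ1 ht
  rw [integral_fourierPlusInv hh]
  simp_rw [integral_exp_subordinatedLaw hα hα2 hθ hβ hβ1 ht, symbol_neg_arg]

lemma eq_toSignedMeasure {μ : SignedMeasure ℝ} {ν : Measure ℝ} [IsFiniteMeasure ν]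
    (h : ∀ A, MeasurableSet A → μ A = ν.real A) : μ = ν.toSignedMeasure := by
  ext A hA
  rw [h A hA, Measure.toSignedMeasure_apply_measurable hA]

/-- By Parseval each pairing is a superposition of relaxation functions weighted by the transform of
`φ`. This transform remains integrable after multiplication by the symbol, so regularity and the
equation follow from the single-frequency statements. -/
theorem isFundamentalSolution_of_eq_subordinatedLaw {α θ β : ℝ} (hα : 0 < α) (hα2 : α ≤ 2)
    (hθ : |θ| ≤ min α (2 - α)) (hβ : 0 < β) (hβ1 : β ≤ 1) {μ : ℝ → SignedMeasure ℝ}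
    (hμ : ∀ t, 0 < t → ∀ A, MeasurableSet A → μ t A = (subordinatedLaw α θ β t).real A) :
    IsFundamentalSolution α θ β μ := by
  have hint : ∀ t, 0 < t → ∀ f : ℝ → ℂ, ∫ᵛ x, f x ∂<•(μ t) = ∫ x, f x ∂(subordinatedLaw α θ β t) := by
    intro t ht f
    have := isProbabilityMeasure_subordinatedLaw hα hα2 hθ hβ hβ1 ht
    rw [eq_toSignedMeasure (hμ t ht), VectorMeasure.integral_toSignedMeasure]
  have hψ := continuous_symbol hα (-θ)
  have hψ0 : ∀ κ, 0 ≤ (symbol α (-θ) κ).re :=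
    re_symbol_nonneg hα (by rw [abs_neg]; exact abs_le_one_of_le_min hθ)
  set G : 𝓢(ℝ, ℂ) → ℝ → ℂ := fun φ t =>
    (2 * (Real.pi : ℂ))⁻¹ * ∫ κ, fourierPlus φ κ * relax β (symbol α (-θ) κ) t with hG
  set G' : 𝓢(ℝ, ℂ) → ℝ → ℂ := fun φ t =>
    (2 * (Real.pi : ℂ))⁻¹ * ∫ κ, fourierPlus φ κ * relaxDeriv β (symbol α (-θ) κ) t with hG'
  have hpair : ∀ φ : 𝓢(ℝ, ℂ), ∀ t, 0 ≤ t → pairing μ φ t = G φ t := by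
    intro φ t ht
    rcases ht.eq_or_lt with rfl | ht
    · rw [pairing, if_pos le_rfl, hG, ← fourierPlusInv_fourierPlus_schwartz, fourierPlusInv]
      simp [relax_zero_right hβ hβ1]
    · rw [pairing, if_neg ht.not_ge, hint t ht]
      have h1 := integral_fourierPlusInv_subordinatedLaw hα hα2 hθ hβ hβ1 ht
        (integrable_fourierPlus_schwartz φ)
      simp_rw [fourierPlusInv_fourierPlus_schwartz] at h1
      exact h1
  have hderiv : ∀ φ : 𝓢(ℝ, ℂ), ∀ t, 0 < t → HasDerivAt (pairing μ φ) (G' φ t) t := by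
    intro φ t ht
    have h := (hasDerivAt_integral_mul_relax hβ hβ1 hψ hψ0 (continuous_fourierPlus_schwartz φ)
      (integrable_symbol_mul_fourierPlus_schwartz φ hα hα2 (-θ))
      (integrable_fourierPlus_schwartz φ) ht).const_mul (2 * (Real.pi : ℂ))⁻¹
    refine h.congr_of_eventuallyEq ?_
    filter_upwards [Ioi_mem_nhds ht] with u hu
    exact hpair φ u (le_of_lt hu)
  refine ⟨fun T _ => ⟨1, fun t ht => ?_⟩, fun φ => ?_, fun φ t ht => ?_⟩
  · have := isProbabilityMeasure_subordinatedLaw hα hα2 hθ hβ hβ1 ht.1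
    rw [eq_toSignedMeasure (hμ t ht.1), Measure.variation_toSignedMeasure, measure_univ]
    simp
  · obtain ⟨C, hC⟩ := exists_norm_integral_mul_relaxDeriv_le hβ hβ1 hψ0
      (integrable_symbol_mul_fourierPlus_schwartz φ hα hα2 (-θ))
    refine caputoRegular_of_hasDerivAt hβ (g' := G' φ) (C := ‖(2 * (Real.pi : ℂ))⁻¹‖ * C) ?_ (hderiv φ)
      ?_ fun t ht => ?_
    · exact (continuousOn_const.mul (continuousOn_integral_mul_relax hβ hβ1 hψ hψ0
        (continuous_fourierPlus_schwartz φ) (integrable_fourierPlus_schwartz φ))).congr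
        fun t ht => hpair φ t ht
    · exact continuousOn_const.mul (continuousOn_integral_mul_relaxDeriv hβ hβ1 hψ hψ0
        (continuous_fourierPlus_schwartz φ)
        (integrable_symbol_mul_fourierPlus_schwartz φ hα hα2 (-θ)))
    · rw [hG', norm_mul, mul_assoc]
      exact mul_le_mul_of_nonneg_left (hC t ht) (norm_nonneg _)
  · have hi : Integrable fun κ => -symbol α (-θ) κ * fourierPlus φ κ := by
      refine (integrable_symbol_mul_fourierPlus_schwartz φ hα hα2 (-θ)).mono' ?_
        (Eventually.of_forall fun κ => ?_)
      · exact (hψ.neg.mul (continuous_fourierPlus_schwartz φ)).aestronglyMeasurable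
      · rw [norm_mul, norm_neg]
    rw [caputoDeriv_of_hasDerivAt β (hderiv φ) ht, hint t ht]
    simp only [rieszFeller]
    rw [integral_fourierPlusInv_subordinatedLaw hα hα2 hθ hβ hβ1 ht hi]
    split_ifs with hβ2
    · subst hβ2
      simp only [hG']
      congr 1
      refine integral_congr_ae (Eventually.of_forall fun κ => ?_)
      simp only [relaxDeriv_one]
      ring
    · rw [← caputo_integral_mul_relax hβ hβ1 hψ hψ0 (continuous_fourierPlus_schwartz φ)
        (integrable_symbol_mul_fourierPlus_schwartz φ hα hα2 (-θ)) (lt_of_le_of_ne hβ1 hβ2) ht]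
      simp_rw [hG', mul_left_comm _ ((2 * (Real.pi : ℂ))⁻¹)]
      rw [intervalIntegral.integral_const_mul]
      ring

/-! ### Integration against signed measures -/

section Signed

variable (m : SignedMeasure ℝ)

lemma integral_signedMeasure_eq_sub {f : ℝ → ℂ} (hp : Integrable f m.toJordanDecomposition.posPart)
    (hn : Integrable f m.toJordanDecomposition.negPart) :
    ∫ᵛ x, f x ∂<•m = ∫ x, f x ∂m.toJordanDecomposition.posPart -
      ∫ x, f x ∂m.toJordanDecomposition.negPart := by
  have h := m.toSignedMeasure_toJordanDecomposition
  conv_lhs => rw [← h, JordanDecomposition.toSignedMeasure]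
  rw [VectorMeasure.integral_sub_vectorMeasure, VectorMeasure.integral_toSignedMeasure,
    VectorMeasure.integral_toSignedMeasure]
  · rwa [VectorMeasure.Integrable, Measure.variation_toSignedMeasure]
  · rwa [VectorMeasure.Integrable, Measure.variation_toSignedMeasure]

lemma real_posPart_add_real_negPart : m.toJordanDecomposition.posPart.real univ +
    m.toJordanDecomposition.negPart.real univ = (m.variation univ).toReal := by
  rw [← SignedMeasure.totalVariation_eq_variation, SignedMeasure.totalVariation, Measure.add_apply,
    ENNReal.toReal_add (measure_ne_top _ _) (measure_ne_top _ _)]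
  rfl

lemma integrable_of_continuous_of_norm_le {ν : Measure ℝ} [IsFiniteMeasure ν] {f : ℝ → ℂ}
    (hf : Continuous f) {M : ℝ} (hM : ∀ x, ‖f x‖ ≤ M) : Integrable f ν :=
  (integrable_const M).mono' hf.aestronglyMeasurable (Eventually.of_forall hM)

lemma norm_integral_signedMeasure_le {f : ℝ → ℂ} (hf : Continuous f) {M : ℝ}
    (hM : ∀ x, ‖f x‖ ≤ M) : ‖∫ᵛ x, f x ∂<•m‖ ≤ M * (m.variation univ).toReal := by
  rw [integral_signedMeasure_eq_sub m (integrable_of_continuous_of_norm_le hf hM)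
    (integrable_of_continuous_of_norm_le hf hM), ← real_posPart_add_real_negPart, mul_add]
  exact (norm_sub_le _ _).trans (add_le_add
    (norm_integral_le_of_norm_le_const (Eventually.of_forall hM))
    (norm_integral_le_of_norm_le_const (Eventually.of_forall hM)))

lemma tendsto_integral_signedMeasure {f : ℕ → ℝ → ℂ} {g : ℝ → ℂ} (hf : ∀ n, Continuous (f n))
    (hg : Continuous g) {M : ℝ} (hM : ∀ n x, ‖f n x‖ ≤ M)
    (h : ∀ x, Tendsto (fun n => f n x) atTop (𝓝 (g x))) :
    Tendsto (fun n => ∫ᵛ x, f n x ∂<•m) atTop (𝓝 (∫ᵛ x, g x ∂<•m)) := by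
  have hgM : ∀ x, ‖g x‖ ≤ M := fun x => le_of_tendsto' (h x).norm fun n => hM n x
  have key : ∀ ν : Measure ℝ, IsFiniteMeasure ν →
      Tendsto (fun n => ∫ x, f n x ∂ν) atTop (𝓝 (∫ x, g x ∂ν)) := fun ν _ =>
    tendsto_integral_of_dominated_convergence (fun _ => M) (fun n => (hf n).aestronglyMeasurable)
      (integrable_const M) (fun n => Eventually.of_forall (hM n)) (Eventually.of_forall h)
  have e : ∀ n, ∫ᵛ x, f n x ∂<•m = _ := fun n => integral_signedMeasure_eq_sub m
    (integrable_of_continuous_of_norm_le (hf n) (hM n))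
    (integrable_of_continuous_of_norm_le (hf n) (hM n))
  simp_rw [e]
  rw [integral_signedMeasure_eq_sub m (integrable_of_continuous_of_norm_le hg hgM)
    (integrable_of_continuous_of_norm_le hg hgM)]
  exact (key _ inferInstance).sub (key _ inferInstance)

/-- A signed measure with the same characteristic function as a finite measure is equal to it. -/
lemma signedMeasure_eq_of_integral_exp_eq {ν : Measure ℝ} [IsFiniteMeasure ν]
    (h : ∀ κ : ℝ, ∫ᵛ x, Complex.exp (Complex.I * κ * x) ∂<•m =
      ∫ x, Complex.exp (Complex.I * κ * x) ∂ν) {A : Set ℝ} (hA : MeasurableSet A) :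
    m A = ν.real A := by
  have hi : ∀ (ρ : Measure ℝ) [IsFiniteMeasure ρ] (κ : ℝ),
      Integrable (fun x : ℝ => Complex.exp (Complex.I * κ * x)) ρ := fun ρ _ κ =>
    integrable_of_continuous_of_norm_le (by fun_prop) (M := 1) fun x => (norm_exp_I_mul' κ x).le
  -- Moving the negative part to the other side leaves finite positive measures, which
  -- characteristic functions determine.
  have h1 : m.toJordanDecomposition.posPart = ν + m.toJordanDecomposition.negPart := by
    refine Measure.ext_of_charFun (funext fun κ => ?_)
    have e : ∀ x : ℝ, Complex.exp (κ * x * Complex.I) = Complex.exp (Complex.I * κ * x) := by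
      intro x; congr 1; ring
    have h2 := h κ
    rw [integral_signedMeasure_eq_sub m (hi _ κ) (hi _ κ)] at h2
    rw [charFun_apply_real, charFun_apply_real]
    simp_rw [e]
    rw [integral_add_measure (hi _ κ) (hi _ κ), ← h2, sub_add_cancel]
  conv_lhs => rw [← m.toSignedMeasure_toJordanDecomposition, JordanDecomposition.toSignedMeasure]
  rw [Measure.toSignedMeasure_sub_apply hA, h1, measureReal_add_apply, add_sub_cancel_right]

end Signed

/-! ### Inversion of the Caputo derivative and the Abel–Volterra equation -/

lemma integral_Ioc_sub_rpow_mul_sub_rpow {β τ t : ℝ} (hβ : 0 < β) (hβ1 : β < 1) (hτ : τ < t) :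
    IntegrableOn (fun s => (t - s) ^ (β - 1) * (s - τ) ^ (-β)) (Ioc τ t) ∧
    ∫ s in Ioc τ t, (t - s) ^ (β - 1) * (s - τ) ^ (-β) = Real.Gamma β * Real.Gamma (1 - β) := by
  have h0 : 0 < t - τ := sub_pos.2 hτ
  have h1 := intervalIntegrable_sub_rpow_mul_rpow hβ (b := 1 - β) (by linarith) h0
  have h2 := integral_sub_rpow_mul_rpow hβ (b := 1 - β) (by linarith) h0
  have e : ∀ s : ℝ, (t - s) ^ (β - 1) * (s - τ) ^ (-β) =
      (fun u => (t - τ - u) ^ (β - 1) * u ^ (1 - β - 1)) (s - τ) := by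
    intro s
    simp only
    congr 2 <;> ring
  simp_rw [e]
  constructor
  · have := h1.comp_sub_right τ
    rw [zero_add, sub_add_cancel, intervalIntegrable_iff_integrableOn_Ioc_of_le hτ.le] at this
    exact this
  · rw [← intervalIntegral.integral_of_le hτ.le,
      intervalIntegral.integral_comp_sub_right (fun u => (t - τ - u) ^ (β - 1) * u ^ (1 - β - 1)),
      sub_self, h2]
    simp

/-- The fractional integral of order `β` inverts the Caputo derivative. -/
lemma integral_sub_rpow_mul_caputoDeriv {β : ℝ} (hβ : 0 < β) (hβ1 : β ≤ 1) {g r : ℝ → ℂ}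
    (hg : CaputoRegular β g) (hr : ∀ s, 0 < s → caputoDeriv β g s = r s) {t : ℝ} (ht : 0 < t) :
    IntervalIntegrable (fun s => (((t - s) ^ (β - 1) : ℝ) : ℂ) * r s) volume 0 t ∧
    ∫ s in (0 : ℝ)..t, (((t - s) ^ (β - 1) : ℝ) : ℂ) * r s = Real.Gamma β * (g t - g 0) := by
  have hgi := hg.integrable_deriv t ht
  have hftc : ∫ s in (0 : ℝ)..t, deriv g s = g t - g 0 :=
    intervalIntegral.integral_eq_sub_of_hasDerivAt_of_le ht.le
      (hg.continuousOn.mono Icc_subset_Ici_self)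
      (fun s hs => (hg.differentiableAt s hs.1).hasDerivAt) hgi
  rcases hβ1.eq_or_lt with rfl | hβ1
  · have e : ∀ s ∈ uIoc 0 t, deriv g s = (((t - s) ^ ((1 : ℝ) - 1) : ℝ) : ℂ) * r s := by
      intro s hs
      rw [uIoc_of_le ht.le] at hs
      rw [← hr s hs.1, caputoDeriv, if_pos rfl]
      simp
    refine ⟨hgi.congr e, ?_⟩
    rw [Real.Gamma_one, Complex.ofReal_one, one_mul, ← hftc]
    exact (intervalIntegral.integral_congr_ae (Eventually.of_forall e)).symm
  · have hΓ := (Real.Gamma_pos_of_pos (show 0 < 1 - β by linarith)).ne'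
    have hΓc : (Real.Gamma (1 - β) : ℂ) ≠ 0 := by exact_mod_cast hΓ
    rw [intervalIntegrable_iff_integrableOn_Ioc_of_le ht.le] at hgi ⊢
    set μ : Measure ℝ := volume.restrict (Ioc 0 t) with hμ
    -- The composed kernel, cut off to the triangle `τ < s`. Its integral in `s` is `Γ(β) Γ(1 - β)`
    -- for every `τ` in `(0, t)`, so Fubini needs only the integrability of `g'` and leaves a
    -- multiple of `∫ g'`.
    set k : ℝ → ℝ → ℝ := fun s τ => (Ioi τ).indicator (fun s => (t - s) ^ (β - 1) * (s - τ) ^ (-β)) s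
      with hk
    have hkm : Measurable fun p : ℝ × ℝ => k p.1 p.2 := by
      have : (fun p : ℝ × ℝ => k p.1 p.2) = {p : ℝ × ℝ | p.2 < p.1}.indicator
          fun p => (t - p.1) ^ (β - 1) * (p.1 - p.2) ^ (-β) := by
        funext p
        simp only [hk, indicator, mem_Ioi, mem_ofPred_eq]
      rw [this]
      exact Measurable.indicator (by fun_prop) (measurableSet_lt measurable_snd measurable_fst)
    have hk0 : ∀ᵐ τ ∂μ, ∀ᵐ s ∂μ, 0 ≤ k s τ := by
      refine Eventually.of_forall fun τ => ?_
      filter_upwards [self_mem_ae_restrict measurableSet_Ioc] with s hs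
      refine indicator_apply_nonneg fun hs' => ?_
      exact mul_nonneg (Real.rpow_nonneg (sub_nonneg.2 hs.2) _)
        (Real.rpow_nonneg (sub_nonneg.2 (le_of_lt hs')) _)
    have hset : ∀ {τ : ℝ}, 0 < τ → Ioc 0 t ∩ Ioi τ = Ioc τ t := by
      intro τ hτ
      ext s; simp only [mem_inter_iff, mem_Ioc, mem_Ioi]
      constructor
      · rintro ⟨⟨_, h⟩, h'⟩; exact ⟨h', h⟩
      · rintro ⟨h, h'⟩; exact ⟨⟨hτ.trans h, h'⟩, h⟩
    have hkint : ∀ᵐ τ ∂μ, Integrable (fun s => k s τ) μ ∧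
        ∫ s, k s τ ∂μ = Real.Gamma β * Real.Gamma (1 - β) := by
      -- The endpoint `τ = t`, where the Beta integral degenerates, is discarded as a null set.
      rw [hμ, Measure.restrict_congr_set Ioo_ae_eq_Ioc.symm]
      filter_upwards [self_mem_ae_restrict measurableSet_Ioo] with τ hτ
      obtain ⟨h1, h2⟩ := integral_Ioc_sub_rpow_mul_sub_rpow hβ hβ1 hτ.2
      rw [Measure.restrict_congr_set Ioo_ae_eq_Ioc, hk]
      constructor
      · rw [integrable_indicator_iff measurableSet_Ioi, IntegrableOn,
          Measure.restrict_restrict measurableSet_Ioi, inter_comm, hset hτ.1]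
        exact h1
      · rw [integral_indicator measurableSet_Ioi, Measure.restrict_restrict measurableSet_Ioi,
          inter_comm, hset hτ.1, h2]
    have hint : Integrable (Function.uncurry fun (s τ : ℝ) => (k s τ : ℂ) * deriv g τ) (μ.prod μ) := by
      have hm : Measurable (Function.uncurry fun (s τ : ℝ) => (k s τ : ℂ) * deriv g τ) := by
        have : Measurable fun p : ℝ × ℝ => deriv g p.2 := (measurable_deriv g).comp measurable_snd
        exact (Complex.measurable_ofReal.comp hkm).mul this
      rw [integrable_prod_iff' hm.aestronglyMeasurable]
      constructor
      · filter_upwards [hkint] with τ hτ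
        exact (hτ.1.ofReal (𝕜 := ℂ)).mul_const (deriv g τ)
      · refine (hgi.norm.const_mul (Real.Gamma β * Real.Gamma (1 - β))).congr ?_
        filter_upwards [hkint, hk0] with τ hτ hτ0
        rw [← hτ.2, ← integral_mul_const]
        refine integral_congr_ae ?_
        filter_upwards [hτ0] with s hs
        simp only [Function.uncurry]
        rw [norm_mul, Complex.norm_real, Real.norm_of_nonneg hs]
    have hL : ∀ s ∈ Ioc 0 t, ∫ τ, (k s τ : ℂ) * deriv g τ ∂μ =
        Real.Gamma (1 - β) * ((((t - s) ^ (β - 1) : ℝ) : ℂ) * r s) := by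
      intro s hs
      have e1 : ∀ τ, (k s τ : ℂ) * deriv g τ = (Iio s).indicator (fun τ =>
          (((t - s) ^ (β - 1) : ℝ) : ℂ) * ((((s - τ) ^ (-β) : ℝ) : ℂ) * deriv g τ)) τ := by
        intro τ
        simp only [hk, indicator, mem_Ioi, mem_Iio]
        split_ifs
        · push_cast; ring
        · simp
      have e2 : Iio s ∩ Ioc 0 t = Ioo 0 s := by
        ext τ; simp only [mem_inter_iff, mem_Ioc, mem_Iio, mem_Ioo]
        constructor
        · rintro ⟨h, h', _⟩; exact ⟨h', h⟩
        · rintro ⟨h, h'⟩; exact ⟨h', h, h'.le.trans hs.2⟩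
      simp_rw [e1]
      rw [integral_indicator measurableSet_Iio, hμ, Measure.restrict_restrict measurableSet_Iio, e2,
        Measure.restrict_congr_set Ioo_ae_eq_Ioc, ← intervalIntegral.integral_of_le hs.1.le,
        intervalIntegral.integral_const_mul, ← hr s hs.1, caputoDeriv, if_neg hβ1.ne,
        Complex.ofReal_inv, mul_left_comm, mul_inv_cancel_left₀ hΓc]
    have hI := hint.integral_prod_left
    have hI2 : IntegrableOn (fun s => Real.Gamma (1 - β) * ((((t - s) ^ (β - 1) : ℝ) : ℂ) * r s))
        (Ioc 0 t) := by
      refine hI.congr ?_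
      filter_upwards [self_mem_ae_restrict measurableSet_Ioc] with s hs
      exact hL s hs
    refine ⟨?_, ?_⟩
    · refine (hI2.const_mul (Real.Gamma (1 - β) : ℂ)⁻¹).congr (Eventually.of_forall fun s => ?_)
      exact inv_mul_cancel_left₀ hΓc _
    · have hsw := integral_integral_swap hint
      rw [hμ, setIntegral_congr_fun measurableSet_Ioc hL, integral_const_mul, ← hμ] at hsw
      have hR : ∫ τ, ∫ s, (k s τ : ℂ) * deriv g τ ∂μ ∂μ =
          Real.Gamma (1 - β) * (Real.Gamma β * (g t - g 0)) := by
        rw [← hftc, intervalIntegral.integral_of_le ht.le, ← integral_const_mul, ← integral_const_mul]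
        refine integral_congr_ae ?_
        filter_upwards [hkint] with τ hτ
        rw [integral_mul_const, integral_complex_ofReal, hτ.2]
        push_cast; ring
      rw [hR] at hsw
      rw [intervalIntegral.integral_of_le ht.le]
      exact mul_left_cancel₀ hΓc hsw

lemma integral_sub_rpow_mul_exp_le {β k t : ℝ} (hβ : 0 < β) (hk : 0 < k) (ht : 0 < t) :
    IntervalIntegrable (fun s => (t - s) ^ (β - 1) * Real.exp (k * s)) volume 0 t ∧
    ∫ s in (0 : ℝ)..t, (t - s) ^ (β - 1) * Real.exp (k * s) ≤
      Real.exp (k * t) * ((1 / k) ^ β * Real.Gamma β) := by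
  have hi := integrableOn_rpow_mul_exp_neg hβ hk
  have hi' : IntervalIntegrable (fun u => Real.exp (k * t) * (u ^ (β - 1) * Real.exp (-(k * u))))
      volume 0 t := by
    rw [intervalIntegrable_iff_integrableOn_Ioc_of_le ht.le]
    exact (hi.mono_set Ioc_subset_Ioi_self).const_mul _
  have e : ∀ s : ℝ, (t - s) ^ (β - 1) * Real.exp (k * s) =
      (fun u => Real.exp (k * t) * (u ^ (β - 1) * Real.exp (-(k * u)))) (t - s) := by
    intro s
    simp only
    rw [mul_left_comm, ← Real.exp_add]
    congr 2; ring
  simp_rw [e]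
  constructor
  · have := (hi'.comp_sub_left t).symm
    simpa using this
  · rw [intervalIntegral.integral_comp_sub_left
      (fun u => Real.exp (k * t) * (u ^ (β - 1) * Real.exp (-(k * u)))), sub_self, sub_zero,
      intervalIntegral.integral_const_mul, ← Real.integral_rpow_mul_exp_neg_mul_Ioi hβ hk,
      intervalIntegral.integral_of_le ht.le]
    refine mul_le_mul_of_nonneg_left (setIntegral_mono_set hi ?_ Ioc_subset_Ioi_self.eventuallyLE)
      (Real.exp_pos _).le
    filter_upwards [self_mem_ae_restrict measurableSet_Ioi] with u hu
    exact mul_nonneg (Real.rpow_nonneg (le_of_lt hu) _) (Real.exp_pos _).le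

/-- A bounded solution of a homogeneous Abel–Volterra equation vanishes. -/
lemma eq_zero_of_volterra {β : ℝ} (hβ : 0 < β) {c : ℂ} {d : ℝ → ℂ} {T B : ℝ}
    (hB : ∀ t ∈ Ioc 0 T, ‖d t‖ ≤ B)
    (h : ∀ t ∈ Ioc 0 T, Real.Gamma β * d t =
      c * ∫ s in (0 : ℝ)..t, (((t - s) ^ (β - 1) : ℝ) : ℂ) * d s) {t : ℝ} (ht : t ∈ Ioc 0 T) :
    d t = 0 := by
  have hB0 : 0 ≤ B := (norm_nonneg _).trans (hB t ht)
  have hΓ := Real.Gamma_pos_of_pos hβ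
  -- Chosen so that `‖c‖ (1/k)^β ≤ 1/2`: in the norm with weight `e^{-kt}` the Volterra operator
  -- contracts by `1/2`, and iterating the bound gives zero.
  set k : ℝ := (2 * ‖c‖ + 1) ^ (1 / β) with hk
  have hk0 : 0 < k := by positivity
  have hkβ : (1 / k) ^ β = (2 * ‖c‖ + 1)⁻¹ := by
    rw [Real.div_rpow zero_le_one hk0.le, Real.one_rpow, hk, ← Real.rpow_mul (by positivity),
      one_div_mul_cancel hβ.ne', Real.rpow_one, one_div]
  have key : ∀ n : ℕ, ∀ t ∈ Ioc 0 T, ‖d t‖ ≤ B * (1 / 2) ^ n * Real.exp (k * t) := by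
    intro n
    induction n with
    | zero =>
      intro t ht
      have h1 : 1 ≤ Real.exp (k * t) := Real.one_le_exp (mul_nonneg hk0.le ht.1.le)
      have := hB t ht
      nlinarith
    | succ n ih =>
      intro t ht
      obtain ⟨hi, hle⟩ := integral_sub_rpow_mul_exp_le hβ hk0 ht.1
      have h1 : ‖∫ s in (0 : ℝ)..t, (((t - s) ^ (β - 1) : ℝ) : ℂ) * d s‖ ≤
          ∫ s in (0 : ℝ)..t, B * (1 / 2) ^ n * ((t - s) ^ (β - 1) * Real.exp (k * s)) := by
        refine intervalIntegral.norm_integral_le_of_norm_le ht.1.le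
          (Eventually.of_forall fun s hs => ?_) (hi.const_mul _)
        have h2 := Real.rpow_nonneg (sub_nonneg.2 hs.2) (β - 1)
        rw [norm_mul, Complex.norm_real, Real.norm_of_nonneg h2]
        calc _ ≤ (t - s) ^ (β - 1) * (B * (1 / 2) ^ n * Real.exp (k * s)) := by
              gcongr; exact ih s ⟨hs.1, hs.2.trans ht.2⟩
          _ = _ := by ring
      rw [intervalIntegral.integral_const_mul] at h1
      have h3 : Real.Gamma β * ‖d t‖ ≤ ‖c‖ * (B * (1 / 2) ^ n *
          (Real.exp (k * t) * ((2 * ‖c‖ + 1)⁻¹ * Real.Gamma β))) := by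
        rw [← hkβ]
        calc Real.Gamma β * ‖d t‖ = ‖(Real.Gamma β : ℂ) * d t‖ := by
              rw [norm_mul, Complex.norm_real, Real.norm_of_nonneg hΓ.le]
          _ = ‖c‖ * ‖∫ s in (0 : ℝ)..t, (((t - s) ^ (β - 1) : ℝ) : ℂ) * d s‖ := by
              rw [h t ht, norm_mul]
          _ ≤ _ := by
              refine mul_le_mul_of_nonneg_left (h1.trans ?_) (norm_nonneg _)
              exact mul_le_mul_of_nonneg_left hle (by positivity)
      have h4 : ‖c‖ * (2 * ‖c‖ + 1)⁻¹ ≤ 1 / 2 := by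
        rw [← div_eq_mul_inv, div_le_iff₀ (by positivity)]
        linarith
      have h5 : Real.Gamma β * ‖d t‖ ≤ Real.Gamma β * (B * (1 / 2) ^ (n + 1) * Real.exp (k * t)) := by
        calc _ ≤ _ := h3
          _ = (‖c‖ * (2 * ‖c‖ + 1)⁻¹) * (Real.Gamma β * (B * (1 / 2) ^ n * Real.exp (k * t))) := by ring
          _ ≤ 1 / 2 * (Real.Gamma β * (B * (1 / 2) ^ n * Real.exp (k * t))) := by gcongr
          _ = _ := by ring
      exact le_of_mul_le_mul_left h5 hΓ
  have hlim : Tendsto (fun n : ℕ => B * (1 / 2) ^ n * Real.exp (k * t)) atTop (𝓝 (B * 0 * Real.exp (k * t))) :=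
    ((tendsto_pow_atTop_nhds_zero_of_lt_one (by norm_num) (by norm_num)).const_mul B).mul_const _
  have := ge_of_tendsto' hlim fun n => key n t ht
  rw [mul_zero, zero_mul] at this
  exact norm_le_zero_iff.1 this

/-! ### Truncated characters as test functions for the nonlocal operator -/

/-- A smooth cutoff function that is `1` near the origin. -/
def cutoff : ContDiffBump (0 : ℝ) := ⟨1, 2, one_pos, one_lt_two⟩

/-- The truncated characters `exp(iκx) χ(x / (n + 1))` as test functions. -/
def truncChar (κ : ℝ) (n : ℕ) : 𝓢(ℝ, ℂ) :=
  HasCompactSupport.toSchwartzMap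
    (f := fun x : ℝ => Complex.exp (Complex.I * κ * x) * (cutoff (x / (n + 1)) : ℂ))
    (by
      have h1 : HasCompactSupport fun x : ℝ => cutoff (x * ((n : ℝ) + 1)⁻¹) := by
        have := cutoff.hasCompactSupport.comp_homeomorph
          (Homeomorph.mulRight₀ ((n : ℝ) + 1)⁻¹ (by positivity))
        exact this
      have h2 : HasCompactSupport fun x : ℝ => ((cutoff (x * ((n : ℝ) + 1)⁻¹) : ℝ) : ℂ) :=
        h1.comp_left Complex.ofReal_zero
      exact HasCompactSupport.mul_left h2)
    (by
      have h1 : ContDiff ℝ ((⊤ : ℕ∞) : WithTop ℕ∞) fun x : ℝ => cutoff (x / (n + 1)) := cutoff.contDiff.comp (by fun_prop)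
      have h2 : ContDiff ℝ ((⊤ : ℕ∞) : WithTop ℕ∞) fun x : ℝ => ((cutoff (x / (n + 1)) : ℝ) : ℂ) :=
        Complex.ofRealCLM.contDiff.comp h1
      have h3 : ContDiff ℝ ((⊤ : ℕ∞) : WithTop ℕ∞) fun x : ℝ => (x : ℂ) := Complex.ofRealCLM.contDiff
      exact (contDiff_const.mul h3).cexp.mul h2)

lemma truncChar_apply (κ : ℝ) (n : ℕ) (x : ℝ) :
    truncChar κ n x = Complex.exp (Complex.I * κ * x) * (cutoff (x / (n + 1)) : ℂ) := rfl

/-- Truncation leaves the initial value exactly `1`. -/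
lemma truncChar_apply_zero (κ : ℝ) (n : ℕ) : truncChar κ n 0 = 1 := by
  rw [truncChar_apply, zero_div, cutoff.one_of_mem_closedBall (by simp [cutoff])]
  simp

lemma norm_truncChar_le (κ : ℝ) (n : ℕ) (x : ℝ) : ‖truncChar κ n x‖ ≤ 1 := by
  rw [truncChar_apply, norm_mul, norm_exp_I_mul', one_mul, Complex.norm_real,
    Real.norm_of_nonneg cutoff.nonneg]
  exact cutoff.le_one

lemma tendsto_truncChar (κ x : ℝ) :
    Tendsto (fun n => truncChar κ n x) atTop (𝓝 (Complex.exp (Complex.I * κ * x))) := by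
  have h1 : Tendsto (fun n : ℕ => x / ((n : ℝ) + 1)) atTop (𝓝 0) :=
    tendsto_const_nhds.div_atTop (tendsto_natCast_atTop_atTop.atTop_add tendsto_const_nhds)
  have h2 : Tendsto (fun n : ℕ => ((cutoff (x / ((n : ℝ) + 1)) : ℝ) : ℂ)) atTop
      (𝓝 ((cutoff (0 : ℝ) : ℝ) : ℂ)) :=
    ((Complex.continuous_ofReal.comp cutoff.continuous).tendsto 0).comp h1
  have h3 := h2.const_mul (Complex.exp (Complex.I * κ * x))
  rw [cutoff.one_of_mem_closedBall (by simp [cutoff]), Complex.ofReal_one, mul_one] at h3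
  exact h3

lemma fourierPlus_truncChar (κ : ℝ) (n : ℕ) (k : ℝ) : fourierPlus (truncChar κ n) k =
    ((n : ℝ) + 1 : ℝ) * fourierPlus (truncChar 0 0) (((n : ℝ) + 1) * (k + κ)) := by
  have hN : (0 : ℝ) < (n : ℝ) + 1 := by positivity
  have h := Measure.integral_comp_mul_left
    (fun x : ℝ => Complex.exp (Complex.I * k * x) * truncChar κ n x) ((n : ℝ) + 1)
  rw [abs_of_pos (inv_pos.2 hN)] at h
  have h2 : fourierPlus (truncChar κ n) k = ((n : ℝ) + 1) • ∫ x : ℝ,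
      Complex.exp (Complex.I * k * (((n : ℝ) + 1) * x : ℝ)) * truncChar κ n (((n : ℝ) + 1) * x) := by
    rw [h, smul_inv_smul₀ hN.ne', fourierPlus]
  rw [h2, Complex.real_smul, fourierPlus]
  congr 1
  refine integral_congr_ae (Eventually.of_forall fun x => ?_)
  simp only [truncChar_apply]
  rw [mul_div_cancel_left₀ _ hN.ne', ← mul_assoc, ← mul_assoc, ← Complex.exp_add, ← Complex.exp_add]
  simp only [Nat.cast_zero, zero_add, div_one]
  congr 2; push_cast; ring

/-- The transform concentrates near frequency `-κ` at scale `1/(n+1)`. The substitution `y = (n+1)(k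
+ κ)` makes the transform of the cutoff a fixed weight and moves the dependence on `n` into a
bounded phase and the symbol. -/
lemma rieszFeller_truncChar (α θ κ : ℝ) (n : ℕ) (x : ℝ) : rieszFeller α θ (truncChar κ n) x =
    (2 * (Real.pi : ℂ))⁻¹ * ∫ y : ℝ, Complex.exp (-(Complex.I * (y / ((n : ℝ) + 1) - κ : ℝ) * x)) *
      (-symbol α θ (y / ((n : ℝ) + 1) - κ) * fourierPlus (truncChar 0 0) y) := by
  have hN : (0 : ℝ) < (n : ℝ) + 1 := by positivity
  set H : ℝ → ℂ := fun y => Complex.exp (-(Complex.I * (y / ((n : ℝ) + 1) - κ : ℝ) * x)) *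
      (-symbol α θ (y / ((n : ℝ) + 1) - κ) * fourierPlus (truncChar 0 0) y) with hH
  rw [rieszFeller, fourierPlusInv]
  congr 1
  have e : ∀ k : ℝ, Complex.exp (-(Complex.I * k * x)) * (-symbol α θ k * fourierPlus (truncChar κ n) k) =
      ((n : ℝ) + 1 : ℝ) * H (((n : ℝ) + 1) * (k + κ)) := by
    intro k
    rw [hH]
    simp only
    rw [mul_div_cancel_left₀ _ hN.ne', add_sub_cancel_right, fourierPlus_truncChar]
    ring
  simp_rw [e]
  rw [integral_const_mul, integral_add_right_eq_self (fun k => H (((n : ℝ) + 1) * k)) κ,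
    Measure.integral_comp_mul_left, abs_of_pos (inv_pos.2 hN), Complex.real_smul, ← mul_assoc,
    ← Complex.ofReal_mul, mul_inv_cancel₀ hN.ne', Complex.ofReal_one, one_mul]

lemma continuous_rieszFeller {α : ℝ} (hα : 0 < α) (hα2 : α ≤ 2) (θ : ℝ) (φ : 𝓢(ℝ, ℂ)) :
    Continuous (rieszFeller α θ φ) := by
  refine continuous_fourierPlusInv ((integrable_symbol_mul_fourierPlus_schwartz φ hα hα2 θ).mono' ?_
    (Eventually.of_forall fun κ => ?_))
  · exact ((continuous_symbol hα θ).neg.mul (continuous_fourierPlus_schwartz φ)).aestronglyMeasurable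
  · rw [norm_mul, norm_neg]

section TruncChar

variable {α : ℝ} (hα : 0 < α) (hα2 : α ≤ 2) (θ κ : ℝ)

include hα hα2

lemma norm_rieszFeller_truncChar_integrand_le (n : ℕ) (x y : ℝ) :
    ‖Complex.exp (-(Complex.I * (y / ((n : ℝ) + 1) - κ : ℝ) * x)) *
      (-symbol α θ (y / ((n : ℝ) + 1) - κ) * fourierPlus (truncChar 0 0) y)‖ ≤
    (1 + 2 * κ ^ 2) * ‖fourierPlus (truncChar 0 0) y‖ +
      2 * (y ^ 2 * ‖fourierPlus (truncChar 0 0) y‖) := by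
  rw [norm_mul, norm_exp_I_mul, one_mul, norm_mul, norm_neg, norm_symbol]
  have h1 := abs_rpow_le_one_add_sq hα.le hα2 (y / ((n : ℝ) + 1) - κ)
  have h2 : (y / ((n : ℝ) + 1)) ^ 2 ≤ y ^ 2 := by
    rw [div_pow]
    refine div_le_self (sq_nonneg _) (one_le_pow₀ ?_)
    have : (0 : ℝ) ≤ n := n.cast_nonneg
    linarith
  have h3 : |y / ((n : ℝ) + 1) - κ| ^ α ≤ 1 + 2 * κ ^ 2 + 2 * y ^ 2 := by
    nlinarith [sq_nonneg (y / ((n : ℝ) + 1) + κ)]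
  calc _ ≤ (1 + 2 * κ ^ 2 + 2 * y ^ 2) * ‖fourierPlus (truncChar 0 0) y‖ := by gcongr
    _ = _ := by ring

lemma exists_norm_rieszFeller_truncChar_le :
    ∃ M, ∀ n x, ‖rieszFeller α θ (truncChar κ n) x‖ ≤ M := by
  refine ⟨‖(2 * (Real.pi : ℂ))⁻¹‖ * ∫ y, ((1 + 2 * κ ^ 2) * ‖fourierPlus (truncChar 0 0) y‖ +
    2 * (y ^ 2 * ‖fourierPlus (truncChar 0 0) y‖)), fun n x => ?_⟩
  rw [rieszFeller_truncChar, norm_mul]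
  refine mul_le_mul_of_nonneg_left (norm_integral_le_of_norm_le ?_ (Eventually.of_forall fun y =>
    norm_rieszFeller_truncChar_integrand_le hα hα2 θ κ n x y)) (norm_nonneg _)
  exact ((integrable_fourierPlus_schwartz (truncChar 0 0)).norm.const_mul _).add
    ((integrable_sq_mul_fourierPlus_schwartz (truncChar 0 0)).const_mul _)

lemma tendsto_rieszFeller_truncChar (x : ℝ) :
    Tendsto (fun n => rieszFeller α θ (truncChar κ n) x) atTop
      (𝓝 (-symbol α (-θ) κ * Complex.exp (Complex.I * κ * x))) := by
  -- The transform of the cutoff integrates to `2π` times its value at `0`, that is, to `2π`. The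
  -- symbol frozen at `-κ` is the one of opposite skewness at `κ`.
  have hlim : -symbol α (-θ) κ * Complex.exp (Complex.I * κ * x) =
      (2 * (Real.pi : ℂ))⁻¹ * ∫ y : ℝ, Complex.exp (-(Complex.I * (0 - κ : ℝ) * x)) *
      (-symbol α θ (0 - κ) * fourierPlus (truncChar 0 0) y) := by
    have h := fourierPlusInv_fourierPlus_schwartz (truncChar 0 0) 0
    rw [truncChar_apply_zero, fourierPlusInv] at h
    simp only [Complex.ofReal_zero, mul_zero, neg_zero, Complex.exp_zero, one_mul] at h
    rw [integral_const_mul, integral_const_mul, zero_sub, symbol_neg_arg]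
    have e : Complex.exp (-(Complex.I * (-κ : ℝ) * x)) = Complex.exp (Complex.I * κ * x) := by
      congr 1; push_cast; ring
    rw [e]
    linear_combination (symbol α (-θ) κ * Complex.exp (Complex.I * κ * x)) * h
  rw [hlim]
  simp_rw [rieszFeller_truncChar]
  refine (tendsto_integral_of_dominated_convergence (fun y => (1 + 2 * κ ^ 2) *
    ‖fourierPlus (truncChar 0 0) y‖ + 2 * (y ^ 2 * ‖fourierPlus (truncChar 0 0) y‖))
    (fun n => ?_) ?_ (fun n => Eventually.of_forall fun y =>
      norm_rieszFeller_truncChar_integrand_le hα hα2 θ κ n x y)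
    (Eventually.of_forall fun y => ?_)).const_mul _
  · have h1 := continuous_symbol hα θ
    have h2 := continuous_fourierPlus_schwartz (truncChar 0 0)
    exact Continuous.aestronglyMeasurable (by fun_prop)
  · exact ((integrable_fourierPlus_schwartz (truncChar 0 0)).norm.const_mul _).add
      ((integrable_sq_mul_fourierPlus_schwartz (truncChar 0 0)).const_mul _)
  · have h1 : Tendsto (fun n : ℕ => y / ((n : ℝ) + 1)) atTop (𝓝 0) :=
      tendsto_const_nhds.div_atTop (tendsto_natCast_atTop_atTop.atTop_add tendsto_const_nhds)
    have h2 : Continuous fun z : ℝ => Complex.exp (-(Complex.I * (z - κ : ℝ) * x)) *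
        (-symbol α θ (z - κ) * fourierPlus (truncChar 0 0) y) := by
      have h3 := continuous_symbol hα θ
      fun_prop
    exact (h2.tendsto 0).comp h1

end TruncChar

/-! ### Uniqueness -/

section Uniqueness

variable {α θ β : ℝ} (hα : 0 < α) (hα2 : α ≤ 2) (hβ : 0 < β) (hβ1 : β ≤ 1)
  {μ : ℝ → SignedMeasure ℝ} (hμ : IsFundamentalSolution α θ β μ) (κ : ℝ)

include hμ

lemma IsFundamentalSolution.exists_variation_le {T : ℝ} (hT : 0 < T) :
    ∃ C, 0 ≤ C ∧ ∀ t ∈ Ioc 0 T, ((μ t).variation univ).toReal ≤ C := by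
  obtain ⟨C, hC⟩ := hμ.locally_bounded T hT
  exact ⟨C, C.2, fun t ht => ENNReal.toReal_le_coe_of_le_coe (hC t ht)⟩

include hα hα2 hβ hβ1

/-- The characteristic function of a fundamental solution satisfies an Abel–Volterra equation. -/
lemma IsFundamentalSolution.volterra {t : ℝ} (ht : 0 < t) :
    IntervalIntegrable (fun s => (((t - s) ^ (β - 1) : ℝ) : ℂ) * (-symbol α θ κ *
      ∫ᵛ x, Complex.exp (Complex.I * κ * x) ∂<•(μ s))) volume 0 t ∧
    ∫ s in (0 : ℝ)..t, (((t - s) ^ (β - 1) : ℝ) : ℂ) * (-symbol α θ κ *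
      ∫ᵛ x, Complex.exp (Complex.I * κ * x) ∂<•(μ s)) =
      Real.Gamma β * (∫ᵛ x, Complex.exp (Complex.I * κ * x) ∂<•(μ t) - 1) := by
  set r : ℕ → ℝ → ℂ := fun n s => ∫ᵛ x, rieszFeller α (-θ) (truncChar κ n) x ∂<•(μ s) with hr
  -- The weak equation for each truncated character is integrated to order `β`. What remains is the
  -- limit in `n`, dominated by `(t - s)^{β-1}` times a uniform bound `M` on the images and a bound
  -- `C` on the variations.
  have hn : ∀ n, _ ∧ _ := fun n => integral_sub_rpow_mul_caputoDeriv hβ hβ1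
    (hμ.regular (truncChar κ n)) (r := r n) (fun s hs => hμ.equation _ s hs) ht
  obtain ⟨M, hM⟩ := exists_norm_rieszFeller_truncChar_le hα hα2 (-θ) κ
  obtain ⟨C, hC0, hC⟩ := hμ.exists_variation_le ht
  have hM0 : 0 ≤ M := (norm_nonneg _).trans (hM 0 0)
  have hrlim : ∀ s, Tendsto (fun n => r n s) atTop
      (𝓝 (-symbol α θ κ * ∫ᵛ x, Complex.exp (Complex.I * κ * x) ∂<•(μ s))) := by
    intro s
    have h1 := tendsto_integral_signedMeasure (μ s) (fun n => continuous_rieszFeller hα hα2 (-θ) _)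
      (g := fun x : ℝ => -symbol α θ κ * Complex.exp (Complex.I * κ * x)) (by fun_prop) hM
      (fun x => by simpa using tendsto_rieszFeller_truncChar hα hα2 (-θ) κ x)
    have hi : ∀ (ρ : Measure ℝ) [IsFiniteMeasure ρ],
        Integrable (fun x : ℝ => Complex.exp (Complex.I * κ * x)) ρ := fun ρ _ =>
      integrable_of_continuous_of_norm_le (by fun_prop) (M := 1) fun x => (norm_exp_I_mul' κ x).le
    rw [integral_signedMeasure_eq_sub (μ s) ((hi _).const_mul _) ((hi _).const_mul _),
      integral_const_mul, integral_const_mul, ← mul_sub,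
      ← integral_signedMeasure_eq_sub (μ s) (hi _) (hi _)] at h1
    exact h1
  have hbi : IntervalIntegrable (fun s => (t - s) ^ (β - 1) * (M * C)) volume 0 t := by
    have := (intervalIntegrable_sub_rpow_mul_rpow hβ one_pos ht).mul_const (M * C)
    simpa using this
  have hbound : ∀ n, ∀ s ∈ Ioc 0 t,
      ‖(((t - s) ^ (β - 1) : ℝ) : ℂ) * r n s‖ ≤ (t - s) ^ (β - 1) * (M * C) := by
    intro n s hs
    have h2 := Real.rpow_nonneg (sub_nonneg.2 hs.2) (β - 1)
    rw [norm_mul, Complex.norm_real, Real.norm_of_nonneg h2]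
    refine mul_le_mul_of_nonneg_left ?_ h2
    exact (norm_integral_signedMeasure_le (μ s) (continuous_rieszFeller hα hα2 (-θ) _) (hM n)).trans
      (mul_le_mul_of_nonneg_left (hC s hs) hM0)
  have hlim : ∀ s, Tendsto (fun n => (((t - s) ^ (β - 1) : ℝ) : ℂ) * r n s) atTop
      (𝓝 ((((t - s) ^ (β - 1) : ℝ) : ℂ) *
        (-symbol α θ κ * ∫ᵛ x, Complex.exp (Complex.I * κ * x) ∂<•(μ s)))) :=
    fun s => (hrlim s).const_mul _
  have hmeas : ∀ n, AEStronglyMeasurable (fun s => (((t - s) ^ (β - 1) : ℝ) : ℂ) * r n s)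
      (volume.restrict (uIoc 0 t)) := fun n => by
    rw [uIoc_of_le ht.le]; exact (hn n).1.1.1
  refine ⟨hbi.mono_fun' (aestronglyMeasurable_of_tendsto_ae atTop hmeas (Eventually.of_forall hlim)) ?_,
    ?_⟩
  · rw [uIoc_of_le ht.le]
    filter_upwards [self_mem_ae_restrict measurableSet_Ioc] with s hs
    exact le_of_tendsto' (hlim s).norm fun n => hbound n s hs
  · have h1 := intervalIntegral.tendsto_integral_filter_of_dominated_convergence
      (a := 0) (b := t) (μ := volume) _ (Eventually.of_forall hmeas)
      (Eventually.of_forall fun n => Eventually.of_forall fun s hs => hbound n s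
        (by rwa [uIoc_of_le ht.le] at hs)) hbi (Eventually.of_forall fun s _ => hlim s)
    have h2 := tendsto_integral_signedMeasure (μ t) (fun n => (truncChar κ n).continuous)
      (g := fun x : ℝ => Complex.exp (Complex.I * κ * x)) (by fun_prop) (norm_truncChar_le κ)
      (tendsto_truncChar κ)
    have h3 : ∀ n, ∫ s in (0 : ℝ)..t, (((t - s) ^ (β - 1) : ℝ) : ℂ) * r n s =
        Real.Gamma β * (∫ᵛ x, truncChar κ n x ∂<•(μ t) - 1) := by
      intro n
      rw [(hn n).2, pairing, if_neg ht.not_ge, pairing, if_pos le_rfl, truncChar_apply_zero]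
    simp_rw [h3] at h1
    exact tendsto_nhds_unique h1 ((h2.sub_const 1).const_mul _)

omit hμ in
/-- Two fundamental solutions have the same characteristic functions. -/
lemma IsFundamentalSolution.integral_exp_eq {μ₁ μ₂ : ℝ → SignedMeasure ℝ}
    (h₁ : IsFundamentalSolution α θ β μ₁) (h₂ : IsFundamentalSolution α θ β μ₂) {t : ℝ} (ht : 0 < t) :
    ∫ᵛ x, Complex.exp (Complex.I * κ * x) ∂<•(μ₁ t) =
      ∫ᵛ x, Complex.exp (Complex.I * κ * x) ∂<•(μ₂ t) := by
  obtain ⟨C₁, -, hC₁⟩ := h₁.exists_variation_le ht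
  obtain ⟨C₂, -, hC₂⟩ := h₂.exists_variation_le ht
  have hb : ∀ m : SignedMeasure ℝ, ‖∫ᵛ x, Complex.exp (Complex.I * κ * x) ∂<•m‖ ≤
      1 * (m.variation univ).toReal := fun m =>
    norm_integral_signedMeasure_le m (by fun_prop) fun x => (norm_exp_I_mul' κ x).le
  -- The inhomogeneity comes from the common initial value and cancels in the difference, which is
  -- bounded by the sum of the two variation bounds.
  refine sub_eq_zero.1 (eq_zero_of_volterra hβ (c := -symbol α θ κ) (T := t) (B := C₁ + C₂)
    (d := fun s => ∫ᵛ x, Complex.exp (Complex.I * κ * x) ∂<•(μ₁ s) -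
      ∫ᵛ x, Complex.exp (Complex.I * κ * x) ∂<•(μ₂ s)) (fun s hs => ?_) (fun s hs => ?_)
    (right_mem_Ioc.2 ht))
  · refine (norm_sub_le _ _).trans (add_le_add ?_ ?_)
    · exact ((hb _).trans_eq (one_mul _)).trans (hC₁ s hs)
    · exact ((hb _).trans_eq (one_mul _)).trans (hC₂ s hs)
  · obtain ⟨i₁, e₁⟩ := h₁.volterra hα hα2 hβ hβ1 κ hs.1
    obtain ⟨i₂, e₂⟩ := h₂.volterra hα hα2 hβ hβ1 κ hs.1
    have e₃ := intervalIntegral.integral_sub i₁ i₂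
    rw [e₁, e₂, ← mul_sub, sub_sub_sub_cancel_right] at e₃
    rw [← e₃, ← intervalIntegral.integral_const_mul]
    refine intervalIntegral.integral_congr fun u _ => ?_
    ring

end Uniqueness

/-- A family of signed measures is a fundamental solution if and only if it is the family of
subordinated laws. -/
theorem isFundamentalSolution_iff {α θ β : ℝ} (hα : 0 < α) (hα2 : α ≤ 2)
    (hθ : |θ| ≤ min α (2 - α)) (hβ : 0 < β) (hβ1 : β ≤ 1) {μ : ℝ → SignedMeasure ℝ} :
    IsFundamentalSolution α θ β μ ↔
      ∀ t, 0 < t → ∀ A, MeasurableSet A → μ t A = (subordinatedLaw α θ β t).real A := by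
  refine ⟨fun hμ t ht A hA => ?_, isFundamentalSolution_of_eq_subordinatedLaw hα hα2 hθ hβ hβ1⟩
  have hP : ∀ t, 0 < t → IsProbabilityMeasure (subordinatedLaw α θ β t) := fun t ht =>
    isProbabilityMeasure_subordinatedLaw hα hα2 hθ hβ hβ1 ht
  classical
  -- Finiteness of the subordinated law is available only for `t > 0`; the value at other times does
  -- not enter the definition of a fundamental solution.
  set ν : ℝ → SignedMeasure ℝ := fun t =>
    if ht : 0 < t then have := hP t ht; (subordinatedLaw α θ β t).toSignedMeasure else 0 with hν
  have hνt : ∀ t (ht : 0 < t), ν t = (have := hP t ht; (subordinatedLaw α θ β t).toSignedMeasure) :=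
    fun t ht => dif_pos ht
  have hνf : IsFundamentalSolution α θ β ν := by
    refine isFundamentalSolution_of_eq_subordinatedLaw hα hα2 hθ hβ hβ1 fun t ht A hA => ?_
    have := hP t ht
    rw [hνt t ht, Measure.toSignedMeasure_apply_measurable hA]
  have := hP t ht
  refine signedMeasure_eq_of_integral_exp_eq (μ t) (fun κ => ?_) hA
  rw [hμ.integral_exp_eq hα hα2 hβ hβ1 κ hνf ht, hνt t ht, VectorMeasure.integral_toSignedMeasure]

/-- Sets of full measure are dense, and an inequality of values at a common point of continuity
would persist nearby. -/
lemma eq_of_ae_eq_of_continuousAt {f g : ℝ → ℝ} (h : f =ᵐ[volume] g) {x : ℝ} (hf : ContinuousAt f x)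
    (hg : ContinuousAt g x) : f x = g x := by
  by_contra hne
  have h1 := (hf.sub hg).eventually_ne (sub_ne_zero.2 hne)
  obtain ⟨y, hy1, hy2⟩ := (Measure.dense_of_ae h).inter_nhds_nonempty h1
  exact hy2 (sub_eq_zero.2 hy1)

/-! ### The subordination formula for densities -/

section Density

variable {α θ β : ℝ} (hα : 0 < α) (hα2 : α ≤ 2) (hθ : |θ| ≤ min α (2 - α)) (hθ1 : |θ| < 1)
  (hβ : 0 < β) (hβ1 : β < 1) {t : ℝ} (ht : 0 < t)

include hβ hβ1

lemma continuous_operationalDensity (t : ℝ) : Continuous fun τ => operationalDensity β τ t :=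
  continuous_const.mul ((continuous_wrightM hβ hβ1).comp (continuous_id.div_const _))

include ht

/-- On `(0, 1]` the density is bounded and `a > -1`; beyond `1` the power is at most `1` and the
density is integrable. -/
lemma integrableOn_rpow_mul_operationalDensity {a : ℝ} (ha0 : a ≤ 0) (ha : -1 < a) :
    IntegrableOn (fun τ => τ ^ a * |operationalDensity β τ t|) (Ioi 0) := by
  have hq := continuous_operationalDensity hβ hβ1 t
  have hqi := integrableOn_operationalDensity hβ hβ1 ht
  have hm : Measurable fun τ => τ ^ a * |operationalDensity β τ t| := by
    have := hq.measurable
    fun_prop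
  rw [← Ioc_union_Ioi_eq_Ioi zero_le_one, integrableOn_union]
  constructor
  · obtain ⟨K, hK⟩ := (isCompact_Icc (a := (0 : ℝ)) (b := 1)).exists_bound_of_continuousOn
      hq.continuousOn
    have h1 : IntegrableOn (fun τ : ℝ => τ ^ a * K) (Ioc 0 1) := by
      have := (intervalIntegral.intervalIntegrable_rpow' (a := 0) (b := 1) ha).mul_const K
      rwa [intervalIntegrable_iff_integrableOn_Ioc_of_le zero_le_one] at this
    refine h1.mono' hm.aestronglyMeasurable ?_
    filter_upwards [self_mem_ae_restrict measurableSet_Ioc] with τ hτ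
    have h2 := Real.rpow_nonneg hτ.1.le a
    rw [norm_mul, Real.norm_of_nonneg h2, Real.norm_eq_abs, abs_abs]
    exact mul_le_mul_of_nonneg_left (hK τ ⟨hτ.1.le, hτ.2⟩) h2
  · refine (hqi.mono_set (Ioi_subset_Ioi zero_le_one)).norm.mono' hm.aestronglyMeasurable ?_
    filter_upwards [self_mem_ae_restrict measurableSet_Ioi] with τ hτ
    have hτ' : (1 : ℝ) < τ := hτ
    have h2 := Real.rpow_nonneg (zero_le_one.trans hτ'.le) a
    rw [norm_mul, Real.norm_of_nonneg h2, Real.norm_eq_abs, abs_abs]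
    exact mul_le_of_le_one_left (abs_nonneg _) (Real.rpow_le_one_of_one_le_of_nonpos hτ'.le ha0)

include hα hθ1

/-- Near every point at which the subordination integral converges, its integrand has an integrable
majorant. -/
lemma exists_majorant_parentDensity_mul {x : ℝ} (hx : x ≠ 0 ∨ 1 < α) :
    ∃ b : ℝ → ℝ, IntegrableOn b (Ioi 0) ∧ ∀ᶠ y in 𝓝 x, ∀ τ, 0 < τ →
      ‖parentDensity α θ y τ * operationalDensity β τ t‖ ≤ b τ := by
  obtain ⟨C, hC0, hC⟩ := exists_parentDensity_le hα hθ1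
  -- For `α > 1` the bound `C τ^{-1/α}` is integrable at `0` and works for all `y`. Otherwise `x ≠
  -- 0`, and `|y| f ≤ C` is used on `|y| > |x|/2`.
  by_cases h1 : 1 < α
  · have ha : -1 < -(1 / α) := by
      rw [neg_lt_neg_iff, div_lt_one hα]; exact h1
    refine ⟨_, (integrableOn_rpow_mul_operationalDensity hβ hβ1 ht
      (neg_nonpos.2 (one_div_pos.2 hα).le) ha).const_mul C, Eventually.of_forall fun y τ hτ => ?_⟩
    rw [norm_mul, Real.norm_eq_abs, Real.norm_eq_abs, ← mul_assoc]
    exact mul_le_mul_of_nonneg_right (hC y τ hτ).1 (abs_nonneg _)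
  · have hx0 : 0 < |x| := abs_pos.2 (hx.resolve_right h1)
    refine ⟨_, (integrableOn_operationalDensity hβ hβ1 ht).norm.const_mul (C / (|x| / 2)), ?_⟩
    filter_upwards [(continuous_abs.tendsto x).eventually_const_lt (show |x| / 2 < |x| by linarith)]
      with y hy τ hτ
    rw [norm_mul]
    refine mul_le_mul_of_nonneg_right ?_ (norm_nonneg _)
    rw [le_div_iff₀ (by linarith), Real.norm_eq_abs, mul_comm]
    exact (mul_le_mul_of_nonneg_right hy.le (abs_nonneg _)).trans (hC y τ hτ).2

omit ht in
lemma aestronglyMeasurable_parentDensity_mul (t x : ℝ) (ν : Measure ℝ) :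
    AEStronglyMeasurable (fun τ => parentDensity α θ x τ * operationalDensity β τ t) ν := by
  have h1 := (continuous_operationalDensity hβ hβ1 t).measurable
  have h2 : Measurable fun τ => parentDensity α θ x τ :=
    (measurable_parentDensity hα hθ1).comp (measurable_id.prodMk measurable_const)
  exact (h2.mul h1).aestronglyMeasurable

lemma integrableOn_parentDensity_mul {x : ℝ} (hx : x ≠ 0 ∨ 1 < α) :
    IntegrableOn (fun τ => parentDensity α θ x τ * operationalDensity β τ t) (Ioi 0) := by
  obtain ⟨b, hb, hle⟩ := exists_majorant_parentDensity_mul hα hθ1 hβ hβ1 ht hx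
  refine hb.mono' (aestronglyMeasurable_parentDensity_mul hα hθ1 hβ hβ1 t x _) ?_
  filter_upwards [self_mem_ae_restrict measurableSet_Ioi] with τ hτ
  exact hle.self_of_nhds τ hτ

lemma continuousAt_integral_parentDensity_mul {x : ℝ} (hx : x ≠ 0 ∨ 1 < α) :
    ContinuousAt (fun y => ∫ τ in Ioi (0 : ℝ), parentDensity α θ y τ * operationalDensity β τ t) x := by
  obtain ⟨b, hb, hle⟩ := exists_majorant_parentDensity_mul hα hθ1 hβ hβ1 ht hx
  refine continuousAt_of_dominated (Eventually.of_forall fun y =>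
    aestronglyMeasurable_parentDensity_mul hα hθ1 hβ hβ1 t y _) ?_ hb
    (Eventually.of_forall fun τ => ?_)
  · filter_upwards [hle] with y hy
    filter_upwards [self_mem_ae_restrict measurableSet_Ioi] with τ hτ
    exact hy τ hτ
  · have h := continuous_stableDensity hα hθ1
    unfold parentDensity
    fun_prop

include hα2 hθ

/-- Integrating in `x` first, each parent density has mass one, and an integrable function of `τ`
remains. -/
lemma integrable_prod_parentDensity_mul :
    Integrable (Function.uncurry fun (x τ : ℝ) => parentDensity α θ x τ * operationalDensity β τ t)
      (volume.prod (volume.restrict (Ioi 0))) := by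
  have hm : Measurable (Function.uncurry fun (x τ : ℝ) =>
      parentDensity α θ x τ * operationalDensity β τ t) := by
    have h1 := (continuous_operationalDensity hβ hβ1 t).measurable
    have h2 : Measurable fun p : ℝ × ℝ => parentDensity α θ p.1 p.2 :=
      (measurable_parentDensity hα hθ1).comp measurable_swap
    exact h2.mul (h1.comp measurable_snd)
  rw [integrable_prod_iff' hm.aestronglyMeasurable]
  constructor
  · filter_upwards [self_mem_ae_restrict measurableSet_Ioi] with τ hτ
    exact (integrable_parentDensity hα hα2 hθ hθ1 hτ).mul_const (operationalDensity β τ t)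
  · refine (integrableOn_operationalDensity hβ hβ1 ht).norm.congr ?_
    filter_upwards [self_mem_ae_restrict measurableSet_Ioi] with τ hτ
    have h1 := integral_parentDensity hα hα2 hθ hθ1 hτ
    rw [← one_mul ‖operationalDensity β τ t‖, ← h1, ← integral_mul_const]
    refine integral_congr_ae (Eventually.of_forall fun x => ?_)
    simp only [Function.uncurry]
    rw [norm_mul, Real.norm_of_nonneg (parentDensity_nonneg hα hα2 hθ hθ1 (le_of_lt hτ) x)]

lemma integrable_integral_parentDensity_mul :
    Integrable fun x => ∫ τ in Ioi (0 : ℝ), parentDensity α θ x τ * operationalDensity β τ t :=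
  (integrable_prod_parentDensity_mul hα hα2 hθ hθ1 hβ hβ1 ht).integral_prod_left

lemma real_subordinatedLaw_eq_setIntegral {A : Set ℝ} (hA : MeasurableSet A) :
    (subordinatedLaw α θ β t).real A =
      ∫ x in A, ∫ τ in Ioi (0 : ℝ), parentDensity α θ x τ * operationalDensity β τ t := by
  have hint : Integrable (Function.uncurry fun (x τ : ℝ) =>
      parentDensity α θ x τ * operationalDensity β τ t)
      ((volume.restrict A).prod (volume.restrict (Ioi 0))) :=
    (integrable_prod_parentDensity_mul hα hα2 hθ hθ1 hβ hβ1 ht).mono_measure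
      (Measure.prod_mono Measure.restrict_le_self le_rfl)
  rw [real_subordinatedLaw hα hα2 hθ ht hA, integral_operationalLaw hβ hβ1 ht,
    integral_integral_swap hint]
  refine setIntegral_congr_fun measurableSet_Ioi fun τ hτ => ?_
  have hi := integrable_parentDensity hα hα2 hθ hθ1 hτ
  have h0 := parentDensity_nonneg hα hα2 hθ hθ1 (le_of_lt hτ)
  have h1 : (parentLaw α θ τ).real A = ∫ x in A, parentDensity α θ x τ := by
    rw [parentLaw, if_neg hθ1.ne, Measure.real, withDensity_apply _ hA,
      ← ofReal_integral_eq_lintegral_ofReal hi.integrableOn (Eventually.of_forall h0),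
      ENNReal.toReal_ofReal (integral_nonneg h0)]
  rw [h1, integral_mul_const, smul_eq_mul, mul_comm]

end Density

lemma isFundamentalSolution_withDensity_iff {α θ β : ℝ} (hα : 0 < α) (hα2 : α ≤ 2)
    (hθ : |θ| ≤ min α (2 - α)) (hθ1 : |θ| < 1) (hβ : 0 < β) (hβ1 : β < 1) {u : ℝ → ℝ → ℝ}
    (hu : ∀ t, 0 < t → Integrable fun x => u x t) :
    IsFundamentalSolution α θ β (fun t => (volume : Measure ℝ).withDensityᵥ fun x => u x t) ↔
      ∀ t, 0 < t → ∀ᵐ x : ℝ, u x t =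
        ∫ τ in Ioi (0 : ℝ), parentDensity α θ x τ * operationalDensity β τ t := by
  rw [isFundamentalSolution_iff hα hα2 hθ hβ hβ1.le]
  refine forall₂_congr fun t ht => ?_
  have hG := integrable_integral_parentDensity_mul hα hα2 hθ hθ1 hβ hβ1 ht
  constructor
  · intro h
    refine (hu t ht).ae_eq_of_forall_setIntegral_eq _ _ hG fun A hA _ => ?_
    rw [← real_subordinatedLaw_eq_setIntegral hα hα2 hθ hθ1 hβ hβ1 ht hA, ← h A hA,
      withDensityᵥ_apply (hu t ht) hA]
  · intro h A hA
    rw [withDensityᵥ_apply (hu t ht) hA,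
      real_subordinatedLaw_eq_setIntegral hα hα2 hθ hθ1 hβ hβ1 ht hA]
    exact integral_congr_ae (ae_restrict_of_ae h)

end STFD

end

theorem mainTheorem1 (α θ β : ℝ) (hα : 0 < α) (hα2 : α ≤ 2) (hθ : |θ| ≤ min α (2 - α))
    (hβ : 0 < β) (hβ1 : β ≤ 1) :
    -- the parent density is the stable density with characteristic function `exp(-τ ψ)`
    (|θ| < 1 → ∀ τ : ℝ, 0 < τ →
      (∀ x : ℝ, 0 ≤ STFD.parentDensity α θ x τ) ∧
      Integrable (fun x : ℝ => STFD.parentDensity α θ x τ) ∧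
      ∫ x : ℝ, STFD.parentDensity α θ x τ = 1 ∧
      ∀ κ : ℝ, STFD.fourierPlus (fun x => (STFD.parentDensity α θ x τ : ℂ)) κ =
        Complex.exp (-((τ : ℂ) * STFD.symbol α θ κ))) ∧
    -- the kernel is a probability density in `τ`, with the stated Laplace transform in `t`
    (β < 1 →
      (∀ t : ℝ, 0 < t →
        (∀ τ : ℝ, 0 ≤ τ → 0 ≤ STFD.operationalDensity β τ t) ∧
        IntegrableOn (fun τ : ℝ => STFD.operationalDensity β τ t) (Ioi 0) ∧
        ∫ τ in Ioi (0 : ℝ), STFD.operationalDensity β τ t = 1) ∧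
      (∀ τ : ℝ, 0 ≤ τ → ∀ s : ℂ, 0 < s.re →
        IntegrableOn (fun t : ℝ =>
          Complex.exp (-(s * (t : ℂ))) * (STFD.operationalDensity β τ t : ℂ)) (Ioi 0) ∧
        ∫ t in Ioi (0 : ℝ),
          Complex.exp (-(s * (t : ℂ))) * (STFD.operationalDensity β τ t : ℂ) =
            s ^ ((β : ℂ) - 1) * Complex.exp (-((τ : ℂ) * s ^ (β : ℂ))))) ∧
    -- existence, uniqueness and subordination formula for all parameters, in terms of laws
    (∀ μ : ℝ → SignedMeasure ℝ, STFD.IsFundamentalSolution α θ β μ ↔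
      ∀ t : ℝ, 0 < t → ∀ A : Set ℝ, MeasurableSet A →
        μ t A = ∫ τ, (STFD.parentLaw α θ τ).real A ∂(STFD.operationalLaw β t)) ∧
    -- the subordination formula for densities
    (|θ| < 1 → β < 1 →
      (∀ t : ℝ, 0 < t →
        (∀ x : ℝ, (x ≠ 0 ∨ 1 < α) →
          IntegrableOn (fun τ : ℝ =>
            STFD.parentDensity α θ x τ * STFD.operationalDensity β τ t) (Ioi 0)) ∧
        Integrable (fun x : ℝ => ∫ τ in Ioi (0 : ℝ),
          STFD.parentDensity α θ x τ * STFD.operationalDensity β τ t)) ∧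
      ∀ u : ℝ → ℝ → ℝ, (∀ t : ℝ, 0 < t → Integrable (fun x : ℝ => u x t)) →
        (STFD.IsFundamentalSolution α θ β
            (fun t => (volume : Measure ℝ).withDensityᵥ (fun x : ℝ => u x t)) ↔
          ∀ t : ℝ, 0 < t → ∀ᵐ x : ℝ, u x t = ∫ τ in Ioi (0 : ℝ),
            STFD.parentDensity α θ x τ * STFD.operationalDensity β τ t) ∧
        (STFD.IsFundamentalSolution α θ β
            (fun t => (volume : Measure ℝ).withDensityᵥ (fun x : ℝ => u x t)) →
          ∀ t : ℝ, 0 < t → ∀ x : ℝ, (x ≠ 0 ∨ 1 < α) → ContinuousAt (fun y : ℝ => u y t) x →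
            u x t = ∫ τ in Ioi (0 : ℝ),
              STFD.parentDensity α θ x τ * STFD.operationalDensity β τ t)) := by
  refine ⟨fun hθ1 τ hτ => ⟨STFD.parentDensity_nonneg hα hα2 hθ hθ1 hτ.le,
    STFD.integrable_parentDensity hα hα2 hθ hθ1 hτ, STFD.integral_parentDensity hα hα2 hθ hθ1 hτ,
    STFD.fourierPlus_parentDensity hα hα2 hθ hθ1 hτ⟩, fun hβ2 => ⟨fun t ht =>
    ⟨fun τ hτ => STFD.operationalDensity_nonneg hβ hβ2 hτ ht,
      STFD.integrableOn_operationalDensity hβ hβ2 ht, STFD.integral_operationalDensity hβ hβ2 ht⟩,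
    fun τ hτ s hs => ⟨STFD.integrableOn_exp_mul_operationalDensity hβ hβ2 hτ hs,
      STFD.laplace_operationalDensity hβ hβ2 hτ hs⟩⟩, fun μ => ?_, fun hθ1 hβ2 =>
    ⟨fun t ht => ⟨fun x hx => STFD.integrableOn_parentDensity_mul hα hθ1 hβ hβ2 ht hx,
      STFD.integrable_integral_parentDensity_mul hα hα2 hθ hθ1 hβ hβ2 ht⟩, fun u hu => ?_⟩⟩
  · rw [STFD.isFundamentalSolution_iff hα hα2 hθ hβ hβ1]
    refine forall₂_congr fun t ht => forall₂_congr fun A hA => ?_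
    rw [STFD.real_subordinatedLaw hα hα2 hθ ht hA]
  -- The subordination integral is continuous at every admissible `x`, so equality almost everywhere
  -- becomes equality at each such point of continuity of `u`.
  · have h := STFD.isFundamentalSolution_withDensity_iff hα hα2 hθ hθ1 hβ hβ2 hu
    exact ⟨h, fun hf t ht x hx hc => STFD.eq_of_ae_eq_of_continuousAt (h.1 hf t ht) hc
      (STFD.continuousAt_integral_parentDensity_mul hα hθ1 hβ hβ2 ht hx)⟩
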